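/- A *-category is a $\mathbb C$-linear category with conjugate-linear involutions $f\mapsto f^*$, $\mathrm{Hom}(X,Y)\to\mathrm{Hom}(Y,X)$, such that $(g\circ f)^*=f^*\circ g^*$. A C*-category is a *-category whose hom-sets are Banach spaces with $\|g\circ f\|\le\|g\|\,\|f\|$, $\|f^*f\|=\|f\|^2$, and $f^*f\ge 0$ in the C*-algebra $\mathrm{End}(X)$ for $f:X\to Y$. It is a W*-category if each $\mathrm{Hom}(X,Y)$ is isometrically the dual of a Banach space. A *-functor is a functor that is linear on morphisms and preserves $*$. A morphism $f$ is unitary if $f^*f$ and $ff^*$ are identities. A direct sum of a finite (possibly empty) family $(X_i)$ is an object $S$ with morphisms $s_i:X_i\to S$ such that $s_i^*s_i=1_{X_i}$, $s_j^*s_i=0$ for $i\ne j$, and $\sum_i s_is_i^*=1_S$. A *direct-sum extension* of $\mathcal C$ is a fully faithful *-functor $J:\mathcal C\to\mathcal D$ such that $\mathcal D$ admits finite direct sums and every object of $\mathcal D$ is a direct sum of a finite family of objects $J(X_i)$. Let $\mathcal C$ be a C*-category. (1) $\mathcal C$ is a W*-category if and only if, for all objects $X,Y$ of $\mathcal C$,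 the *-algebra $$\begin{pmatrix}\mathrm{End}(X)&\mathrm{Hom}(Y,X)\\ \mathrm{Hom}(X,Y)&\mathrm{End}(Y)\end{pmatrix}$$ is a W*-algebra (that is, it is *-isomorphic to a W*-algebra). Suppose now that $\mathcal C$ is a W*-category. (2) For every finite family $X_1,\dots,X_n$ of objects of $\mathcal C$, the *-algebra of matrices $(a_{ij})$ with $a_{ij}\in\mathrm{Hom}(X_j,X_i)$ is a W*-algebra, in whose norm each entry space $\mathrm{Hom}(X_j,X_i)$ is isometrically embedded. (3) There is a W*-category $\mathcal D$ and a direct-sum extension $J:\mathcal C\to\mathcal D$ that is isometric on hom-spaces. (4) This extension is unique. More precisely, let $J:\mathcal C\to\mathcal D$ be a direct-sum extension with $\mathcal D$ a W*-category, and let $F:\mathcal C\to\mathcal E$ be a *-functor to a W*-category that admits finite direct sums. Then there are a *-functor $G:\mathcal D\to\mathcal E$ and a unitary natural isomorphism $\alpha:G J\cong F$. If $(G,\alpha)$ and $(G',\alpha')$ are two such pairs, there is exactly one natural transformation $\beta:G\to G'$ with $\alpha'_X\circ\beta_{J(X)}=\alpha_X$ for all objects $X$ of $\mathcal C$, and it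 is a unitary isomorphism. If $F$ is itself a direct-sum extension, then for every such pair $G$ is a unitary equivalence: it is fully faithful and every object of $\mathcal E$ is unitarily isomorphic to some $G(Y)$. -/

import Mathlib

open CategoryTheory

universe v u v₁ u₁ v₂ u₂

/-- A *-category: a complex-linear category with conjugate-linear involutions
`adj : Hom(X, Y) → Hom(Y, X)` reversing composition. -/
class StarCategory (C : Type u) [Category.{v} C] extends Preadditive C, Linear ℂ C where
  adj : ∀ {X Y : C}, (X ⟶ Y) → (Y ⟶ X)
  adj_add : ∀ {X Y : C} (f g : X ⟶ Y), adj (f + g) = adj f + adj g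
  adj_smul : ∀ {X Y : C} (c : ℂ) (f : X ⟶ Y), adj (c • f) = (starRingEnd ℂ c) • adj f
  adj_adj : ∀ {X Y : C} (f : X ⟶ Y), adj (adj f) = f
  adj_comp : ∀ {X Y Z : C} (f : X ⟶ Y) (g : Y ⟶ Z), adj (f ≫ g) = adj g ≫ adj f

/-- A C*-category: a *-category whose hom-sets are complex Banach spaces with
`‖g ∘ f‖ ≤ ‖g‖ ‖f‖`, `‖f* ∘ f‖ = ‖f‖²` and `f* ∘ f ≥ 0` in the C*-algebra `End X`
for `f : X ⟶ Y`. (Recall that `f ≫ g` is `g ∘ f`. An element of a C*-algebra is positive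
when it has the form `g* g` with `g` in that algebra.) -/
class CStarCategory (C : Type u) [Category.{v} C] extends StarCategory C where
  homNorm : ∀ X Y : C, Norm (X ⟶ Y)
  core : ∀ X Y : C, NormedSpace.Core ℂ (X ⟶ Y)
  complete : ∀ X Y : C,
    @CompleteSpace (X ⟶ Y) (NormedAddCommGroup.ofCore (core X Y)).toUniformSpace
  norm_comp_le : ∀ {X Y Z : C} (f : X ⟶ Y) (g : Y ⟶ Z), ‖f ≫ g‖ ≤ ‖g‖ * ‖f‖
  norm_comp_adj : ∀ {X Y : C} (f : X ⟶ Y), ‖f ≫ adj f‖ = ‖f‖ ^ 2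
  comp_adj_nonneg : ∀ {X Y : C} (f : X ⟶ Y), ∃ g : X ⟶ X, f ≫ adj f = g ≫ adj g

namespace CStarCategory

variable {C : Type u} [Category.{v} C] [CStarCategory C]

noncomputable instance homNormedAddCommGroup (X Y : C) : NormedAddCommGroup (X ⟶ Y) :=
  letI := homNorm X Y
  NormedAddCommGroup.ofCore (core X Y)

noncomputable instance homNormedSpace (X Y : C) : NormedSpace ℂ (X ⟶ Y) :=
  letI := homNorm X Y
  NormedSpace.ofCore (core X Y)

instance homCompleteSpace (X Y : C) : CompleteSpace (X ⟶ Y) := complete X Y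

end CStarCategory

/-- A W*-category: a C*-category each of whose hom-spaces is isometrically the dual of a
Banach space. -/
class IsWStarCategory (C : Type u) [Category.{v} C] [CStarCategory C] : Prop where
  exists_predual : ∀ X Y : C,
    ∃ (P : Type v) (_ : NormedAddCommGroup P) (_ : NormedSpace ℂ P) (_ : CompleteSpace P),
      Nonempty ((X ⟶ Y) ≃ₗᵢ[ℂ] StrongDual ℂ P)

/-- A *-algebra is a W*-algebra if it is *-isomorphic to one (the C*-norm of a *-algebra is
unique when there is one). -/
def IsWStarAlgebra (A : Type v) [Ring A] [StarRing A] [Algebra ℂ A] : Prop :=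
  ∃ (B : Type v) (_ : CStarAlgebra B) (_ : WStarAlgebra B), Nonempty (A ≃⋆ₐ[ℂ] B)

namespace StarCategory

section

variable {C : Type u} [Category.{v} C] [StarCategory C]

lemma adj_id (X : C) : adj (𝟙 X) = 𝟙 X := by
  have h := adj_comp (adj (𝟙 X)) (𝟙 X)
  rw [Category.comp_id, adj_adj, Category.comp_id] at h
  exact h.symm

/-- The adjoint as an additive map. -/
def adjHom (X Y : C) : (X ⟶ Y) →+ (Y ⟶ X) where
  toFun := adj
  map_zero' := by
    have h := adj_add (0 : X ⟶ Y) 0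
    rw [add_zero] at h
    exact left_eq_add.mp h
  map_add' := adj_add

lemma adj_sum {ι : Type*} (s : Finset ι) {X Y : C} (f : ι → (X ⟶ Y)) :
    adj (∑ i ∈ s, f i) = ∑ i ∈ s, adj (f i) :=
  map_sum (adjHom X Y) f s

lemma adj_zero (X Y : C) : adj (0 : X ⟶ Y) = 0 := map_zero (adjHom X Y)

end

set_option linter.unusedSectionVars false

/-- The matrix algebra of a family of objects: its `(i, j)` entries are the morphisms from
`X j` to `X i`. -/
def MatAlg {C : Type u} [Category.{v} C] {ι : Type*} (X : ι → C) : Type _ :=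
  ∀ i j : ι, X j ⟶ X i

namespace MatAlg

variable {C : Type u} [Category.{v} C] [StarCategory C] {ι : Type*} (X : ι → C)

instance : AddCommGroup (MatAlg X) := inferInstanceAs (AddCommGroup (∀ i j : ι, X j ⟶ X i))

instance : Module ℂ (MatAlg X) := inferInstanceAs (Module ℂ (∀ i j : ι, X j ⟶ X i))

variable {X}

@[ext] lemma ext {a b : MatAlg X} (h : ∀ i j, a i j = b i j) : a = b :=
  funext fun i => funext fun j => h i j

@[simp] lemma zero_apply (i j : ι) : (0 : MatAlg X) i j = 0 := rfl
@[simp] lemma add_apply (a b : MatAlg X) (i j : ι) : (a + b) i j = a i j + b i j := rfl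
@[simp] lemma smul_apply (c : ℂ) (a : MatAlg X) (i j : ι) : (c • a) i j = c • a i j := rfl

/-- Conjugate transpose: `(a*) i j = (a j i)*`. -/
instance : Star (MatAlg X) := ⟨fun a i j => adj (a j i)⟩

@[simp] lemma star_apply (a : MatAlg X) (i j : ι) : (star a) i j = adj (a j i) := rfl

variable [Fintype ι]

/-- Matrix multiplication: `(a b) i k = ∑ j, a i j ∘ b j k`. -/
instance : Mul (MatAlg X) := ⟨fun a b i k => ∑ j, b j k ≫ a i j⟩

lemma mul_apply (a b : MatAlg X) (i k : ι) : (a * b) i k = ∑ j, b j k ≫ a i j := rfl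

variable [DecidableEq ι]

/-- The identity matrix: identity morphisms on the diagonal, zero elsewhere. -/
instance : One (MatAlg X) :=
  ⟨fun i j => if h : j = i then eqToHom (congrArg X h) else 0⟩

lemma one_apply (i j : ι) :
    (1 : MatAlg X) i j = if h : j = i then eqToHom (congrArg X h) else 0 := rfl

lemma one_apply_self (i : ι) : (1 : MatAlg X) i i = 𝟙 (X i) := by simp [one_apply]

lemma one_apply_ne {i j : ι} (h : j ≠ i) : (1 : MatAlg X) i j = 0 := by simp [one_apply, h]

instance : Ring (MatAlg X) :=
  { (inferInstance : AddCommGroup (MatAlg X)) with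
    mul := (· * ·)
    one := 1
    mul_assoc := fun a b c => by
      ext i l
      simp only [mul_apply, Preadditive.comp_sum, Preadditive.sum_comp, Category.assoc]
      exact Finset.sum_comm
    one_mul := fun a => by
      ext i k
      rw [mul_apply, Finset.sum_eq_single i]
      · rw [one_apply_self, Category.comp_id]
      · intro j _ h
        rw [one_apply_ne h, Limits.comp_zero]
      · simp
    mul_one := fun a => by
      ext i k
      rw [mul_apply, Finset.sum_eq_single k]
      · rw [one_apply_self, Category.id_comp]
      · intro j _ h
        rw [one_apply_ne h.symm, Limits.zero_comp]
      · simp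
    left_distrib := fun a b c => by
      ext i k
      simp [mul_apply, Preadditive.add_comp, Finset.sum_add_distrib]
    right_distrib := fun a b c => by
      ext i k
      simp [mul_apply, Preadditive.comp_add, Finset.sum_add_distrib]
    zero_mul := fun a => by
      ext i k
      simp [mul_apply]
    mul_zero := fun a => by
      ext i k
      simp [mul_apply] }

instance : StarRing (MatAlg X) where
  star_involutive a := by
    ext i j
    simp [adj_adj]
  star_mul a b := by
    ext i k
    simp [mul_apply, adj_sum, adj_comp]
  star_add a b := by
    ext i j
    simp [adj_add]

instance : Algebra ℂ (MatAlg X) :=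
  Algebra.ofModule
    (fun c a b => by
      ext i k
      simp [mul_apply, Finset.smul_sum])
    (fun c a b => by
      ext i k
      simp [mul_apply, Finset.smul_sum])

instance : StarModule ℂ (MatAlg X) where
  star_smul c a := by
    ext i j
    simp [adj_smul]

end MatAlg

section DirectSums

variable {C : Type u} [Category.{v} C] [StarCategory C]

/-- `S` with the morphisms `s i : X i ⟶ S` is a direct sum of the finite family `X`:
`s i` are isometries with mutually orthogonal ranges summing to the identity of `S`. -/
structure IsDirectSum {n : ℕ} (X : Fin n → C) (S : C) (s : ∀ i, X i ⟶ S) : Prop where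
  isometry : ∀ i, s i ≫ adj (s i) = 𝟙 (X i)
  orthogonal : ∀ i j, i ≠ j → s i ≫ adj (s j) = 0
  total : ∑ i, adj (s i) ≫ s i = 𝟙 S

/-- Every finite family of objects (the empty one included) has a direct sum. -/
def HasFiniteDirectSums (C : Type u) [Category.{v} C] [StarCategory C] : Prop :=
  ∀ (n : ℕ) (X : Fin n → C), ∃ (S : C) (s : ∀ i, X i ⟶ S), IsDirectSum X S s

/-- A morphism `f` is unitary if `f* f` and `f f*` are identities. -/
def IsUnitary {X Y : C} (f : X ⟶ Y) : Prop := f ≫ adj f = 𝟙 X ∧ adj f ≫ f = 𝟙 Y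

end DirectSums

section Functors

variable {C : Type u} [Category.{v} C] [StarCategory C]
variable {D : Type u₁} [Category.{v₁} D] [StarCategory D]

/-- A *-functor: linear on morphisms and preserving adjoints. -/
structure IsStarFunctor (F : C ⥤ D) : Prop where
  map_add : ∀ {X Y : C} (f g : X ⟶ Y), F.map (f + g) = F.map f + F.map g
  map_smul : ∀ {X Y : C} (c : ℂ) (f : X ⟶ Y), F.map (c • f) = c • F.map f
  map_adj : ∀ {X Y : C} (f : X ⟶ Y), F.map (adj f) = adj (F.map f)

/-- A natural isomorphism with unitary components. -/
def IsUnitaryIso {F G : C ⥤ D} (α : F ≅ G) : Prop := ∀ X : C, IsUnitary (α.hom.app X)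

/-- A unitary equivalence of *-categories: a fully faithful *-functor such that each object of
the target is unitarily isomorphic to one in the image. -/
structure IsUnitaryEquivalence (F : C ⥤ D) : Prop where
  isStarFunctor : IsStarFunctor F
  full : F.Full
  faithful : F.Faithful
  unitarily_essSurj : ∀ Y : D, ∃ (X : C) (f : F.obj X ⟶ Y), IsUnitary f

/-- `F : C ⥤ D` extends `C` to a category with finite direct sums: `F` is a fully faithful
*-functor, `D` admits finite direct sums, and each object of `D` is a finite direct sum of
objects coming from `C` (without this last minimality, no extension could be unique). -/
structure IsDirectSumExtension (F : C ⥤ D) : Prop where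
  isStarFunctor : IsStarFunctor F
  full : F.Full
  faithful : F.Faithful
  hasFiniteDirectSums : HasFiniteDirectSums D
  generated : ∀ Y : D, ∃ (n : ℕ) (X : Fin n → C) (s : ∀ i, F.obj (X i) ⟶ Y),
    IsDirectSum (fun i => F.obj (X i)) Y s

end Functors

end StarCategory

/-! The extension is the category of finite families of objects with matrices as morphisms. A matrix
acts on columns of morphisms out of an object `Z`; these columns form a Hilbert module over `End Z`,
and the supremum over `Z` of the operator norms is a norm on matrices. Cauchy–Schwarz gives the
C*-identity (`FinFamily.norm_act_sq`). The negative part of `f* f` vanishes because inner products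
of columns are positive (`FinFamily.exists_comp_adj_eq`).

What remains of (1)–(3) is one statement about a C*-algebra `A` with orthogonal projections `e i` of
sum one: if all corners `e i A e j` are dual spaces, so is `A` (`exists_isPredualOn_of_corners`).
Conversely, corners of a dual algebra are dual (`IsPredualOn.corner_of_top`). Hom-spaces are corners
of endomorphism algebras of direct sums, so predual statements pass in both directions. Adding up
the preduals of the corners does not suffice, since it gives a dual norm that is only equivalent to
the norm of `A`. Instead preduals are handled as norming sets of functionals with weakly compact
unit ball; the Dixmier–Ng theorem (`IsPredualOn.exists_predual`) turns such a set into a Banach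
predual.

Projections are adjoined one at a time. Let `p` be the sum of those already treated and `q` the
next. An element `a` of `(p + q)A(p + q)` has coefficients `l* a h` in `pAp`, for `l`, `h` in the
right `pAp`-module `(p + q)Ap`. Coefficients of a bounded family have weak limits, and the
self-duality of `qAp` over `pAp` shows that the limits are again coefficients of an element
(`exists_lim_coefficients`). The coefficients miss only the part of `q` orthogonal to the support of
`qAp`; it is central in `(p + q)A(p + q)`, and there the predual of `qAq` serves
(`norm_le_of_coefficients`). Self-duality comes from the preduals of the off-diagonal corners
(`IsPredualOn.isSelfDualCorner`). All of this relies on multiplication being automatically weakly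
continuous on bounded families (`IsPredualOn.isWeakLim_mul`), which is proved with functional
calculus and no Hilbert space.

Part (4) is matrix algebra: a *-functor preserves direct sums, so its values on the extension are
determined by matrix entries, and these are morphisms of the original category. -/

open Filter Topology

universe w
-- Norming sets of functionals and weak limits along ultrafilters
section WeakLimits

variable {A : Type*} [NormedAddCommGroup A] [NormedSpace ℂ A]

/-- `V` is a set of functionals of norm at most one on `W` which norms `W`, and for whose weak
topology the unit ball of `W` is compact. -/
structure IsPredualOn (W : Submodule ℂ A) (V : Set (A →ₗ[ℂ] ℂ)) : Prop where
  norm_apply_le : ∀ φ ∈ V, ∀ w ∈ W, ‖φ w‖ ≤ ‖w‖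
  norming : ∀ w ∈ W, ∀ r : ℝ, 0 ≤ r → (∀ φ ∈ V, ‖φ w‖ ≤ r) → ‖w‖ ≤ r
  compact : ∀ F : Ultrafilter A, (∀ᶠ w in (F : Filter A), w ∈ W ∧ ‖w‖ ≤ 1) →
    ∃ w ∈ W, ∀ φ ∈ V, Tendsto φ F (𝓝 (φ w))

/-- The family `f` converges to `w` along `𝒰` when tested against the functionals in `V`. -/
def IsWeakLim {I : Type*} (V : Set (A →ₗ[ℂ] ℂ)) (𝒰 : Ultrafilter I) (f : I → A) (w : A) : Prop :=
  ∀ φ ∈ V, Tendsto (fun i => φ (f i)) 𝒰 (𝓝 (φ w))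

namespace IsWeakLim

variable {I : Type*} {V : Set (A →ₗ[ℂ] ℂ)} {𝒰 : Ultrafilter I} {f g : I → A} {v w : A}

lemma add (hf : IsWeakLim V 𝒰 f v) (hg : IsWeakLim V 𝒰 g w) :
    IsWeakLim V 𝒰 (fun i => f i + g i) (v + w) := fun φ hφ => by
  simpa using (hf φ hφ).add (hg φ hφ)

lemma sub (hf : IsWeakLim V 𝒰 f v) (hg : IsWeakLim V 𝒰 g w) :
    IsWeakLim V 𝒰 (fun i => f i - g i) (v - w) := fun φ hφ => by
  simpa using (hf φ hφ).sub (hg φ hφ)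

lemma smul (c : ℂ) (hf : IsWeakLim V 𝒰 f v) : IsWeakLim V 𝒰 (fun i => c • f i) (c • v) :=
  fun φ hφ => by simpa using (hf φ hφ).const_mul c

lemma const (v : A) : IsWeakLim V 𝒰 (fun _ => v) v := fun _ _ => tendsto_const_nhds

lemma sum {ι : Type*} (s : Finset ι) {F : ι → I → A} {v : ι → A}
    (h : ∀ k ∈ s, IsWeakLim V 𝒰 (F k) (v k)) :
    IsWeakLim V 𝒰 (fun i => ∑ k ∈ s, F k i) (∑ k ∈ s, v k) := fun φ hφ => by
  simpa using tendsto_finsetSum s fun k hk => h k hk φ hφ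

end IsWeakLim

namespace IsPredualOn

variable {I : Type*} {W : Submodule ℂ A} {V : Set (A →ₗ[ℂ] ℂ)} (hV : IsPredualOn W V)
  {𝒰 : Ultrafilter I} {f g : I → A} {v w : A}

include hV

/-- The norm is a supremum over `V`, hence lower semicontinuous for weak limits. -/
lemma norm_le (hw : w ∈ W) (hf : ∀ i, f i ∈ W) {r : ℝ} (hr : ∀ᶠ i in (𝒰 : Filter I), ‖f i‖ ≤ r)
    (h : IsWeakLim V 𝒰 f w) : ‖w‖ ≤ r := by
  obtain ⟨i, hi⟩ := hr.exists
  refine hV.norming w hw r ((norm_nonneg _).trans hi) fun φ hφ => ?_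
  refine le_of_tendsto (h φ hφ).norm ?_
  filter_upwards [hr] with i hi
  exact (hV.norm_apply_le φ hφ _ (hf i)).trans hi

lemma unique (hv : v ∈ W) (hw : w ∈ W) (h : IsWeakLim V 𝒰 f v) (h' : IsWeakLim V 𝒰 f w) :
    v = w := by
  have := hV.norming (v - w) (W.sub_mem hv hw) 0 le_rfl fun φ hφ => by
    rw [map_sub, tendsto_nhds_unique (h φ hφ) (h' φ hφ), sub_self, norm_zero]
  exact sub_eq_zero.mp (norm_le_zero_iff.mp this)

lemma exists_lim (𝒰 : Ultrafilter I) (hf : ∀ i, f i ∈ W) {C : ℝ} (hC : ∀ i, ‖f i‖ ≤ C) :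
    ∃ w ∈ W, IsWeakLim V 𝒰 f w := by
  -- Rescaling by `|C| + 1` puts the family in the unit ball, with a factor that is invertible even
  -- when `C = 0`.
  have hC' : 0 < |C| + 1 := by positivity
  set c : ℂ := ((|C| + 1 : ℝ) : ℂ)
  have hc : c ≠ 0 := Complex.ofReal_ne_zero.mpr hC'.ne'
  have hcn : ‖c‖ = |C| + 1 := by simp only [c, Complex.norm_real, Real.norm_eq_abs, abs_of_pos hC']
  obtain ⟨w, hw, h⟩ := hV.compact (𝒰.map fun i => c⁻¹ • f i) (by
    rw [Ultrafilter.coe_map, eventually_map]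
    refine Eventually.of_forall fun i => ⟨W.smul_mem _ (hf i), ?_⟩
    rw [norm_smul, norm_inv, hcn, inv_mul_le_iff₀ hC', mul_one]
    exact (hC i).trans ((le_abs_self C).trans (by linarith)))
  refine ⟨c • w, W.smul_mem _ hw, ?_⟩
  have h1 : IsWeakLim V 𝒰 (fun i => c⁻¹ • f i) w := fun φ hφ => by
    have := h φ hφ
    rwa [Ultrafilter.coe_map, tendsto_map'_iff] at this
  simpa [smul_smul, mul_inv_cancel₀ hc] using h1.smul c

lemma isWeakLim_of_tendsto (hw : w ∈ W) (hf : ∀ i, f i ∈ W) (h : Tendsto f 𝒰 (𝓝 w)) :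
    IsWeakLim V 𝒰 f w := fun φ hφ => by
  rw [tendsto_iff_norm_sub_tendsto_zero] at h ⊢
  refine squeeze_zero (fun _ => norm_nonneg _) (fun i => ?_) h
  rw [← map_sub]
  exact hV.norm_apply_le φ hφ _ (W.sub_mem (hf i) hw)

end IsPredualOn

end WeakLimits

/-! ### Orthogonality and its stability under weak limits -/

section Orthogonal

variable {A : Type*} [CStarAlgebra A]

lemma norm_add_sq_le_of_star_mul_eq_zero {a b : A} (h : star a * b = 0) :
    ‖a + b‖ ^ 2 ≤ ‖a‖ ^ 2 + ‖b‖ ^ 2 := by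
  have h' : star b * a = 0 := by simpa using congrArg star h
  have : star (a + b) * (a + b) = star a * a + star b * b := by
    rw [star_add, add_mul, mul_add, mul_add, h, h', add_zero, zero_add]
  rw [sq, sq, sq, ← CStarRing.norm_star_mul_self, ← CStarRing.norm_star_mul_self (x := a),
    ← CStarRing.norm_star_mul_self (x := b), this]
  exact norm_add_le _ _

lemma norm_sum_sq_le_of_star_mul_eq_zero {ι : Type*} (s : Finset ι) (e : ι → A)
    (h : ∀ i ∈ s, ∀ j ∈ s, i ≠ j → star (e i) * e j = 0) :
    ‖∑ i ∈ s, e i‖ ^ 2 ≤ ∑ i ∈ s, ‖e i‖ ^ 2 := by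
  classical
  induction s using Finset.induction_on with
  | empty => simp
  | insert a s ha ih =>
    rw [Finset.sum_insert ha, Finset.sum_insert ha]
    refine (norm_add_sq_le_of_star_mul_eq_zero ?_).trans
      (add_le_add le_rfl (ih fun i hi j hj => h i (by simp [hi]) j (by simp [hj])))
    rw [Finset.mul_sum]
    exact Finset.sum_eq_zero fun j hj => h a (by simp) j (by simp [hj]) (by rintro rfl; exact ha hj)

/-- With `b = g² y`, expanding gives `(y + t b)*(y + t b) = y* y + 2t y* g² y + t² b* b`, and `b* b
= y* g⁴ y ≤ y* g² y` because `g² ≤ 1`. The gain over Pythagoras is the term linear in `t`. -/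
lemma mul_norm_sq_le_of_selfAdjoint {g y : A} (hg : IsSelfAdjoint g) (hg1 : ‖g‖ ≤ 1) {t : ℝ}
    (ht : 0 ≤ t) : (2 * t + t ^ 2) * ‖g * (g * y)‖ ^ 2 ≤ ‖y + (t : ℂ) • (g * (g * y))‖ ^ 2 := by
  let _ := CStarAlgebra.spectralOrder A
  have := CStarAlgebra.spectralOrderedRing A
  have hs : ∀ z : A, ‖z‖ ^ 2 = ‖star z * z‖ := fun z => by rw [CStarRing.norm_star_mul_self, sq]
  have hgs : star g = g := hg
  have hle : g * g ≤ 1 := by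
    have h1 := CStarAlgebra.star_mul_le_algebraMap_norm_sq (a := g)
    rw [hgs] at h1
    refine h1.trans ?_
    have : algebraMap ℝ A (‖g‖ ^ 2) ≤ algebraMap ℝ A 1 :=
      algebraMap_mono A (by nlinarith [norm_nonneg g])
    simpa using this
  have h4 : g * g * g * g ≤ g * g := by
    have := star_left_conjugate_le_conjugate hle g
    simpa [hgs, mul_assoc] using this
  set b : A := g * (g * y) with hb
  have hbb : star b * b = star y * (g * g * g * g) * y := by
    simp [hb, hgs, mul_assoc]
  have hyb : star y * b = star y * (g * g) * y := by simp [hb, mul_assoc]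
  have hby : star b * y = star y * (g * g) * y := by simp [hb, hgs, mul_assoc]
  have h5 : star b * b ≤ star y * (g * g) * y := hbb ▸ star_left_conjugate_le_conjugate h4 y
  have key : (2 * t + t ^ 2) • (star b * b) ≤
      star (y + (t : ℂ) • b) * (y + (t : ℂ) • b) := by
    have hexp : star (y + (t : ℂ) • b) * (y + (t : ℂ) • b) =
        star y * y + (2 * t) • (star y * (g * g) * y) + t ^ 2 • (star b * b) := by
      have e : ((t : ℂ) • b) = t • b := by simp
      rw [e, star_add, star_smul, add_mul, mul_add, mul_add, smul_mul_assoc, mul_smul_comm,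
        smul_mul_smul_comm, hyb, hby, star_trivial t]
      module
    rw [hexp, add_smul, add_assoc]
    refine le_add_of_nonneg_of_le (star_mul_self_nonneg y) ?_
    gcongr
  have h6 := CStarAlgebra.norm_le_norm_of_nonneg_of_le
    (smul_nonneg (by positivity) (star_mul_self_nonneg b)) key
  rw [norm_smul, Real.norm_of_nonneg (by positivity)] at h6
  rwa [hs, hs]

variable {I : Type*} {W : Submodule ℂ A} {V : Set (A →ₗ[ℂ] ℂ)}

/-- With `b = g² y`, every `f x i` is orthogonal to `b`, so `‖f x i + t b‖² ≤ C² + t² ‖b‖²`. Lower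
semicontinuity passes this bound to `y + t b`, whose squared norm is at least `(2t + t²) ‖b‖²`.
Letting `t` grow forces `b = 0`, and then `(g y)*(g y) = y* b = 0`. -/
lemma IsPredualOn.mul_eq_zero_of_mul_eq_zero (hV : IsPredualOn W V) {𝒰 : Ultrafilter I} {f g : A}
    (hf : IsSelfAdjoint f) (hg : IsSelfAdjoint g) (hf1 : ‖f‖ ≤ 1) (hg1 : ‖g‖ ≤ 1) (hfg : f * g = 0)
    (hfW : ∀ w ∈ W, f * w ∈ W) (hgW : ∀ w ∈ W, g * w ∈ W) {x : I → A} {y : A} {C : ℝ}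
    (hx : ∀ i, x i ∈ W) (hC : ∀ i, ‖x i‖ ≤ C) (hy : y ∈ W)
    (h : IsWeakLim V 𝒰 (fun i => f * x i) y) : g * y = 0 := by
  have hfs : star f = f := hf
  set b : A := g * (g * y) with hb
  have hbW : b ∈ W := hgW _ (hgW _ hy)
  have hsq : ∀ t : ℝ, 0 ≤ t → ‖y + (t : ℂ) • b‖ ^ 2 ≤ C ^ 2 + t ^ 2 * ‖b‖ ^ 2 := by
    intro t ht
    have hbound : ∀ i, ‖f * x i + (t : ℂ) • b‖ ≤ √(C ^ 2 + t ^ 2 * ‖b‖ ^ 2) := fun i => by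
      refine Real.le_sqrt_of_sq_le ?_
      refine (norm_add_sq_le_of_star_mul_eq_zero ?_).trans ?_
      · rw [star_mul, hfs, mul_smul_comm, hb, mul_assoc, ← mul_assoc f g, hfg, zero_mul, mul_zero,
          smul_zero]
      · rw [norm_smul, mul_pow, Complex.norm_real, Real.norm_eq_abs, sq_abs]
        have h1 : ‖f * x i‖ ≤ C := (norm_mul_le _ _).trans
          ((mul_le_mul hf1 (hC i) (norm_nonneg _) zero_le_one).trans_eq (one_mul C))
        gcongr
    have := hV.norm_le (𝒰 := 𝒰) (W.add_mem hy (W.smul_mem (t : ℂ) hbW))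
      (fun i => W.add_mem (hfW _ (hx i)) (W.smul_mem (t : ℂ) hbW)) (Eventually.of_forall hbound)
      (h.add (IsWeakLim.const ((t : ℂ) • b)))
    calc _ ≤ (√(C ^ 2 + t ^ 2 * ‖b‖ ^ 2)) ^ 2 := by gcongr
      _ = _ := Real.sq_sqrt (by positivity)
  have hb0 : ‖b‖ ^ 2 = 0 := by
    by_contra hne
    have hpos : 0 < ‖b‖ ^ 2 := lt_of_le_of_ne (by positivity) (Ne.symm hne)
    -- This value of `t` makes the linear term equal to `2 (C² + 1)`, which exceeds `C²`.
    have ht : 0 ≤ (C ^ 2 + 1) / ‖b‖ ^ 2 := by positivity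
    have h1 := (mul_norm_sq_le_of_selfAdjoint (y := y) hg hg1 ht).trans (hsq _ ht)
    rw [add_mul] at h1
    have h2 : 2 * ((C ^ 2 + 1) / ‖b‖ ^ 2) * ‖b‖ ^ 2 ≤ C ^ 2 := by linarith
    rw [mul_assoc, div_mul_cancel₀ _ hne] at h2
    nlinarith [sq_nonneg C]
  have hb1 : b = 0 := by simpa using hb0
  have : star (g * y) * (g * y) = 0 := by
    rw [star_mul, show star g = g from hg, mul_assoc, ← hb, hb1, mul_zero]
  exact CStarRing.star_mul_self_eq_zero_iff _ |>.mp this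

/-- The elements of `A` which, together with their adjoints, leave `W` invariant under left
multiplication. -/
def leftStabilizer (W : Submodule ℂ A) : StarSubalgebra ℂ A where
  carrier := {a | ∀ w ∈ W, a * w ∈ W ∧ star a * w ∈ W}
  mul_mem' {a b} ha hb w hw := by
    rw [star_mul, mul_assoc, mul_assoc]
    exact ⟨(ha _ (hb w hw).1).1, (hb _ (ha w hw).2).2⟩
  add_mem' {a b} ha hb w hw := by
    rw [star_add, add_mul, add_mul]
    exact ⟨W.add_mem (ha w hw).1 (hb w hw).1, W.add_mem (ha w hw).2 (hb w hw).2⟩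
  algebraMap_mem' r w hw := by
    rw [← algebraMap_star_comm, ← Algebra.smul_def, ← Algebra.smul_def]
    exact ⟨W.smul_mem _ hw, W.smul_mem _ hw⟩
  star_mem' {a} ha w hw := by
    rw [star_star]
    exact ⟨(ha w hw).2, (ha w hw).1⟩

lemma mem_leftStabilizer {a : A} :
    a ∈ leftStabilizer W ↔ ∀ w ∈ W, a * w ∈ W ∧ star a * w ∈ W := Iff.rfl

lemma isClosed_leftStabilizer (hW : IsClosed (W : Set A)) :
    IsClosed (leftStabilizer W : Set A) := by
  have : (leftStabilizer W : Set A) =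
      ⋂ w ∈ W, ((fun a : A => a * w) ⁻¹' (W : Set A) ∩ (fun a : A => star a * w) ⁻¹' (W : Set A)) := by
    ext a
    simp [mem_leftStabilizer]
  rw [this]
  exact isClosed_biInter fun w _ => (hW.preimage (by fun_prop)).inter (hW.preimage (by fun_prop))

lemma cfc_mem_leftStabilizer (hW : IsClosed (W : Set A)) (f : ℝ → ℝ) {a : A}
    (ha : a ∈ leftStabilizer W) : cfc f a ∈ leftStabilizer W :=
  cfc_mem (hs := isClosed_leftStabilizer hW) f ha

end Orthogonal

/-! ### Weak continuity of left multiplication -/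

section ModuleProperty

/-- Each term is the part of `[0, s]` in the slice `[k, k + 1]`. Under functional calculus this cuts
`N h` into `N` positive contractions. -/
lemma sum_clamp (s : ℝ) (hs : 0 ≤ s) (N : ℕ) :
    ∑ k ∈ Finset.range N, max 0 (min 1 (s - k)) = min s N := by
  induction N with
  | zero => simp [hs]
  | succ N ih =>
    rw [Finset.sum_range_succ, ih]
    push_cast
    grind

variable {A : Type*} [CStarAlgebra A] {I : Type*} {W : Submodule ℂ A} {V : Set (A →ₗ[ℂ] ℂ)}

/-- Slice `N h = ∑ R k` so that `R k (1 - R l) = 0` for `l < k`. Weak limits `y k` of `R k x i`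
inherit these orthogonality relations. Hence `N` times the error `h w - w'` is a difference of two
sums of `N` mutually orthogonal terms of norm at most `C`. Its norm is at most `2 √N C`, so the
error is at most `2 C / √N` for every `N`. -/
lemma IsPredualOn.isWeakLim_mul_of_spectrum (hV : IsPredualOn W V) (hW : IsClosed (W : Set A))
    {𝒰 : Ultrafilter I} {h : A} (hh : IsSelfAdjoint h) (hspec : spectrum ℝ h ⊆ Set.Icc 0 1)
    (hmem : h ∈ leftStabilizer W) {x : I → A} {w : A} {C : ℝ} (hx : ∀ i, x i ∈ W)
    (hC : ∀ i, ‖x i‖ ≤ C) (hw : w ∈ W) (hlim : IsWeakLim V 𝒰 x w) :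
    IsWeakLim V 𝒰 (fun i => h * x i) (h * w) := by
  have hC0 : 0 ≤ C := by
    obtain ⟨i⟩ := 𝒰.neBot.nonempty
    exact (norm_nonneg _).trans (hC i)
  have hstab : ∀ {a : A}, a ∈ leftStabilizer W → ∀ w ∈ W, a * w ∈ W := fun ha w hw => (ha w hw).1
  obtain ⟨w', hw', hlim'⟩ := hV.exists_lim 𝒰 (f := fun i => h * x i) (C := ‖h‖ * C)
    (fun i => hstab hmem _ (hx i))
    (fun i => (norm_mul_le _ _).trans (mul_le_mul_of_nonneg_left (hC i) (norm_nonneg _)))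
  suffices hkey : ∀ N : ℕ, 0 < N → (N : ℝ) * ‖h * w - w'‖ ^ 2 ≤ 4 * C ^ 2 by
    have hz : h * w = w' := by
      by_contra hne
      have hpos : 0 < ‖h * w - w'‖ ^ 2 := by
        have := norm_pos_iff.mpr (sub_ne_zero.mpr hne)
        positivity
      obtain ⟨N, hN⟩ := exists_nat_gt (4 * C ^ 2 / ‖h * w - w'‖ ^ 2)
      rw [div_lt_iff₀ hpos] at hN
      have hN0 : 0 < N := by
        rcases Nat.eq_zero_or_pos N with rfl | h0
        · simp only [Nat.cast_zero, zero_mul] at hN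
          nlinarith [sq_nonneg C]
        · exact h0
      linarith [hkey N hN0]
    rwa [hz]
  intro N hN
  have hN' : (0 : ℝ) < N := by exact_mod_cast hN
  set r : ℕ → ℝ → ℝ := fun k t => max 0 (min 1 (N * t - k)) with hr
  have hrc : ∀ k, Continuous (r k) := fun k => by simp only [hr]; fun_prop
  have hr0 : ∀ k t, 0 ≤ r k t := fun k t => le_max_left _ _
  have hr1 : ∀ k t, r k t ≤ 1 := fun k t => max_le zero_le_one (min_le_left _ _)
  set R : ℕ → A := fun k => cfc (r k) h with hR
  have hRsa : ∀ k, IsSelfAdjoint (R k) := fun k => cfc_predicate _ _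
  have hR1sa : ∀ k, IsSelfAdjoint (1 - R k) := fun k => (IsSelfAdjoint.one A).sub (hRsa k)
  have hsub : ∀ k, 1 - R k = cfc (fun t => 1 - r k t) h := fun k => by
    rw [cfc_sub (fun _ => 1) (r k) h (by fun_prop) (hrc k).continuousOn, cfc_const_one ℝ h]
  have hRn : ∀ k, ‖R k‖ ≤ 1 := fun k => norm_cfc_le zero_le_one fun t _ => by
    rw [Real.norm_of_nonneg (hr0 k t)]
    exact hr1 k t
  have hR1n : ∀ k, ‖1 - R k‖ ≤ 1 := fun k => by
    rw [hsub]
    refine norm_cfc_le zero_le_one fun t _ => ?_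
    rw [Real.norm_of_nonneg (by linarith [hr1 k t])]
    linarith [hr0 k t]
  have hRm : ∀ k, R k ∈ leftStabilizer W := fun k => cfc_mem_leftStabilizer hW _ hmem
  have hR1m : ∀ k, 1 - R k ∈ leftStabilizer W := fun k =>
    sub_mem (one_mem _) (hRm k)
  have hcomm : ∀ k l, R k * R l = R l * R k := fun k l => cfc_commute_cfc _ _ _
  -- Where slice `k` is nonzero, `N t > k ≥ l + 1`, so slice `l` is already full.
  have horth : ∀ k l, l < k → R k * (1 - R l) = 0 := fun k l hlk => by
    rw [hsub, hR]
    dsimp only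
    rw [← cfc_mul (r k) (fun t => 1 - r l t) h (hrc k).continuousOn
      ((continuous_const.sub (hrc l)).continuousOn)]
    convert cfc_const_zero ℝ h using 2
    ext t
    have : (l : ℝ) + 1 ≤ k := by exact_mod_cast hlk
    simp only [hr]
    rcases le_total (N * t - k) 0 with h1 | h1
    · rw [min_eq_right (h1.trans zero_le_one), max_eq_left h1, zero_mul]
    · rw [min_eq_left (by linarith : (1 : ℝ) ≤ N * t - l), max_eq_right zero_le_one, sub_self,
        mul_zero]
  have horth' : ∀ k l, l < k → (1 - R l) * R k = 0 := fun k l hlk => by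
    rw [← horth k l hlk, sub_mul, mul_sub, one_mul, mul_one, hcomm]
  have hsum : (N : ℂ) • h = ∑ k ∈ Finset.range N, R k := by
    simp only [hR]
    rw [← cfc_sum r h (Finset.range N) (fun k _ => (hrc k).continuousOn)]
    have : (N : ℂ) • h = cfc (fun t : ℝ => (N : ℝ) * t) h := by
      rw [cfc_const_mul_id (N : ℝ) h, Nat.cast_smul_eq_nsmul, Nat.cast_smul_eq_nsmul]
    rw [this]
    refine cfc_congr fun t ht => ?_
    have ht' := hspec ht
    rw [Finset.sum_apply]
    simp only [hr]
    rw [sum_clamp _ (mul_nonneg hN'.le ht'.1), min_eq_left]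
    exact mul_le_of_le_one_right hN'.le ht'.2
  have hRx : ∀ k i, ‖R k * x i‖ ≤ C := fun k i => (norm_mul_le _ _).trans
    ((mul_le_mul (hRn k) (hC i) (norm_nonneg _) zero_le_one).trans_eq (one_mul C))
  have hR1x : ∀ k i, ‖(1 - R k) * x i‖ ≤ C := fun k i => (norm_mul_le _ _).trans
    ((mul_le_mul (hR1n k) (hC i) (norm_nonneg _) zero_le_one).trans_eq (one_mul C))
  choose y hyW hy using fun k => hV.exists_lim 𝒰 (f := fun i => R k * x i)
    (fun i => hstab (hRm k) _ (hx i)) (hRx k)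
  have hy' : ∀ k, IsWeakLim V 𝒰 (fun i => (1 - R k) * x i) (w - y k) := fun k => by
    simpa only [sub_mul, one_mul] using hlim.sub (hy k)
  have hyn : ∀ k, ‖y k‖ ≤ C := fun k => hV.norm_le (hyW k) (fun i => hstab (hRm k) _ (hx i))
    (Eventually.of_forall (hRx k)) (hy k)
  have hyn' : ∀ k, ‖w - y k‖ ≤ C := fun k => hV.norm_le (W.sub_mem hw (hyW k))
    (fun i => hstab (hR1m k) _ (hx i)) (Eventually.of_forall (hR1x k)) (hy' k)
  have ho1 : ∀ k l, l < k → R k * (w - y l) = 0 := fun k l hlk =>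
    hV.mul_eq_zero_of_mul_eq_zero (hR1sa l) (hRsa k) (hR1n l) (hRn k) (horth' k l hlk)
      (hstab (hR1m l)) (hstab (hRm k)) hx hC (W.sub_mem hw (hyW l)) (hy' l)
  have ho2 : ∀ k l, l < k → (1 - R l) * y k = 0 := fun k l hlk =>
    hV.mul_eq_zero_of_mul_eq_zero (hRsa k) (hR1sa l) (hRn k) (hR1n l) (horth k l hlk)
      (hstab (hRm k)) (hstab (hR1m l)) hx hC (hyW k) (hy k)
  -- Orthogonality improves the trivial bound `N C` to `√N C`.
  have key : ∀ e : ℕ → A, (∀ k, ‖e k‖ ≤ C) → (∀ k l, l < k → star (e k) * e l = 0) →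
      ‖∑ k ∈ Finset.range N, e k‖ ≤ √N * C := fun e he hort => by
    refine abs_le_of_sq_le_sq' ?_ (by positivity) |>.2
    refine (norm_sum_sq_le_of_star_mul_eq_zero _ e fun i _ j _ hij => ?_).trans ?_
    · rcases lt_or_gt_of_ne hij with hlt | hlt
      · simpa using congrArg star (hort j i hlt)
      · exact hort i j hlt
    · rw [mul_pow, Real.sq_sqrt hN'.le]
      refine (Finset.sum_le_sum fun k _ => pow_le_pow_left₀ (norm_nonneg _) (he k) 2).trans ?_
      simp
  have h1 := key (fun k => R k * (w - y k)) (fun k => (norm_mul_le _ _).trans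
      ((mul_le_mul (hRn k) (hyn' k) (norm_nonneg _) zero_le_one).trans_eq (one_mul C)))
    fun k l hlk => by
      rw [star_mul, (hRsa k).star_eq, mul_assoc, ← mul_assoc (R k), hcomm, mul_assoc (R l),
        ho1 k l hlk, mul_zero, mul_zero]
  have h2 := key (fun k => (1 - R k) * y k) (fun k => (norm_mul_le _ _).trans
      ((mul_le_mul (hR1n k) (hyn k) (norm_nonneg _) zero_le_one).trans_eq (one_mul C)))
    fun k l hlk => by
      have hc : (1 - R k) * (1 - R l) = (1 - R l) * (1 - R k) := by
        simp only [sub_mul, mul_sub, one_mul, mul_one, hcomm k l]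
        abel
      have := congrArg star (ho2 k l hlk)
      rw [star_mul, star_zero, (hR1sa l).star_eq] at this
      rw [star_mul, (hR1sa k).star_eq, mul_assoc, ← mul_assoc (1 - R k), hc, ← mul_assoc,
        ← mul_assoc, this, zero_mul, zero_mul]
  have hw'N : (N : ℂ) • w' = ∑ k ∈ Finset.range N, y k := by
    refine hV.unique (𝒰 := 𝒰) (W.smul_mem _ hw') (W.sum_mem fun k _ => hyW k)
      (hlim'.smul (N : ℂ)) ?_
    have := IsWeakLim.sum (Finset.range N) fun k _ => hy k
    simpa only [← smul_mul_assoc, hsum, Finset.sum_mul] using this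
  -- Termwise, `R k w - y k = R k (w - y k) - (1 - R k) y k`.
  have hdiff : (N : ℂ) • (h * w - w') = ∑ k ∈ Finset.range N, R k * (w - y k) -
      ∑ k ∈ Finset.range N, (1 - R k) * y k := by
    rw [smul_sub, ← smul_mul_assoc, hsum, hw'N, Finset.sum_mul, ← Finset.sum_sub_distrib,
      ← Finset.sum_sub_distrib]
    refine Finset.sum_congr rfl fun k _ => ?_
    rw [mul_sub, sub_mul, one_mul]
    abel
  have h3 : (N : ℝ) * ‖h * w - w'‖ ≤ 2 * (√N * C) := by
    have := congrArg norm hdiff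
    rw [norm_smul, Complex.norm_natCast] at this
    rw [this]
    refine (norm_sub_le _ _).trans ?_
    linarith
  have h4 : ((N : ℝ) * ‖h * w - w'‖) ^ 2 ≤ (2 * (√N * C)) ^ 2 := by gcongr
  have h5 : (2 * (√N * C)) ^ 2 = N * (4 * C ^ 2) := by
    rw [mul_pow, mul_pow, Real.sq_sqrt hN'.le]; ring
  rw [h5, mul_pow, sq (N : ℝ), mul_assoc] at h4
  exact le_of_mul_le_mul_left h4 hN'

/-- Left multiplication by an element whose left multiplication, together with that of its
adjoint, preserves `W` commutes with weak limits of bounded families. -/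
theorem IsPredualOn.isWeakLim_mul (hV : IsPredualOn W V) (hW : IsClosed (W : Set A))
    {𝒰 : Ultrafilter I} {a : A} (hmem : a ∈ leftStabilizer W) {x : I → A} {w : A} {C : ℝ}
    (hx : ∀ i, x i ∈ W) (hC : ∀ i, ‖x i‖ ≤ C) (hw : w ∈ W) (hlim : IsWeakLim V 𝒰 x w) :
    IsWeakLim V 𝒰 (fun i => a * x i) (a * w) := by
  let _ := CStarAlgebra.spectralOrder A
  have := CStarAlgebra.spectralOrderedRing A
  have hsa : ∀ h : A, IsSelfAdjoint h → h ∈ leftStabilizer W →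
      IsWeakLim V 𝒰 (fun i => h * x i) (h * w) := by
    intro h hh hm
    -- The affine change `k = (h + M) / (2M)` moves the spectrum into `[0, 1]`; the added one keeps
    -- `M` positive when `h = 0`.
    set M : ℝ := ‖h‖ + 1 with hM
    have hM0 : 0 < M := by positivity
    set k : A := cfc (fun t : ℝ => (2 * M)⁻¹ * (t + M)) h with hk
    have hkm : k ∈ leftStabilizer W := cfc_mem_leftStabilizer hW _ hm
    have hspec : spectrum ℝ k ⊆ Set.Icc 0 1 := by
      rw [hk, cfc_map_spectrum (fun t : ℝ => (2 * M)⁻¹ * (t + M)) h]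
      rintro _ ⟨t, ht, rfl⟩
      have : Nontrivial A := by
        by_contra hnt
        have := not_nontrivial_iff_subsingleton.mp hnt
        simp [spectrum.of_subsingleton] at ht
      have h1 := (abs_le.mp (spectrum.norm_le_norm_of_mem ht))
      have h2 : -M ≤ t ∧ t ≤ M := ⟨by linarith [h1.1], by linarith [h1.2]⟩
      refine ⟨mul_nonneg (by positivity) (by linarith), ?_⟩
      dsimp only
      rw [inv_mul_le_iff₀ (by positivity)]
      linarith
    have hk' : h = ((2 * M : ℝ) : ℂ) • k - ((M : ℝ) : ℂ) • 1 := by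
      have e1 : k = (2 * M)⁻¹ • (h + algebraMap ℝ A M) := by
        rw [hk, cfc_const_mul _ (fun t : ℝ => t + M) h, cfc_add_const M (fun t : ℝ => t) h,
          cfc_id' ℝ h]
      rw [Complex.coe_smul, Complex.coe_smul, e1, smul_smul, mul_inv_cancel₀ (by positivity),
        one_smul, Algebra.algebraMap_eq_smul_one, add_sub_cancel_right]
    have := ((hV.isWeakLim_mul_of_spectrum hW (cfc_predicate _ _) hspec hkm hx hC hw hlim).smul
      ((2 * M : ℝ) : ℂ)).sub (hlim.smul ((M : ℝ) : ℂ))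
    rw [hk']
    simpa only [sub_mul, smul_mul_assoc, one_mul] using this
  have hsm : star a ∈ leftStabilizer W := star_mem hmem
  have hre : ((realPart a : selfAdjoint A) : A) ∈ leftStabilizer W := by
    rw [realPart_apply_coe, ← Complex.coe_smul]
    exact SMulMemClass.smul_mem _ (add_mem hmem hsm)
  have him : ((imaginaryPart a : selfAdjoint A) : A) ∈ leftStabilizer W := by
    rw [imaginaryPart_apply_coe, ← Complex.coe_smul]
    exact SMulMemClass.smul_mem _ (SMulMemClass.smul_mem _ (sub_mem hmem hsm))
  have := (hsa _ (realPart a).2 hre).add ((hsa _ (imaginaryPart a).2 him).smul Complex.I)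
  have h2 := realPart_add_I_smul_imaginaryPart a
  simpa only [← smul_mul_assoc, ← add_mul, h2] using this

end ModuleProperty

/-! ### Right multiplication, by passing to adjoints -/

section RightModule

variable {A : Type*} [CStarAlgebra A] {I : Type*} {W : Submodule ℂ A} {V : Set (A →ₗ[ℂ] ℂ)}

/-- The adjoints of the elements of `W`. -/
def starSubmodule (W : Submodule ℂ A) : Submodule ℂ A where
  carrier := {a | star a ∈ W}
  add_mem' {a b} ha hb := by
    rw [Set.mem_ofPred_eq, star_add]
    exact W.add_mem ha hb
  zero_mem' := by simp
  smul_mem' c a ha := by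
    rw [Set.mem_ofPred_eq, star_smul]
    exact W.smul_mem _ ha

lemma mem_starSubmodule {a : A} : a ∈ starSubmodule W ↔ star a ∈ W := Iff.rfl

/-- The functionals `a ↦ conj (φ (a*))` for `φ` in `V`. -/
def starFunctionals (V : Set (A →ₗ[ℂ] ℂ)) : Set (A →ₗ[ℂ] ℂ) :=
  {ψ | ∃ φ ∈ V, ∀ a, ψ a = starRingEnd ℂ (φ (star a))}

lemma exists_starFunctional {φ : A →ₗ[ℂ] ℂ} (hφ : φ ∈ V) :
    ∃ ψ ∈ starFunctionals V, ∀ a, ψ a = starRingEnd ℂ (φ (star a)) := by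
  let ψ : A →ₗ[ℂ] ℂ :=
    { toFun := fun a => starRingEnd ℂ (φ (star a))
      map_add' := fun a b => by simp
      map_smul' := fun c a => by simp [star_smul] }
  exact ⟨ψ, ⟨φ, hφ, fun _ => rfl⟩, fun _ => rfl⟩

lemma isWeakLim_starFunctionals {𝒰 : Ultrafilter I} {f : I → A} {w : A} :
    IsWeakLim (starFunctionals V) 𝒰 (fun i => star (f i)) (star w) ↔ IsWeakLim V 𝒰 f w := by
  constructor
  · intro h φ hφ
    obtain ⟨ψ, hψ, hψφ⟩ := exists_starFunctional hφ
    have := ((Complex.continuous_conj.tendsto _).comp (h ψ hψ))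
    simpa [Function.comp_def, hψφ] using this
  · rintro h ψ ⟨φ, hφ, hψφ⟩
    have := ((Complex.continuous_conj.tendsto _).comp (h φ hφ))
    simpa [Function.comp_def, hψφ] using this

lemma IsPredualOn.starFunctionals (hV : IsPredualOn W V) :
    IsPredualOn (starSubmodule W) (_root_.starFunctionals V) where
  norm_apply_le := by
    rintro ψ ⟨φ, hφ, hψφ⟩ w hw
    rw [hψφ, RCLike.norm_conj, ← norm_star w]
    exact hV.norm_apply_le φ hφ _ hw
  norming w hw r hr h := by
    rw [← norm_star w]
    refine hV.norming _ hw r hr fun φ hφ => ?_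
    obtain ⟨ψ, hψ, hψφ⟩ := exists_starFunctional hφ
    have := h ψ hψ
    rwa [hψφ, RCLike.norm_conj] at this
  compact F hF := by
    obtain ⟨w, hw, h⟩ := hV.compact (F.map Star.star) (by
      rw [Ultrafilter.coe_map, eventually_map]
      filter_upwards [hF] with w hw
      exact ⟨hw.1, by simpa using hw.2⟩)
    refine ⟨Star.star w, by rwa [mem_starSubmodule, star_star], ?_⟩
    have h1 : IsWeakLim V F (fun a => Star.star a) w := fun φ hφ => by
      have := h φ hφ
      rwa [Ultrafilter.coe_map, tendsto_map'_iff] at this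
    have := isWeakLim_starFunctionals.mpr h1
    simp only [star_star] at this
    exact this

theorem IsPredualOn.isWeakLim_mul_right (hV : IsPredualOn W V) (hW : IsClosed (W : Set A))
    {𝒰 : Ultrafilter I} {a : A} (hmem : ∀ w ∈ W, w * a ∈ W ∧ w * star a ∈ W) {x : I → A} {w : A}
    {C : ℝ} (hx : ∀ i, x i ∈ W) (hC : ∀ i, ‖x i‖ ≤ C) (hw : w ∈ W) (hlim : IsWeakLim V 𝒰 x w) :
    IsWeakLim V 𝒰 (fun i => x i * a) (w * a) := by
  have hW' : IsClosed (starSubmodule W : Set A) := hW.preimage continuous_star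
  have := hV.starFunctionals.isWeakLim_mul (a := star a) (x := fun i => star (x i)) (w := star w) (C := C)
    (𝒰 := 𝒰) hW'
    (fun v hv => by
      rw [mem_starSubmodule] at hv
      rw [mem_starSubmodule, mem_starSubmodule, star_mul, star_mul, star_star]
      exact hmem _ hv)
    (fun i => by rw [mem_starSubmodule, star_star]; exact hx i)
    (fun i => by rw [norm_star]; exact hC i) (by rwa [mem_starSubmodule, star_star])
    (isWeakLim_starFunctionals.mpr hlim)
  simp only [← star_mul] at this
  exact isWeakLim_starFunctionals.mp this

end RightModule

/-! ### Corners `q A p` -/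

section Corner

variable {A : Type*} [CStarAlgebra A]

/-- The elements `x` with `q x = x = x p`. -/
def corner (q p : A) : Submodule ℂ A where
  carrier := {x | q * x = x ∧ x * p = x}
  add_mem' {a b} ha hb := by
    simp only [Set.mem_ofPred_eq, mul_add, add_mul, ha.1, ha.2, hb.1, hb.2, and_self]
  zero_mem' := by simp
  smul_mem' c a ha := by
    simp only [Set.mem_ofPred_eq, mul_smul_comm, smul_mul_assoc, ha.1, ha.2, and_self]

variable {p q r x y : A}

lemma mem_corner : x ∈ corner q p ↔ q * x = x ∧ x * p = x := Iff.rfl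

lemma isClosed_corner (q p : A) : IsClosed (corner q p : Set A) := by
  have : (corner q p : Set A) = {x | q * x = x} ∩ {x | x * p = x} := rfl
  rw [this]
  exact (isClosed_eq (by fun_prop) continuous_id).inter (isClosed_eq (by fun_prop) continuous_id)

lemma mul_mem_corner {s : A} (hx : x ∈ corner q p) (hy : y ∈ corner s r) : x * y ∈ corner q r :=
  ⟨by rw [← mul_assoc, hx.1], by rw [mul_assoc, hy.2]⟩

lemma star_mem_corner (hq : IsStarProjection q) (hp : IsStarProjection p) (hx : x ∈ corner q p) :
    star x ∈ corner p q :=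
  ⟨by simpa [hp.isSelfAdjoint.star_eq] using congrArg star hx.2,
    by simpa [hq.isSelfAdjoint.star_eq] using congrArg star hx.1⟩

lemma compress_mem_corner (hq : IsStarProjection q) (hp : IsStarProjection p) (x : A) :
    q * x * p ∈ corner q p :=
  ⟨by rw [← mul_assoc, ← mul_assoc, hq.isIdempotentElem.eq],
    by rw [mul_assoc, hp.isIdempotentElem.eq]⟩

lemma mem_leftStabilizer_corner (hq : IsStarProjection q) (hx : x ∈ corner q q) :
    x ∈ leftStabilizer (corner q p) := fun _ hw =>
  ⟨mul_mem_corner hx hw, mul_mem_corner (star_mem_corner hq hq hx) hw⟩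

variable {I : Type*} {V : Set (A →ₗ[ℂ] ℂ)} {𝒰 : Ultrafilter I} {f : I → A} {w : A} {C : ℝ}

lemma IsPredualOn.corner_mul (hV : IsPredualOn (corner q p) V) (hq : IsStarProjection q)
    (hx : x ∈ corner q q) (hf : ∀ i, f i ∈ corner q p) (hC : ∀ i, ‖f i‖ ≤ C)
    (hw : w ∈ corner q p) (hlim : IsWeakLim V 𝒰 f w) : IsWeakLim V 𝒰 (fun i => x * f i) (x * w) :=
  hV.isWeakLim_mul (isClosed_corner q p) (mem_leftStabilizer_corner hq hx) hf hC hw hlim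

lemma IsPredualOn.corner_mul_right (hV : IsPredualOn (corner q p) V) (hp : IsStarProjection p)
    (hx : x ∈ corner p p) (hf : ∀ i, f i ∈ corner q p) (hC : ∀ i, ‖f i‖ ≤ C)
    (hw : w ∈ corner q p) (hlim : IsWeakLim V 𝒰 f w) : IsWeakLim V 𝒰 (fun i => f i * x) (w * x) :=
  hV.isWeakLim_mul_right (isClosed_corner q p)
    (fun _ hw => ⟨mul_mem_corner hw hx, mul_mem_corner hw (star_mem_corner hp hp hx)⟩) hf hC hw hlim

end Corner

/-! ### Approximate units of corners -/

section Frames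

variable {A : Type*} [CStarAlgebra A] {p q : A}

/-- For the resolvent `R = (ε + h)⁻¹` one has `R h - 1 = -ε R`. If `x x* ≤ h`, then `‖R h x - x‖² ≤
‖ε² R h R‖ ≤ ε`. Positivity of `h` and of the remainder `y` is expressed through finite sums `∑ e
e*`, so that the statement needs no order on `A`. -/
lemma exists_regularization {h : A} (hh : ∃ (E : Submodule ℂ A) (s : Finset E),
    h = ∑ e ∈ s, (e : A) * star (e : A)) {ε : ℝ} (hε : 0 < ε) :
    IsSelfAdjoint h ∧ ‖cfc (fun t : ℝ => (ε + t)⁻¹) h * h‖ ≤ 1 ∧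
    ∀ x y : A, h = x * star x + y → (∃ (E : Submodule ℂ A) (s : Finset E),
      y = ∑ e ∈ s, (e : A) * star (e : A)) →
      ‖cfc (fun t : ℝ => (ε + t)⁻¹) h * h * x - x‖ ^ 2 ≤ ε := by
  let _ := CStarAlgebra.spectralOrder A
  have := CStarAlgebra.spectralOrderedRing A
  have hnn : ∀ {y : A}, (∃ (E : Submodule ℂ A) (s : Finset E),
      y = ∑ e ∈ s, (e : A) * star (e : A)) → 0 ≤ y := by
    rintro y ⟨E, s, rfl⟩
    exact Finset.sum_nonneg fun e _ => mul_star_self_nonneg _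
  have h0 : 0 ≤ h := hnn hh
  have hsa : IsSelfAdjoint h := .of_nonneg h0
  have hsp : ∀ t ∈ spectrum ℝ h, 0 ≤ t := fun t ht => spectrum_nonneg_of_nonneg h0 ht
  have hpos : ∀ t ∈ spectrum ℝ h, 0 < ε + t := fun t ht => by linarith [hsp t ht]
  have hcont : ContinuousOn (fun t : ℝ => (ε + t)⁻¹) (spectrum ℝ h) :=
    ContinuousOn.inv₀ (by fun_prop) fun t ht => (hpos t ht).ne'
  set R := cfc (fun t : ℝ => (ε + t)⁻¹) h with hR
  have hRsa : IsSelfAdjoint R := cfc_predicate _ _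
  have hcont' : ContinuousOn (fun t : ℝ => (ε + t)⁻¹ * t) (spectrum ℝ h) :=
    hcont.mul continuousOn_id
  have hRh : R * h = cfc (fun t : ℝ => (ε + t)⁻¹ * t) h := by
    rw [cfc_mul (fun t : ℝ => (ε + t)⁻¹) (fun t => t) h hcont (by fun_prop), cfc_id' ℝ h]
  refine ⟨hsa, ?_, fun x y hxy hy => ?_⟩
  · rw [hRh]
    refine norm_cfc_le zero_le_one fun t ht => ?_
    have h1 := hsp t ht
    have h2 := hpos t ht
    rw [Real.norm_of_nonneg (by positivity), inv_mul_le_iff₀ h2]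
    linarith
  · have h1 : R * h - 1 = -(ε • R) := by
      rw [hRh, hR, ← cfc_smul ε (fun t : ℝ => (ε + t)⁻¹) h hcont, ← cfc_neg,
        ← cfc_const_one ℝ h,
        ← cfc_sub (fun t : ℝ => (ε + t)⁻¹ * t) (fun _ => 1) h hcont' (by fun_prop)]
      refine cfc_congr fun t ht => ?_
      have := (hpos t ht).ne'
      simp only [smul_eq_mul]
      field_simp
      ring
    have h2 : R * h * x - x = -(ε • R) * x := by rw [← h1, sub_mul, one_mul]
    have h3 : x * star x ≤ h := by
      rw [hxy]
      exact le_add_of_nonneg_right (hnn hy)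
    have h4 : (R * h * x - x) * star (R * h * x - x) ≤ (ε • R) * h * (ε • R) := by
      have h5 := star_left_conjugate_le_conjugate h3 (ε • R)
      rw [star_smul, hRsa.star_eq, star_trivial ε] at h5
      convert h5 using 1
      rw [h2, star_mul, star_neg, star_smul, hRsa.star_eq, star_trivial ε]
      simp only [neg_mul, mul_neg, neg_neg, mul_assoc]
    rw [sq, ← CStarRing.norm_self_mul_star]
    refine (CStarAlgebra.norm_le_norm_of_nonneg_of_le (mul_star_self_nonneg _) h4).trans ?_
    have h6 : (ε • R) * h * (ε • R) = cfc (fun t : ℝ => ε ^ 2 * ((ε + t)⁻¹ * t * (ε + t)⁻¹)) h := by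
      rw [cfc_const_mul _ (fun t : ℝ => (ε + t)⁻¹ * t * (ε + t)⁻¹) h
        (hcont'.mul hcont), cfc_mul (fun t : ℝ => (ε + t)⁻¹ * t) _ h hcont' hcont,
        ← hRh, ← hR]
      simp only [smul_mul_assoc, mul_smul_comm, smul_smul, sq]
    rw [h6]
    refine norm_cfc_le hε.le fun t ht => ?_
    have h7 := hsp t ht
    have h8 := hpos t ht
    rw [Real.norm_of_nonneg (by positivity)]
    have h9 : (ε + t)⁻¹ * t ≤ 1 := by rw [inv_mul_le_iff₀ h8]; linarith
    have h10 : (ε + t)⁻¹ * ε ≤ 1 := by rw [inv_mul_le_iff₀ h8]; linarith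
    calc ε ^ 2 * ((ε + t)⁻¹ * t * (ε + t)⁻¹) = ε * (((ε + t)⁻¹ * t) * ((ε + t)⁻¹ * ε)) := by ring
      _ ≤ ε * (1 * 1) := by gcongr
      _ = ε := by ring

/-- An approximate left unit of a corner, made of elements `u = R ∑ e e*` of norm at most one. -/
lemma exists_frame (q p : A) (hq : IsStarProjection q) (hp : IsStarProjection p) :
    ∃ (𝒰 : Ultrafilter (Finset (corner q p) × ℕ)) (R : Finset (corner q p) × ℕ → A),
      (∀ i, ∀ x ∈ corner q p, R i * x ∈ corner q p) ∧
      (∀ i, ‖R i * ∑ e ∈ i.1, (e : A) * star (e : A)‖ ≤ 1) ∧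
      ∀ x ∈ corner q p,
        Tendsto (fun i => R i * (∑ e ∈ i.1, (e : A) * star (e : A)) * x) 𝒰 (𝓝 x) := by
  classical
  -- Along an ultrafilter finer than `atTop`, a given `x` eventually lies in the finite set, and the
  -- regularization parameter `1 / (n + 1)` tends to zero.
  let 𝒰 : Ultrafilter (Finset (corner q p) × ℕ) := Ultrafilter.of atTop
  have h𝒰 : (𝒰 : Filter (Finset (corner q p) × ℕ)) ≤ atTop := Ultrafilter.of_le atTop
  let h : Finset (corner q p) × ℕ → A := fun i => ∑ e ∈ i.1, (e : A) * star (e : A)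
  let ε : Finset (corner q p) × ℕ → ℝ := fun i => 1 / ((i.2 : ℝ) + 1)
  have hε : ∀ i, 0 < ε i := fun i => by positivity
  have hreg := fun i => exists_regularization ⟨corner q p, i.1, rfl⟩ (hε i)
  refine ⟨𝒰, fun i => cfc (fun t : ℝ => (ε i + t)⁻¹) (h i), fun i x hx => ?_,
    fun i => (hreg i).2.1, fun x hx => ?_⟩
  · refine (cfc_mem_leftStabilizer (isClosed_corner q p) _ (a := h i)
      (sum_mem fun e _ => ?_) x hx).1
    exact mem_leftStabilizer_corner hq (mul_mem_corner e.2 (star_mem_corner hq hp e.2))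
  · rw [tendsto_iff_norm_sub_tendsto_zero]
    have hlim : Tendsto (fun i => √(ε i)) 𝒰 (𝓝 0) := by
      have h1 : Tendsto ε 𝒰 (𝓝 0) :=
        (tendsto_one_div_add_atTop_nhds_zero_nat.comp (tendsto_snd.mono_left
          (prod_atTop_atTop_eq (α := Finset (corner q p)) (β := ℕ)).ge)).mono_left h𝒰
      simpa using h1.sqrt
    refine squeeze_zero' (Eventually.of_forall fun _ => norm_nonneg _) ?_ hlim
    have hmem : ∀ᶠ i in (𝒰 : Filter (Finset (corner q p) × ℕ)),
        (⟨x, hx⟩ : corner q p) ∈ i.1 := by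
      refine h𝒰 ?_
      filter_upwards [eventually_ge_atTop (({⟨x, hx⟩}, 0) : Finset (corner q p) × ℕ)] with i hi
      exact hi.1 (Finset.mem_singleton_self _)
    filter_upwards [hmem] with i hi
    -- `x x*` is one of the summands; the rest of the sum is the positive remainder.
    refine Real.le_sqrt_of_sq_le ((hreg i).2.2 x _ ?_ ⟨corner q p, i.1.erase ⟨x, hx⟩, rfl⟩)
    exact (Finset.add_sum_erase i.1 (fun e => (e : A) * star (e : A)) hi).symm

end Frames

/-! ### Reading norms off a submodule -/

section SpectralCutoff

variable {A : Type*} [CStarAlgebra A]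

/-- On the support of the cutoff `g` the spectrum of `s` is at least `r + ε`, so `‖s g h‖ ≥ (r + ε)
‖g h‖`. But `g h` lies in `M`, where `s` has norm at most `r`; hence `g h = 0`. -/
lemma cfc_cutoff_mul_eq_zero {M : Submodule ℂ A} (hM : IsClosed (M : Set A)) {s : A} {r ε : ℝ}
    (hs : ∃ b, s = star b * b) (hsM : s ∈ leftStabilizer M) (hr : 0 ≤ r) (hε : 0 < ε)
    (hle : ∀ h ∈ M, ‖s * h‖ ≤ r * ‖h‖) {h : A} (hh : h ∈ M) :
    cfc (fun t : ℝ => max 0 (t - (r + ε))) s * h = 0 := by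
  let _ := CStarAlgebra.spectralOrder A
  have := CStarAlgebra.spectralOrderedRing A
  have hs0 : 0 ≤ s := by
    obtain ⟨b, rfl⟩ := hs
    exact star_mul_self_nonneg b
  have hsa : IsSelfAdjoint s := .of_nonneg hs0
  set f : ℝ → ℝ := fun t => max 0 (t - (r + ε)) with hf
  have hfc : Continuous f := by simp only [hf]; fun_prop
  set g := cfc f s with hg
  have hgsa : star g = g := (cfc_predicate f s : IsSelfAdjoint g).star_eq
  have hk : g * h ∈ M := (cfc_mem_leftStabilizer hM f hsM h hh).1
  have hmono : (r + ε) ^ 2 • (g * g) ≤ g * s * (s * g) := by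
    have e1 : (r + ε) ^ 2 • (g * g) = cfc (fun t => (r + ε) ^ 2 * (f t * f t)) s := by
      rw [cfc_const_mul _ (fun t => f t * f t) s (by fun_prop),
        cfc_mul f f s (by fun_prop) (by fun_prop)]
    have e2 : g * s * (s * g) = cfc (fun t => f t * t * (t * f t)) s := by
      rw [cfc_mul (fun t => f t * t) (fun t => t * f t) s (by fun_prop) (by fun_prop),
        cfc_mul f (fun t => t) s (by fun_prop) (by fun_prop),
        cfc_mul (fun t => t) f s (by fun_prop) (by fun_prop), cfc_id' ℝ s]
    rw [e1, e2]
    refine cfc_mono (fun t _ => ?_) (by fun_prop) (by fun_prop)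
    rcases le_total t (r + ε) with h1 | h1
    · have : f t = 0 := max_eq_left (by linarith)
      simp [this]
    · have h2 : (r + ε) ^ 2 ≤ t ^ 2 := by gcongr
      nlinarith [mul_self_nonneg (f t), mul_le_mul_of_nonneg_right h2 (mul_self_nonneg (f t))]
  have hsk : star (s * (g * h)) * (s * (g * h)) = star h * (g * s * (s * g)) * h := by
    simp only [star_mul, hgsa, hsa.star_eq, mul_assoc]
  have hkk : star (g * h) * (g * h) = star h * (g * g) * h := by
    simp only [star_mul, hgsa, mul_assoc]
  have h1 : (r + ε) ^ 2 * ‖g * h‖ ^ 2 ≤ ‖s * (g * h)‖ ^ 2 := by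
    have h2 := star_left_conjugate_le_conjugate hmono h
    rw [← hsk, mul_smul_comm, smul_mul_assoc, ← hkk] at h2
    have h3 := CStarAlgebra.norm_le_norm_of_nonneg_of_le
      (smul_nonneg (by positivity) (star_mul_self_nonneg _)) h2
    rwa [norm_smul, CStarRing.norm_star_mul_self, CStarRing.norm_star_mul_self, ← sq, ← sq,
      Real.norm_of_nonneg (by positivity)] at h3
  have h4 : ‖s * (g * h)‖ ^ 2 ≤ (r * ‖g * h‖) ^ 2 := by gcongr; exact hle _ hk
  by_contra hne
  have hpos : 0 < ‖g * h‖ := norm_pos_iff.mpr hne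
  have h5 : (r + ε) ^ 2 * ‖g * h‖ ^ 2 ≤ r ^ 2 * ‖g * h‖ ^ 2 := by
    rw [← mul_pow r]
    exact h1.trans h4
  have h6 := le_of_mul_le_mul_right h5 (by positivity)
  nlinarith

/-- The function `t ↦ t max 0 (t - (r + ε))` vanishes on the spectrum, which therefore lies in `[0,
r + ε]`. Together with the previous lemma this bounds `s` as soon as whatever kills the submodule
also kills `s`. -/
lemma norm_le_of_cfc_cutoff_mul_eq_zero {s : A} {r : ℝ} (hs : ∃ b, s = star b * b) (hr : 0 ≤ r)
    (h : ∀ ε : ℝ, 0 < ε → cfc (fun t : ℝ => max 0 (t - (r + ε))) s * s = 0) : ‖s‖ ≤ r := by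
  let _ := CStarAlgebra.spectralOrder A
  have := CStarAlgebra.spectralOrderedRing A
  have hs0 : 0 ≤ s := by
    obtain ⟨b, rfl⟩ := hs
    exact star_mul_self_nonneg b
  have hsa : IsSelfAdjoint s := .of_nonneg hs0
  refine le_of_forall_pos_le_add fun ε hε => ?_
  have h1 := h ε hε
  nth_rw 2 [← cfc_id' ℝ s] at h1
  rw [← cfc_mul _ _ s (by fun_prop) (by fun_prop), ← cfc_const_zero ℝ s,
    cfc_eq_cfc_iff_eqOn hsa (by fun_prop) (by fun_prop)] at h1
  rw [← cfc_id' ℝ s]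
  refine norm_cfc_le (by linarith) fun t ht => ?_
  have ht0 : 0 ≤ t := spectrum_nonneg_of_nonneg hs0 ht
  rw [Real.norm_of_nonneg ht0]
  by_contra hlt
  rw [not_le] at hlt
  have h2 := h1 ht
  dsimp only at h2
  rw [max_eq_right (by linarith)] at h2
  rcases mul_eq_zero.mp h2 with h3 | h3 <;> linarith

/-- From `‖c* x‖² = ‖x* (c c* x)‖`: a bound on `c` at the single vector `c* x` controls `c*` at `x`.
-/
lemma norm_star_mul_le_of_norm_mul_le {c x : A} {K : ℝ} (hK : 0 ≤ K)
    (h : ‖c * (star c * x)‖ ≤ K * ‖star c * x‖) : ‖star c * x‖ ≤ K * ‖x‖ := by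
  rcases (norm_nonneg (star c * x)).eq_or_lt with h0 | h0
  · rw [← h0]; positivity
  · have h1 : ‖star c * x‖ * ‖star c * x‖ ≤ (K * ‖x‖) * ‖star c * x‖ := by
      rw [← CStarRing.norm_star_mul_self, star_mul, star_star, mul_assoc]
      refine (norm_mul_le _ _).trans ?_
      rw [norm_star]
      calc _ ≤ ‖x‖ * (K * ‖star c * x‖) := by gcongr
        _ = _ := by ring
    exact le_of_mul_le_mul_right h1 h0

end SpectralCutoff

/-! ### Self-duality of corners and multipliers -/

section SelfDual

variable {A : Type*} [CStarAlgebra A] {q p p₁ p₂ : A} {V : Set (A →ₗ[ℂ] ℂ)}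

/-- Every bounded right `pAp`-module map from `qAp` to `pAp` is left multiplication by the adjoint
of an element of `qAp`. -/
def IsSelfDualCorner (q p : A) : Prop :=
  ∀ (T : A →ₗ[ℂ] A) (K : ℝ), (∀ x ∈ corner q p, ‖T x‖ ≤ K * ‖x‖) →
    (∀ x ∈ corner q p, T x ∈ corner p p) →
    (∀ x ∈ corner q p, ∀ b ∈ corner p p, T (x * b) = T x * b) →
    ∃ l ∈ corner q p, ∀ x ∈ corner q p, T x = star l * x

/-- On the approximate unit `u = R ∑ e e*`, the map `x ↦ T (u x)` is represented by `∑ e T(R e)*`.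
These representatives are bounded, and a weak limit of them represents `T`. -/
theorem IsPredualOn.isSelfDualCorner (hV : IsPredualOn (corner q p) V) (hq : IsStarProjection q)
    (hp : IsStarProjection p) : IsSelfDualCorner q p := by
  intro T K hK hT hmod
  obtain ⟨𝒰, R, hR, hu, hlim⟩ := exists_frame q p hq hp
  have hK' : ∀ x ∈ corner q p, ‖T x‖ ≤ |K| * ‖x‖ := fun x hx =>
    (hK x hx).trans (mul_le_mul_of_nonneg_right (le_abs_self K) (norm_nonneg x))
  set u := fun i => R i * ∑ e ∈ i.1, (e : A) * star (e : A) with hu_def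
  have hstar : ∀ {x}, x ∈ corner q p → star x ∈ corner p q := star_mem_corner hq hp
  have huE : ∀ i, ∀ x ∈ corner q p, u i * x ∈ corner q p := fun i x hx => by
    rw [hu_def]
    dsimp only
    rw [mul_assoc, Finset.sum_mul]
    exact hR i _ (Submodule.sum_mem _ fun e _ =>
      mul_mem_corner (mul_mem_corner e.2 (hstar e.2)) hx)
  set l := fun i : Finset (corner q p) × ℕ =>
    ∑ e ∈ i.1, (e : A) * star (T (R i * (e : A))) with hl_def
  have hlE : ∀ i, l i ∈ corner q p := fun i => Submodule.sum_mem _ fun e _ =>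
    mul_mem_corner e.2 (star_mem_corner hp hp (hT _ (hR i _ e.2)))
  have hlx : ∀ i, ∀ x ∈ corner q p, star (l i) * x = T (u i * x) := fun i x hx => by
    simp only [hl_def, hu_def, star_sum, Finset.sum_mul, Finset.mul_sum, map_sum]
    refine Finset.sum_congr rfl fun e _ => ?_
    rw [star_mul, star_star, mul_assoc, ← hmod _ (hR i _ e.2) _ (mul_mem_corner (hstar e.2) hx)]
    simp only [mul_assoc]
  -- Evaluate at the representative itself: `‖l i‖² = ‖T (u i (l i))‖ ≤ |K| ‖l i‖`.
  have hln : ∀ i, ‖l i‖ ≤ |K| := fun i => by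
    rcases (norm_nonneg (l i)).eq_or_lt with h0 | h0
    · rw [← h0]; positivity
    · have h1 : ‖l i‖ * ‖l i‖ ≤ |K| * ‖l i‖ := by
        rw [← CStarRing.norm_star_mul_self, hlx i _ (hlE i)]
        refine (hK' _ (huE i _ (hlE i))).trans ?_
        gcongr
        exact (norm_mul_le _ _).trans (mul_le_of_le_one_left (norm_nonneg _) (hu i))
      exact le_of_mul_le_mul_right h1 h0
  obtain ⟨m, hm, hmlim⟩ := hV.exists_lim 𝒰 hlE hln
  have hTlim : ∀ x ∈ corner q p, Tendsto (fun i => T (u i * x)) 𝒰 (𝓝 (T x)) := fun x hx => by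
    have h1 := tendsto_iff_norm_sub_tendsto_zero.mp (hlim x hx)
    rw [tendsto_iff_norm_sub_tendsto_zero]
    refine squeeze_zero (fun _ => norm_nonneg _) (fun i => ?_) (by simpa using h1.const_mul |K|)
    rw [← map_sub]
    exact hK' _ (Submodule.sub_mem _ (huE i x hx) hx)
  -- The products `x* l i` lie in `pAp`, where no weak topology is given; a left factor `z` from
  -- `qAp` brings them back to `qAp`.
  have hz : ∀ x ∈ corner q p, ∀ z ∈ corner q p, z * (star x * m) = z * star (T x) := by
    intro x hx z hz
    have h1 := hV.corner_mul hq (mul_mem_corner hz (hstar hx)) hlE hln hm hmlim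
    have h2 : Tendsto (fun i => z * star x * l i) 𝒰 (𝓝 (z * star (T x))) := by
      have h3 := ((hTlim x hx).star).const_mul z
      refine h3.congr fun i => ?_
      rw [← hlx i x hx, star_mul, star_star, mul_assoc]
    rw [← mul_assoc]
    exact hV.unique (mul_mem_corner (mul_mem_corner hz (hstar hx)) hm)
      (mul_mem_corner hz (star_mem_corner hp hp (hT x hx))) h1
      (hV.isWeakLim_of_tendsto (mul_mem_corner hz (star_mem_corner hp hp (hT x hx)))
        (fun i => mul_mem_corner (mul_mem_corner hz (hstar hx)) (hlE i)) h2)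
  refine ⟨m, hm, fun x hx => ?_⟩
  set D := star x * m - star (T x) with hD
  have hxD : x * D = 0 := by rw [hD, mul_sub, hz x hx x hx, sub_self]
  -- `D*` is the norm limit of `(m - l i)* x`, and `x D = 0`; so no cancellation of `z` is needed.
  have hDD : star D * D = 0 := by
    have h1 : Tendsto (fun i => (star m * x - star (l i) * x) * D) 𝒰 (𝓝 (star D * D)) := by
      have h2 : star D = star m * x - T x := by simp [hD]
      rw [h2]
      refine Tendsto.mul_const D (tendsto_const_nhds.sub ?_)
      exact (hTlim x hx).congr fun i => (hlx i x hx).symm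
    refine tendsto_nhds_unique h1 (tendsto_const_nhds.congr fun i => ?_)
    rw [← sub_mul, mul_assoc, hxD, mul_zero]
  have hD0 : D = 0 := (CStarRing.star_mul_self_eq_zero_iff D).mp hDD
  have := congrArg star hD0
  rw [hD, star_sub, star_star, star_mul, star_star, star_zero, sub_eq_zero] at this
  exact this.symm

lemma isSelfDualCorner_zero (q : A) : IsSelfDualCorner q 0 := fun T K hK _ _ =>
  ⟨0, Submodule.zero_mem _, fun x hx => by
    have : x = 0 := by simpa using hx.2.symm
    simp [this]⟩

lemma corner_mono {a b c d x : A} (hc : c * a = a) (hd : b * d = b) (hx : x ∈ corner a b) :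
    x ∈ corner c d :=
  ⟨by rw [← hx.1, ← mul_assoc, hc], by rw [← hx.2, mul_assoc, hd]⟩

/-- Since `T x = T (x a) = T x a` on `qAa`, the map `a T` restricts to an `aAa`-module map into
`aAa`, to which self-duality applies. -/
lemma exists_component {a P : A} {T : A →ₗ[ℂ] A} {K : ℝ} (ha : IsStarProjection a)
    (haP : a * P = a) (hPa : P * a = a) (hK : ∀ x ∈ corner q P, ‖T x‖ ≤ K * ‖x‖)
    (hmod : ∀ x ∈ corner q P, ∀ b ∈ corner P P, T (x * b) = T x * b)
    (hsd : IsSelfDualCorner q a) :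
    ∃ l ∈ corner q a, ∀ x ∈ corner q a, a * T x = star l * x := by
  have hin : ∀ {c x : A}, x ∈ corner c a → x ∈ corner c P := fun hx => ⟨hx.1, by
    rw [← hx.2, mul_assoc, haP]⟩
  refine hsd (LinearMap.mulLeft ℂ a ∘ₗ T) (‖a‖ * K) (fun x hx => ?_) (fun x hx => ?_)
    fun x hx c hc => ?_
  · simp only [LinearMap.comp_apply, LinearMap.mulLeft_apply]
    rw [mul_assoc]
    exact (norm_mul_le _ _).trans (mul_le_mul_of_nonneg_left (hK x (hin hx)) (norm_nonneg _))
  · simp only [LinearMap.comp_apply, LinearMap.mulLeft_apply]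
    have h1 : T x = T x * a := by
      rw [← hmod x (hin hx) a ⟨hPa, haP⟩, hx.2]
    exact ⟨by rw [← mul_assoc, ha.isIdempotentElem.eq], by rw [mul_assoc, ← h1]⟩
  · simp only [LinearMap.comp_apply, LinearMap.mulLeft_apply]
    rw [hmod x (hin hx) c (corner_mono hPa haP hc), mul_assoc]

/-- For the defect `D = b T x - l* x` in `bAa`, the element `x D*` lies in `qAb`, where `l` is known
to represent `b T`. Module linearity then gives `D D* = 0`. -/
lemma component_eq {a b P l : A} {T : A →ₗ[ℂ] A} (ha : IsStarProjection a)
    (hb : IsStarProjection b) (haP : a * P = a) (hPa : P * a = a) (hbP : b * P = b)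
    (hmod : ∀ x ∈ corner q P, ∀ b ∈ corner P P, T (x * b) = T x * b) (hl : l ∈ corner q b)
    (hTb : ∀ x ∈ corner q b, b * T x = star l * x) {x : A} (hx : x ∈ corner q a) :
    b * T x = star l * x := by
  have hxP : x ∈ corner q P := ⟨hx.1, by rw [← hx.2, mul_assoc, haP]⟩
  have hlb : b * star l = star l := by simpa [hb.isSelfAdjoint.star_eq] using congrArg star hl.2
  set D := b * T x - star l * x with hD
  have hTx : T x * a = T x := by rw [← hmod x hxP a ⟨hPa, haP⟩, hx.2]
  have hDm : D ∈ corner b a := Submodule.sub_mem _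
    ⟨by rw [← mul_assoc, hb.isIdempotentElem.eq], by rw [mul_assoc, hTx]⟩
    ⟨by rw [← mul_assoc, hlb], by rw [mul_assoc, hx.2]⟩
  have hDs : star D ∈ corner a b := star_mem_corner hb ha hDm
  have h1 := hTb _ (mul_mem_corner hx hDs)
  rw [hmod x hxP _ (corner_mono hPa hbP hDs), ← mul_assoc, ← mul_assoc] at h1
  have h2 : D * star D = 0 := by
    nth_rw 1 [hD]
    rw [sub_mul, h1, sub_self]
  exact sub_eq_zero.mp ((CStarRing.mul_star_self_eq_zero_iff D).mp h2)

/-- Represent `p₁ T` and `p₂ T` on their own corners by `l₁` and `l₂`; by `component_eq` each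
representation also holds on the other corner, so `l₁ + l₂` represents `T`. -/
theorem IsSelfDualCorner.add (h₁ : IsSelfDualCorner q p₁) (h₂ : IsSelfDualCorner q p₂)
    (hp₁ : IsStarProjection p₁) (hp₂ : IsStarProjection p₂) (h12 : p₁ * p₂ = 0) :
    IsSelfDualCorner q (p₁ + p₂) := by
  have h21 : p₂ * p₁ = 0 := by
    simpa [hp₁.isSelfAdjoint.star_eq, hp₂.isSelfAdjoint.star_eq] using congrArg star h12
  have i1 : p₁ * (p₁ + p₂) = p₁ := by rw [mul_add, h12, hp₁.isIdempotentElem.eq, add_zero]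
  have i2 : p₂ * (p₁ + p₂) = p₂ := by rw [mul_add, h21, hp₂.isIdempotentElem.eq, zero_add]
  have i3 : (p₁ + p₂) * p₁ = p₁ := by rw [add_mul, h21, hp₁.isIdempotentElem.eq, add_zero]
  have i4 : (p₁ + p₂) * p₂ = p₂ := by rw [add_mul, h12, hp₂.isIdempotentElem.eq, zero_add]
  intro T K hK hT hmod
  obtain ⟨l₁, hl₁, e₁⟩ := exists_component hp₁ i1 i3 hK hmod h₁
  obtain ⟨l₂, hl₂, e₂⟩ := exists_component hp₂ i2 i4 hK hmod h₂
  refine ⟨l₁ + l₂, Submodule.add_mem _ ⟨hl₁.1, by rw [← hl₁.2, mul_assoc, i1]⟩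
    ⟨hl₂.1, by rw [← hl₂.2, mul_assoc, i2]⟩, fun x hx => ?_⟩
  have hx₁ : x * p₁ ∈ corner q p₁ := ⟨by rw [← mul_assoc, hx.1],
    by rw [mul_assoc, hp₁.isIdempotentElem.eq]⟩
  have hx₂ : x * p₂ ∈ corner q p₂ := ⟨by rw [← mul_assoc, hx.1],
    by rw [mul_assoc, hp₂.isIdempotentElem.eq]⟩
  have c1 : p₁ * T x = star l₁ * x := by
    conv_lhs => rw [← hx.2, mul_add, map_add, mul_add, e₁ _ hx₁,
      component_eq hp₂ hp₁ i2 i4 i1 hmod hl₁ e₁ hx₂, ← mul_add, ← mul_add, hx.2]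
  have c2 : p₂ * T x = star l₂ * x := by
    conv_lhs => rw [← hx.2, mul_add, map_add, mul_add, e₂ _ hx₂,
      component_eq hp₁ hp₂ i1 i3 i2 hmod hl₂ e₂ hx₁, ← mul_add, ← mul_add, hx.2]
  rw [← (hT x hx).1, add_mul, c1, c2, star_add, add_mul]

/-- A bounded right module endomorphism of `qAp` is left multiplication by an element of `qAq`, if
`qAq` has a predual. -/
theorem IsPredualOn.exists_multiplier (hV : IsPredualOn (corner q q) V) (hq : IsStarProjection q)
    (hp : IsStarProjection p) {C : A →ₗ[ℂ] A} {K : ℝ} (hK0 : 0 ≤ K)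
    (hK : ∀ x ∈ corner q p, ‖C x‖ ≤ K * ‖x‖) (hC : ∀ x ∈ corner q p, C x ∈ corner q p)
    (hmod : ∀ x ∈ corner q p, ∀ b ∈ corner p p, C (x * b) = C x * b) :
    ∃ c ∈ corner q q, (∀ x ∈ corner q p, c * x = C x) ∧
      ∀ y, (∀ x ∈ corner q p, y * x = 0) → y * c = 0 := by
  obtain ⟨𝒰, R, hR, hu, hlim⟩ := exists_frame q p hq hp
  set u := fun i => R i * ∑ e ∈ i.1, (e : A) * star (e : A) with hu_def
  have hstar : ∀ {x}, x ∈ corner q p → star x ∈ corner p q := star_mem_corner hq hp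
  have huE : ∀ i, ∀ x ∈ corner q p, u i * x ∈ corner q p := fun i x hx => by
    rw [hu_def]
    dsimp only
    rw [mul_assoc, Finset.sum_mul]
    exact hR i _ (Submodule.sum_mem _ fun e _ =>
      mul_mem_corner (mul_mem_corner e.2 (hstar e.2)) hx)
  -- These elements satisfy `c i x = C (u i x)` by module linearity.
  set c := fun i : Finset (corner q p) × ℕ =>
    ∑ e ∈ i.1, C (R i * (e : A)) * star (e : A) with hc_def
  have hcq : ∀ i, c i ∈ corner q q := fun i => Submodule.sum_mem _ fun e _ =>
    mul_mem_corner (hC _ (hR i _ e.2)) (hstar e.2)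
  have hcx : ∀ i, ∀ x ∈ corner q p, c i * x = C (u i * x) := fun i x hx => by
    simp only [hc_def, hu_def, Finset.sum_mul, Finset.mul_sum, map_sum]
    refine Finset.sum_congr rfl fun e _ => ?_
    rw [mul_assoc, ← hmod _ (hR i _ e.2) _ (mul_mem_corner (hstar e.2) hx)]
    simp only [mul_assoc]
  have hyc : ∀ i y, (∀ x ∈ corner q p, y * x = 0) → y * c i = 0 := fun i y hy => by
    simp only [hc_def, Finset.mul_sum]
    exact Finset.sum_eq_zero fun e _ => by rw [← mul_assoc, hy _ (hC _ (hR i _ e.2)), zero_mul]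
  have hcK : ∀ i, ∀ x ∈ corner q p, ‖c i * x‖ ≤ K * ‖x‖ := fun i x hx => by
    rw [hcx i x hx]
    refine (hK _ (huE i x hx)).trans (mul_le_mul_of_nonneg_left ?_ hK0)
    exact (norm_mul_le _ _).trans (mul_le_of_le_one_left (norm_nonneg _) (hu i))
  have hcn : ∀ i, ‖c i‖ ≤ K := fun i => by
    have hs : ∃ b, c i * star (c i) = star b * b := ⟨star (c i), by rw [star_star]⟩
    have hcs : star (c i) ∈ corner q q := star_mem_corner hq hq (hcq i)
    -- On `qAp` the element `c i (c i)*` has norm at most `K²`, so its spectral cutoffs kill `qAp`.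
    -- They then kill `c i`, whose terms have left factors in `qAp`.
    have h1 : ‖c i * star (c i)‖ ≤ K ^ 2 := by
      refine norm_le_of_cfc_cutoff_mul_eq_zero hs (by positivity) fun ε hε => ?_
      rw [← mul_assoc, hyc i _ fun x hx => ?_, zero_mul]
      refine cfc_cutoff_mul_eq_zero (isClosed_corner q p) hs
        (mem_leftStabilizer_corner hq (mul_mem_corner (hcq i) hcs)) (by positivity) hε
        (fun h hh => ?_) hx
      rw [mul_assoc]
      have h2 := mul_mem_corner hcs hh
      refine (hcK i _ h2).trans ?_
      rw [sq, mul_assoc]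
      exact mul_le_mul_of_nonneg_left (norm_star_mul_le_of_norm_mul_le hK0 (hcK i _ h2)) hK0
    rw [CStarRing.norm_self_mul_star, ← sq] at h1
    exact abs_le_of_sq_le_sq' h1 hK0 |>.2
  obtain ⟨d, hd, hdlim⟩ := hV.exists_lim 𝒰 hcq hcn
  refine ⟨d, hd, fun x hx => ?_, fun y hy => ?_⟩
  · set y := d * x - C x with hy
    have hyE : y ∈ corner q p := Submodule.sub_mem _ (mul_mem_corner hd hx) (hC x hx)
    have hyq : star y ∈ corner p q := hstar hyE
    have hxy : x * star y ∈ corner q q := mul_mem_corner hx hyq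
    -- The predual tests only `qAq`, so `d x = C x` is checked after multiplying on the right by the
    -- adjoint of the defect.
    have h1 := hV.corner_mul_right hq hxy hcq hcn hd hdlim
    have h2 : Tendsto (fun i => c i * (x * star y)) 𝒰 (𝓝 (C x * star y)) := by
      have h3 := tendsto_iff_norm_sub_tendsto_zero.mp (hlim x hx)
      have h4 : Tendsto (fun i => C (u i * x)) 𝒰 (𝓝 (C x)) := by
        rw [tendsto_iff_norm_sub_tendsto_zero]
        refine squeeze_zero (fun _ => norm_nonneg _) (fun i => ?_) (by simpa using h3.const_mul K)
        rw [← map_sub]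
        exact hK _ (Submodule.sub_mem _ (huE i x hx) hx)
      refine (h4.mul_const (star y)).congr fun i => ?_
      rw [← hcx i x hx, mul_assoc]
    have h5 := hV.unique (mul_mem_corner hd hxy) (mul_mem_corner (hC x hx) hyq) h1
      (hV.isWeakLim_of_tendsto (mul_mem_corner (hC x hx) hyq)
        (fun i => mul_mem_corner (hcq i) hxy) h2)
    have h6 : y * star y = 0 := by
      nth_rw 1 [hy]
      rw [sub_mul, mul_assoc, h5, sub_self]
    exact sub_eq_zero.mp ((CStarRing.mul_star_self_eq_zero_iff y).mp h6)
  -- The element `y` is arbitrary in `A`; its compressed square `q y* y q` lies in `qAq` and acts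
  -- weakly continuously.
  · have hm : q * (star y * y) * q ∈ corner q q := compress_mem_corner hq hq _
    have h1 := hV.corner_mul hq hm hcq hcn hd hdlim
    have h2 : ∀ i, q * (star y * y) * q * c i = 0 := fun i => by
      rw [mul_assoc, (hcq i).1, mul_assoc, mul_assoc, hyc i y hy, mul_zero, mul_zero]
    simp only [h2] at h1
    have h3 := hV.unique (mul_mem_corner hm hd) (Submodule.zero_mem _) h1 (IsWeakLim.const 0)
    rw [mul_assoc, hd.1] at h3
    have h4 : star (y * d) * (y * d) = 0 := by
      have h5 : star d * q = star d := (star_mem_corner hq hq hd).2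
      rw [star_mul, mul_assoc, ← mul_assoc (star y), ← h5, mul_assoc (star d), ← mul_assoc q, h3,
        mul_zero]
    exact (CStarRing.star_mul_self_eq_zero_iff _).mp h4

end SelfDual

/-! ### Adjoining one projection -/

section CornerSum

variable {A : Type*} [CStarAlgebra A] {q p : A} {V Vp Vq : Set (A →ₗ[ℂ] ℂ)}

/-- An ultrafilter concentrated on the unit ball of `W` becomes an indexed family once the points
outside the ball are replaced by zero. -/
lemma IsPredualOn.of_families {B : Type*} [NormedAddCommGroup B] [NormedSpace ℂ B]
    {W : Submodule ℂ B} {V : Set (B →ₗ[ℂ] ℂ)}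
    (h1 : ∀ φ ∈ V, ∀ w ∈ W, ‖φ w‖ ≤ ‖w‖)
    (h2 : ∀ w ∈ W, ∀ r : ℝ, 0 ≤ r → (∀ φ ∈ V, ‖φ w‖ ≤ r) → ‖w‖ ≤ r)
    (h3 : ∀ (𝒰 : Ultrafilter B) (f : B → B), (∀ i, f i ∈ W) → (∀ i, ‖f i‖ ≤ 1) →
      ∃ w ∈ W, IsWeakLim V 𝒰 f w) : IsPredualOn W V where
  norm_apply_le := h1
  norming := h2
  compact F hF := by
    classical
    obtain ⟨w, hw, hlim⟩ := h3 F (fun x => if x ∈ W ∧ ‖x‖ ≤ 1 then x else 0)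
      (fun x => by split_ifs with h <;> simp [h]) (fun x => by split_ifs with h <;> simp [h])
    refine ⟨w, hw, fun φ hφ => (hlim φ hφ).congr' ?_⟩
    filter_upwards [hF] with x hx
    rw [if_pos hx]

/-- The projection of `qAq` onto the part of `q` generated by `qAp`. -/
lemma IsPredualOn.exists_support (hV : IsPredualOn (corner q q) V) (hq : IsStarProjection q)
    (hp : IsStarProjection p) : ∃ z ∈ corner q q, IsStarProjection z ∧
      (∀ x ∈ corner q p, z * x = x) ∧ ∀ y, (∀ x ∈ corner q p, y * x = 0) → y * z = 0 := by
  -- The identity map of `qAp` is a module endomorphism; its multiplier is the support.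
  obtain ⟨z, hz, hzx, hy⟩ := hV.exists_multiplier hq hp (C := LinearMap.id) zero_le_one
    (fun x _ => by simp) (fun x hx => hx) (fun x _ b _ => rfl)
  simp only [LinearMap.id_apply] at hzx
  have hzs : ∀ x ∈ corner q p, star z * x = x := fun x hx => by
    set y := star z * x - x with hyd
    have hyE : y ∈ corner q p :=
      Submodule.sub_mem _ (mul_mem_corner (star_mem_corner hq hq hz) hx) hx
    have : star y * y = 0 := by
      nth_rw 2 [hyd]
      rw [mul_sub, ← mul_assoc, ← star_mul, hzx y hyE, sub_self]
    exact sub_eq_zero.mp ((CStarRing.star_mul_self_eq_zero_iff y).mp this)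
  -- Both `q` and `z*` act as the identity on `qAp`, so their difference kills `z`. Thus `z = z* z`,
  -- which is self-adjoint and idempotent.
  have h1 : (q - star z) * z = 0 := hy _ fun x hx => by rw [sub_mul, hzs x hx, hx.1, sub_self]
  rw [sub_mul, hz.1, sub_eq_zero] at h1
  have hsa : IsSelfAdjoint z := by
    rw [h1]
    exact IsSelfAdjoint.star_mul_self z
  refine ⟨z, hz, ⟨?_, hsa⟩, hzx, hy⟩
  nth_rw 1 [hsa.star_eq] at h1
  exact h1.symm

lemma mul_eq_zero_of_mem_corner {a b d e x y : A} (hx : x ∈ corner a b)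
    (hy : y ∈ corner d e) (hbd : b * d = 0) : x * y = 0 := by
  rw [← hx.2, ← hy.1, mul_assoc, ← mul_assoc b, hbd, zero_mul, mul_zero]

variable (hq : IsStarProjection q) (hp : IsStarProjection p) (hpq : p * q = 0)

include hq hp hpq

lemma mul_eq_zero_of_orthogonal : q * p = 0 := by
  simpa [hp.isSelfAdjoint.star_eq, hq.isSelfAdjoint.star_eq] using congrArg star hpq

lemma isStarProjection_add_of_orthogonal : IsStarProjection (p + q) := by
  have hqp := mul_eq_zero_of_orthogonal hq hp hpq
  refine ⟨?_, hp.isSelfAdjoint.add hq.isSelfAdjoint⟩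
  rw [IsIdempotentElem, add_mul, mul_add, mul_add, hpq, hqp, hp.isIdempotentElem.eq,
    hq.isIdempotentElem.eq, add_zero, zero_add]

/-- Weak limits of the matrix coefficients of a bounded family in `(p + q)A(p + q)`, acting on
`(p + q)Ap`, are the matrix coefficients of an element. -/
lemma exists_lim_coefficients (hVp : IsPredualOn (corner p p) Vp)
    (hVq : IsPredualOn (corner q q) Vq) (hsd : IsSelfDualCorner q p) {I : Type*}
    (𝒰 : Ultrafilter I) {f : I → A} (hf : ∀ i, f i ∈ corner (p + q) (p + q))
    (hf1 : ∀ i, ‖f i‖ ≤ 1) :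
    ∃ a ∈ corner (p + q) (p + q), ∀ l ∈ corner (p + q) p, ∀ h ∈ corner (p + q) p,
      IsWeakLim Vp 𝒰 (fun i => star l * f i * h) (star l * a * h) := by
  have hqp := mul_eq_zero_of_orthogonal hq hp hpq
  have hs := isStarProjection_add_of_orthogonal hq hp hpq
  have hpp := hp.isIdempotentElem.eq
  have hqq := hq.isIdempotentElem.eq
  set s := p + q with hs_def
  have hsp : s * p = p := by rw [hs_def, add_mul, hpp, hqp, add_zero]
  have hsq : s * q = q := by rw [hs_def, add_mul, hqq, hpq, zero_add]
  have hps : p * s = p := by rw [hs_def, mul_add, hpp, hpq, add_zero]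
  have hqs : q * s = q := by rw [hs_def, mul_add, hqq, hqp, zero_add]
  have hcomp : ∀ x, s * x * p ∈ corner s p := compress_mem_corner hs hp
  have hfix : ∀ x ∈ corner s p, s * x * p = x := fun x hx => by rw [hx.1, hx.2]
  have hmem : ∀ l h i, star (s * l * p) * f i * (s * h * p) ∈ corner p p := fun l h i =>
    mul_mem_corner (mul_mem_corner (star_mem_corner hs hp (hcomp l)) (hf i)) (hcomp h)
  have hbound : ∀ l h i, ‖star (s * l * p) * f i * (s * h * p)‖ ≤ ‖s * l * p‖ * ‖s * h * p‖ :=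
    fun l h i => by
      refine (norm_mul_le _ _).trans (mul_le_mul_of_nonneg_right ?_ (norm_nonneg _))
      refine (norm_mul_le _ _).trans ?_
      rw [norm_star]
      exact mul_le_of_le_one_right (norm_nonneg _) (hf1 i)
  -- Compressing the arguments to `s l p` and `s h p` defines the limit form on all of `A`, as
  -- linear maps on `A` are needed below; on `(p + q)Ap` compression changes nothing.
  choose Λ hΛm hΛ using fun l h => hVp.exists_lim 𝒰 (hmem l h) (hbound l h)
  have hΛn : ∀ l h, ‖Λ l h‖ ≤ ‖s * l * p‖ * ‖s * h * p‖ := fun l h =>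
    hVp.norm_le (hΛm l h) (hmem l h) (Eventually.of_forall (hbound l h)) (hΛ l h)
  have huniq : ∀ {l h v}, v ∈ corner p p →
      IsWeakLim Vp 𝒰 (fun i => star (s * l * p) * f i * (s * h * p)) v → Λ l h = v :=
    fun hv hlim => hVp.unique (hΛm _ _) hv (hΛ _ _) hlim
  have add_r : ∀ l h h', Λ l (h + h') = Λ l h + Λ l h' := fun l h h' =>
    huniq (Submodule.add_mem _ (hΛm _ _) (hΛm _ _)) (by
      simpa only [mul_add, add_mul] using (hΛ l h).add (hΛ l h'))
  have smul_r : ∀ l (c : ℂ) h, Λ l (c • h) = c • Λ l h := fun l c h =>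
    huniq (Submodule.smul_mem _ _ (hΛm _ _)) (by
      simpa only [mul_smul_comm, smul_mul_assoc] using (hΛ l h).smul c)
  have add_l : ∀ l l' h, Λ (l + l') h = Λ l h + Λ l' h := fun l l' h =>
    huniq (Submodule.add_mem _ (hΛm _ _) (hΛm _ _)) (by
      simpa only [mul_add, add_mul, star_add] using (hΛ l h).add (hΛ l' h))
  have smul_l : ∀ (c : ℂ) l h, Λ (c • l) h = star c • Λ l h := fun c l h =>
    huniq (Submodule.smul_mem _ _ (hΛm _ _)) (by
      simpa only [mul_smul_comm, smul_mul_assoc, star_smul] using (hΛ l h).smul (star c))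
  have mod_r : ∀ l, ∀ h ∈ corner s p, ∀ b ∈ corner p p, Λ l (h * b) = Λ l h * b :=
    fun l h hh b hb => huniq (mul_mem_corner (hΛm _ _) hb) (by
      have h1 := hVp.corner_mul_right hp hb (hmem l h) (hbound l h) (hΛm l h) (hΛ l h)
      have h2 : s * (h * b) * p = s * h * p * b := by
        rw [hfix h hh, hfix _ (mul_mem_corner hh hb)]
      simpa only [h2, mul_assoc] using h1)
  have mod_l : ∀ h, ∀ l ∈ corner s p, ∀ b ∈ corner p p, Λ (l * b) h = star b * Λ l h :=
    fun h l hl b hb => huniq (mul_mem_corner (star_mem_corner hp hp hb) (hΛm _ _)) (by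
      have h1 := hVp.corner_mul hp (star_mem_corner hp hp hb) (hmem l h) (hbound l h) (hΛm l h)
        (hΛ l h)
      have h2 : s * (l * b) * p = s * l * p * b := by
        rw [hfix l hl, hfix _ (mul_mem_corner hl hb)]
      simpa only [h2, mul_assoc, star_mul] using h1)
  have hEF : ∀ {x}, x ∈ corner q p → x ∈ corner s p := corner_mono hsq hpp
  have hpF : p ∈ corner s p := ⟨hsp, hpp⟩
  -- the lower components
  have hC : ∀ h, ∃ m ∈ corner q p, ∀ x ∈ corner q p, Λ x h = star x * m := fun h => by
    -- The form is conjugate-linear in its first variable; its adjoint is a linear module map, and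
    -- self-duality represents it by an element `C h` of `qAp`.
    let T : A →ₗ[ℂ] A :=
      { toFun := fun l => star (Λ l h)
        map_add' := fun l l' => by rw [add_l, star_add]
        map_smul' := fun c l => by rw [smul_l, star_smul, star_star, RingHom.id_apply] }
    obtain ⟨m, hm, hmx⟩ := hsd T ‖s * h * p‖ (fun x hx => by
        change ‖star (Λ x h)‖ ≤ _
        rw [norm_star, mul_comm]
        have := hΛn x h
        rwa [hfix x (hEF hx)] at this)
      (fun x _ => star_mem_corner hp hp (hΛm x h))
      (fun x hx b hb => by
        change star (Λ (x * b) h) = star (Λ x h) * b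
        rw [mod_l h x (hEF hx) b hb, star_mul, star_star])
    exact ⟨m, hm, fun x hx => by simpa [T] using congrArg star (hmx x hx)⟩
  choose C hCm hCx using hC
  have hCuniq : ∀ {h v}, v ∈ corner q p → (∀ x ∈ corner q p, Λ x h = star x * v) → C h = v :=
    fun {h v} hv hx => by
      have hd := Submodule.sub_mem _ (hCm h) hv
      have : star (C h - v) * (C h - v) = 0 := by
        rw [mul_sub, ← hCx h _ hd, ← hx _ hd, sub_self]
      exact sub_eq_zero.mp ((CStarRing.star_mul_self_eq_zero_iff _).mp this)
  have hCmod : ∀ h ∈ corner s p, ∀ b ∈ corner p p, C (h * b) = C h * b := fun h hh b hb =>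
    hCuniq (mul_mem_corner (hCm h) hb) fun x hx => by
      rw [mod_r x h hh b hb, hCx h x hx, mul_assoc]
  let CL : A →ₗ[ℂ] A :=
    { toFun := C
      map_add' := fun h h' => hCuniq (Submodule.add_mem _ (hCm _) (hCm _)) fun x hx => by
        rw [add_r, hCx h x hx, hCx h' x hx, mul_add]
      map_smul' := fun c h => hCuniq (Submodule.smul_mem _ _ (hCm _)) fun x hx => by
        rw [smul_r, hCx h x hx, RingHom.id_apply, mul_smul_comm] }
  -- `C` is a contraction on `qAp`, by `‖C x‖² = ‖Λ (C x) x‖ ≤ ‖C x‖ ‖x‖`, so it comes from an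
  -- element of `qAq`.
  obtain ⟨c, hc, hcx, -⟩ := hVq.exists_multiplier hq hp (C := CL) zero_le_one (fun x hx => by
      change ‖C x‖ ≤ _
      rw [one_mul]
      rcases (norm_nonneg (C x)).eq_or_lt with h0 | h0
      · rw [← h0]; exact norm_nonneg _
      · refine le_of_mul_le_mul_left ?_ h0
        rw [← CStarRing.norm_star_mul_self, ← hCx x _ (hCm x)]
        have := hΛn (C x) x
        rwa [hfix x (hEF hx), hfix _ (hEF (hCm x))] at this)
    (fun x _ => hCm x) (fun x hx b hb => hCmod x (hEF hx) b hb)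
  -- the upper components
  obtain ⟨n, hn, hnx⟩ : ∃ n ∈ corner q p, ∀ x ∈ corner q p, Λ p x = star n * x := by
    let T : A →ₗ[ℂ] A :=
      { toFun := fun h => Λ p h
        map_add' := fun h h' => add_r p h h'
        map_smul' := fun c h => smul_r p c h }
    exact hsd T ‖s * p * p‖ (fun x hx => by
        have := hΛn p x
        rwa [hfix x (hEF hx)] at this)
      (fun x _ => hΛm p x) (fun x hx b hb => mod_r p x (hEF hx) b hb)
  have hns : star n ∈ corner p q := star_mem_corner hq hp hn
  -- The four blocks, in `pAp`, `qAp`, `pAq` and `qAq`.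
  refine ⟨Λ p p + C p + star n + c, Submodule.add_mem _ (Submodule.add_mem _ (Submodule.add_mem _
    (corner_mono hsp hps (hΛm p p)) (corner_mono hsq hps (hCm p))) (corner_mono hsp hqs hns))
    (corner_mono hsq hqs hc), fun l hl h hh => ?_⟩
  have hsplit : ∀ x ∈ corner s p, p * x ∈ corner p p ∧ q * x ∈ corner q p ∧ p * x + q * x = x :=
    fun x hx => ⟨⟨by rw [← mul_assoc, hpp], by rw [mul_assoc, hx.2]⟩,
      ⟨by rw [← mul_assoc, hqq], by rw [mul_assoc, hx.2]⟩, by rw [← add_mul]; exact hx.1⟩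
  obtain ⟨hl0, hl1, hl2⟩ := hsplit l hl
  obtain ⟨hh0, hh1, hh2⟩ := hsplit h hh
  set l0 := p * l
  set l1 := q * l
  set h0 := p * h
  set h1 := q * h
  have hl0s : star l0 ∈ corner p p := star_mem_corner hp hp hl0
  have hl1s : star l1 ∈ corner p q := star_mem_corner hq hp hl1
  have hval : Λ l h = star l * (Λ p p + C p + star n + c) * h := by
    have e0 : (Λ p p + C p + star n + c) * h = Λ p p * h0 + star n * h1 + C h := by
      have e1 : C h = C p * h0 + c * h1 := by
        rw [← hh2, show C (h0 + h1) = C h0 + C h1 from CL.map_add h0 h1, hcx h1 hh1]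
        congr 1
        conv_lhs => rw [← hh0.1]
        exact hCmod p hpF h0 hh0
      rw [e1, ← hh2]
      simp only [add_mul, mul_add]
      rw [mul_eq_zero_of_mem_corner (hΛm p p) hh1 hpq, mul_eq_zero_of_mem_corner (hCm p) hh1 hpq, mul_eq_zero_of_mem_corner hns hh0 hqp, mul_eq_zero_of_mem_corner hc hh0 hqp]
      abel
    have e2 : Λ l h = star l0 * (Λ p p * h0 + star n * h1) + star l1 * C h := by
      have e3 : Λ l0 h = star l0 * Λ p h := by
        conv_lhs => rw [← hl0.1]
        exact mod_l h p hpF l0 hl0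
      have e4 : Λ p h0 = Λ p p * h0 := by
        conv_lhs => rw [← hh0.1]
        exact mod_r p p hpF h0 hh0
      rw [← hl2, add_l, e3, hCx h l1 hl1]
      nth_rw 1 [← hh2]
      rw [add_r, e4, hnx h1 hh1]
    rw [mul_assoc, e0, e2, ← hl2, star_add]
    simp only [add_mul, mul_add]
    rw [mul_eq_zero_of_mem_corner hl0s (hCm h) hpq, mul_eq_zero_of_mem_corner hl1s (mul_mem_corner (hΛm p p) hh0) hqp,
      mul_eq_zero_of_mem_corner hl1s (mul_mem_corner hns hh1) hqp]
    abel
  rw [← hval]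
  have := hΛ l h
  rwa [hfix l hl, hfix h hh] at this

omit hp hpq in
/-- The norm of an element of `(p + q)A(p + q)` is determined by its action on `(p + q)Ap` and its
compression to the part of `q` disjoint from `p`. -/
lemma norm_le_of_coefficients (hp : IsStarProjection p) (hpq : p * q = 0) {z : A}
    (hz : IsStarProjection z) (hzq : z ∈ corner q q) (hzE : ∀ x ∈ corner q p, z * x = x)
    (hzy : ∀ y, (∀ x ∈ corner q p, y * x = 0) → y * z = 0) {a : A}
    (ha : a ∈ corner (p + q) (p + q)) {r : ℝ} (hr : 0 ≤ r)
    (h1 : ∀ l ∈ corner (p + q) p, ∀ h ∈ corner (p + q) p, ‖l‖ ≤ 1 → ‖h‖ ≤ 1 →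
      ‖star l * a * h‖ ≤ r)
    (h2 : ‖(q - z) * a * (q - z)‖ ≤ r) : ‖a‖ ≤ r := by
  have hqp := mul_eq_zero_of_orthogonal hq hp hpq
  have hs := isStarProjection_add_of_orthogonal hq hp hpq
  have hpp := hp.isIdempotentElem.eq
  have hqq := hq.isIdempotentElem.eq
  have hzz := hz.isIdempotentElem.eq
  set Q := q - z with hQ_def
  have hQsa : star Q = Q := (hq.isSelfAdjoint.sub hz.isSelfAdjoint).star_eq
  have hQQ : Q * Q = Q := by
    rw [hQ_def, sub_mul, mul_sub, mul_sub, hqq, hzq.1, hzq.2, hzz]; abel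
  have hQE : ∀ x ∈ corner q p, Q * x = 0 := fun x hx => by
    rw [hQ_def, sub_mul, hx.1, hzE x hx, sub_self]
  have hQq : Q * q = Q := by rw [hQ_def, sub_mul, hqq, hzq.2]
  have hQp : Q * p = 0 := by rw [← hQq, mul_assoc, hqp, mul_zero]
  have hQs : Q * (p + q) = Q := by rw [mul_add, hQp, hQq, zero_add]
  have hsum : p + q = p + z + Q := by rw [hQ_def]; abel
  have hQF : ∀ x ∈ corner (p + q) p, Q * x = 0 := fun x hx => by
    rw [← hQq, mul_assoc]
    exact hQE _ ⟨by rw [← mul_assoc, hqq], by rw [mul_assoc, hx.2]⟩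
  have hpF : p ∈ corner (p + q) p := ⟨by rw [add_mul, hpp, hqp, add_zero], hpp⟩
  have hEF : ∀ {x}, x ∈ corner q p → x ∈ corner (p + q) p :=
    corner_mono (by rw [add_mul, hqq, hpq, zero_add]) hpp
  -- `Q` kills `(p + q)Ap`, which `b` preserves, so `Q b` kills `p` and `qAp`, hence also `z`.
  -- Applied to adjoints as well, this makes `Q` central in `(p + q)A(p + q)`.
  have hcentral : ∀ b ∈ corner (p + q) (p + q), Q * b = Q * b * Q := fun b hb => by
    have e1 : Q * b * p = 0 := by
      rw [mul_assoc]
      exact hQF _ (mul_mem_corner hb hpF)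
    have e2 : Q * b * z = 0 := hzy _ fun x hx => by
      rw [mul_assoc]
      exact hQF _ (mul_mem_corner hb (hEF hx))
    conv_lhs => rw [← hb.2, ← mul_assoc, hsum, mul_add, mul_add, e1, e2, zero_add, zero_add]
  have has : star a ∈ corner (p + q) (p + q) := star_mem_corner hs hs ha
  have hcomm : a * Q = Q * a * Q := by
    have := congrArg star (hcentral _ has)
    simpa [hQsa, mul_assoc] using this
  have hcomm' : star a * Q = Q * star a * Q := by
    have := congrArg star (hcentral _ ha)
    simpa [hQsa, mul_assoc] using this
  have hF : ∀ h ∈ corner (p + q) p, ‖a * h‖ ≤ r * ‖h‖ := fun h hh => by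
    rcases (norm_nonneg (a * h)).eq_or_lt with h0 | h0
    · rw [← h0]; positivity
    rcases (norm_nonneg h).eq_or_lt with h3 | h3
    · have : h = 0 := norm_eq_zero.mp h3.symm
      simp [this]
    have hah := mul_mem_corner ha hh
    have h4 := h1 (((‖a * h‖⁻¹ : ℝ) : ℂ) • (a * h)) (Submodule.smul_mem _ _ hah)
      (((‖h‖⁻¹ : ℝ) : ℂ) • h) (Submodule.smul_mem _ _ hh)
      (by rw [norm_smul, Complex.norm_real, norm_inv, norm_norm, inv_mul_cancel₀ h0.ne'])
      (by rw [norm_smul, Complex.norm_real, norm_inv, norm_norm, inv_mul_cancel₀ h3.ne'])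
    rw [star_smul, smul_mul_assoc, smul_mul_assoc, mul_smul_comm, mul_assoc, norm_smul, norm_smul,
      CStarRing.norm_star_mul_self, norm_star, Complex.norm_real, Complex.norm_real, norm_inv,
      norm_inv, norm_norm, norm_norm] at h4
    field_simp at h4
    linarith
  set s0 := star a * a with hs0
  have hs0m : s0 ∈ corner (p + q) (p + q) := mul_mem_corner has ha
  have hs0b : ∃ b, s0 = star b * b := ⟨a, rfl⟩
  have hrr : 0 ≤ r ^ 2 := by positivity
  have hnorm : ‖s0‖ ≤ r ^ 2 := by
    refine norm_le_of_cfc_cutoff_mul_eq_zero hs0b hrr fun ε hε => ?_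
    have c1 : ∀ h ∈ corner (p + q) p,
        cfc (fun t : ℝ => max 0 (t - (r ^ 2 + ε))) s0 * h = 0 := fun h hh => by
      refine cfc_cutoff_mul_eq_zero (isClosed_corner _ _) hs0b
        (mem_leftStabilizer_corner hs hs0m) hrr hε (fun k hk => ?_) hh
      have hstar : ‖star a * (a * k)‖ ≤ r * ‖a * k‖ :=
        norm_star_mul_le_of_norm_mul_le hr
          (hF _ (mul_mem_corner has (mul_mem_corner ha hk)))
      rw [hs0, mul_assoc, sq, mul_assoc]
      exact hstar.trans (mul_le_mul_of_nonneg_left (hF k hk) hr)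
    have hs0Q : s0 * Q = star (Q * a * Q) * (Q * a * Q) := by
      have hQQ' : ∀ x, Q * (Q * x) = Q * x := fun x => by rw [← mul_assoc, hQQ]
      calc s0 * Q = star a * (a * Q) := mul_assoc _ _ _
        _ = (star a * Q) * (a * Q) := by
          nth_rw 1 [hcomm]
          simp only [mul_assoc]
        _ = Q * star a * Q * (a * Q) := by rw [hcomm']
        _ = _ := by simp only [star_mul, hQsa, mul_assoc, hQQ']
    have hs0sa : star s0 = s0 := by rw [hs0, star_mul, star_star]
    have hs0Q' : Q * s0 = s0 * Q := by
      have := congrArg star hs0Q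
      rwa [star_mul s0, hs0sa, hQsa, star_mul, star_star, ← hs0Q] at this
    have hQ1 : Q ∈ corner Q (1 : A) := ⟨hQQ, mul_one _⟩
    -- The right ideal `Q A` is invariant under `s0`, which acts there as the square of `Q a Q`.
    have c2 : cfc (fun t : ℝ => max 0 (t - (r ^ 2 + ε))) s0 * Q = 0 := by
      refine cfc_cutoff_mul_eq_zero (isClosed_corner Q 1) hs0b (fun k hk => ?_) hrr hε
        (fun k hk => ?_) hQ1
      · have h3 : s0 * k ∈ corner Q 1 := ⟨by rw [← mul_assoc, hs0Q', mul_assoc, hk.1], mul_one _⟩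
        refine ⟨h3, ?_⟩
        rwa [hs0sa]
      · conv_lhs => rw [← hk.1, ← mul_assoc, hs0Q]
        refine (norm_mul_le _ _).trans (mul_le_mul_of_nonneg_right ?_ (norm_nonneg _))
        rw [CStarRing.norm_star_mul_self, sq]
        exact mul_le_mul h2 h2 (norm_nonneg _) hr
    -- The cutoff kills `p`, `z` and `Q`, whose sum is `p + q`; hence it kills `s0`.
    have c3 := hzy _ fun x hx => c1 x (hEF hx)
    have c4 : cfc (fun t : ℝ => max 0 (t - (r ^ 2 + ε))) s0 * (p + q) = 0 := by
      rw [hsum, mul_add, mul_add, c1 p hpF, c3, c2, add_zero, add_zero]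
    nth_rw 2 [← hs0m.1]
    rw [← mul_assoc, c4, zero_mul]
  rw [hs0, CStarRing.norm_star_mul_self, ← sq] at hnorm
  exact abs_le_of_sq_le_sq' hnorm hr |>.2

/-- If `pAp` and `qAq` have preduals and `qAp` is self-dual over `pAp`, then `(p + q)A(p + q)` has
a predual. -/
theorem exists_isPredualOn_corner_add (hVp : IsPredualOn (corner p p) Vp)
    (hVq : IsPredualOn (corner q q) Vq) (hsd : IsSelfDualCorner q p) :
    ∃ V, IsPredualOn (corner (p + q) (p + q)) V := by
  have hqp := mul_eq_zero_of_orthogonal hq hp hpq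
  have hs := isStarProjection_add_of_orthogonal hq hp hpq
  have hpp := hp.isIdempotentElem.eq
  have hqq := hq.isIdempotentElem.eq
  obtain ⟨z, hzq, hz, hzE, hzy⟩ := hVq.exists_support hq hp
  have hzz := hz.isIdempotentElem.eq
  set Q := q - z with hQ_def
  have hQsa : star Q = Q := (hq.isSelfAdjoint.sub hz.isSelfAdjoint).star_eq
  have hQQ : Q * Q = Q := by
    rw [hQ_def, sub_mul, mul_sub, mul_sub, hqq, hzq.1, hzq.2, hzz]; abel
  have hQproj : IsStarProjection Q := ⟨hQQ, hQsa⟩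
  have hQq : Q * q = Q := by rw [hQ_def, sub_mul, hqq, hzq.2]
  have hqQ : q * Q = Q := by rw [hQ_def, mul_sub, hqq, hzq.1]
  have hQmem : Q ∈ corner q q := ⟨hqQ, hQq⟩
  have hQn : ‖Q‖ ≤ 1 := hQproj.norm_le
  have hQcomp : ∀ a, Q * a * Q ∈ corner q q := fun a =>
    ⟨by rw [← mul_assoc, ← mul_assoc, hqQ], by rw [mul_assoc, hQq]⟩
  have hQle : ∀ a : A, ‖Q * a * Q‖ ≤ ‖a‖ := fun a => by
    refine (norm_mul_le _ _).trans ((mul_le_of_le_one_right (norm_nonneg _) hQn).trans ?_)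
    exact (norm_mul_le _ _).trans (mul_le_of_le_one_left (norm_nonneg _) hQn)
  let comp : A → A → A →ₗ[ℂ] A := fun l h => LinearMap.mulRight ℂ h ∘ₗ LinearMap.mulLeft ℂ l
  have hcomp : ∀ l h a, comp l h a = l * a * h := fun _ _ _ => rfl
  have hmem : ∀ l ∈ corner (p + q) p, ∀ h ∈ corner (p + q) p, ∀ a ∈ corner (p + q) (p + q),
      star l * a * h ∈ corner p p := fun l hl h hh a ha =>
    mul_mem_corner (mul_mem_corner (star_mem_corner hs hp hl) ha) hh
  -- Functionals of `pAp` test the coefficients, and functionals of `qAq` test the compression to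
  -- `Q`.
  refine ⟨{ψ | (∃ l ∈ corner (p + q) p, ∃ h ∈ corner (p + q) p, ‖l‖ ≤ 1 ∧ ‖h‖ ≤ 1 ∧
    ∃ φ ∈ Vp, ψ = φ ∘ₗ comp (star l) h) ∨ ∃ φ ∈ Vq, ψ = φ ∘ₗ comp Q Q},
    IsPredualOn.of_families ?_ ?_ ?_⟩
  · rintro ψ (⟨l, hl, h, hh, hl1, hh1, φ, hφ, rfl⟩ | ⟨φ, hφ, rfl⟩) w hw
    · rw [LinearMap.comp_apply, hcomp]
      refine (hVp.norm_apply_le φ hφ _ (hmem l hl h hh w hw)).trans ?_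
      refine (norm_mul_le _ _).trans ((mul_le_of_le_one_right (norm_nonneg _) hh1).trans ?_)
      exact (norm_mul_le _ _).trans (mul_le_of_le_one_left (norm_nonneg _) (by rwa [norm_star]))
    · rw [LinearMap.comp_apply, hcomp]
      exact (hVq.norm_apply_le φ hφ _ (hQcomp w)).trans (hQle w)
  · intro a ha r hr hle
    refine norm_le_of_coefficients hq hp hpq hz hzq hzE hzy ha hr (fun l hl h hh hl1 hh1 => ?_) ?_
    · refine hVp.norming _ (hmem l hl h hh a ha) r hr fun φ hφ => ?_
      exact hle (φ ∘ₗ comp (star l) h) (Or.inl ⟨l, hl, h, hh, hl1, hh1, φ, hφ, rfl⟩)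
    · refine hVq.norming _ (hQcomp a) r hr fun φ hφ => ?_
      exact hle (φ ∘ₗ comp Q Q) (Or.inr ⟨φ, hφ, rfl⟩)
  · intro 𝒰 f hf hf1
    obtain ⟨a, ha, halim⟩ := exists_lim_coefficients hq hp hpq hVp hVq hsd 𝒰 hf hf1
    have hdn : ∀ i, ‖Q * f i * Q‖ ≤ 1 := fun i => (hQle _).trans (hf1 i)
    obtain ⟨d, hd, hdlim⟩ := hVq.exists_lim 𝒰 (fun i => hQcomp (f i)) hdn
    have hd1 : Q * d = d := by
      have h1 := hVq.corner_mul hq hQmem (fun i => hQcomp (f i)) hdn hd hdlim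
      have h2 : ∀ i, Q * (Q * f i * Q) = Q * f i * Q := fun i => by
        rw [← mul_assoc, ← mul_assoc, hQQ]
      simp only [h2] at h1
      exact hVq.unique (mul_mem_corner hQmem hd) hd h1 hdlim
    have hd2 : d * Q = d := by
      have h1 := hVq.corner_mul_right hq hQmem (fun i => hQcomp (f i)) hdn hd hdlim
      have h2 : ∀ i, Q * f i * Q * Q = Q * f i * Q := fun i => by rw [mul_assoc, hQQ]
      simp only [h2] at h1
      exact hVq.unique (mul_mem_corner hd hQmem) hd h1 hdlim
    have hsq : (p + q) * q = q := by rw [add_mul, hqq, hpq, zero_add]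
    have hqs : q * (p + q) = q := by rw [mul_add, hqq, hqp, zero_add]
    have hQF : ∀ x ∈ corner (p + q) p, Q * x = 0 := fun x hx => by
      rw [← hQq, mul_assoc, hQ_def, sub_mul, hzE (q * x)
        ⟨by rw [← mul_assoc, hqq], by rw [mul_assoc, hx.2]⟩, ← mul_assoc, hqq, sub_self]
    have hQs : Q ∈ corner (p + q) (p + q) := corner_mono hsq hqs hQmem
    -- The coefficients determine `a` only up to its `Q`-block, which is replaced by the weak limit
    -- `d` of the blocks `Q f i Q`.
    refine ⟨a - Q * a * Q + d, Submodule.add_mem _ (Submodule.sub_mem _ ha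
      (mul_mem_corner (mul_mem_corner hQs ha) hQs)) (corner_mono hsq hqs hd), ?_⟩
    rintro ψ (⟨l, hl, h, hh, hl1, hh1, φ, hφ, rfl⟩ | ⟨φ, hφ, rfl⟩)
    · have h1 : star l * (a - Q * a * Q + d) * h = star l * a * h := by
        have h2 : d * h = 0 := by rw [← hd2, mul_assoc, hQF h hh, mul_zero]
        rw [mul_assoc, add_mul, sub_mul, mul_assoc (Q * a), hQF h hh, h2, mul_zero, sub_zero,
          add_zero, mul_assoc]
      simp only [LinearMap.comp_apply, hcomp, h1]
      exact halim l hl h hh φ hφ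
    · have h1 : Q * (a - Q * a * Q + d) * Q = d := by
        have h2 : Q * (Q * a * Q) * Q = Q * a * Q := by
          rw [← mul_assoc, ← mul_assoc, hQQ, mul_assoc, hQQ]
        rw [mul_add Q, mul_sub Q, add_mul _ _ Q, sub_mul _ _ Q, h2, sub_self, zero_add, hd1, hd2]
      simp only [LinearMap.comp_apply, hcomp, h1]
      exact hdlim φ hφ

end CornerSum

/-! ### From corners to the algebra and back -/

section Induction

variable {A : Type*} [CStarAlgebra A]

lemma isPredualOn_corner_zero : IsPredualOn (corner (0 : A) 0) ∅ := by
  have h0 : ∀ w ∈ corner (0 : A) 0, w = 0 := fun w hw => by simpa using hw.1.symm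
  refine IsPredualOn.of_families (by simp) (fun w hw r hr _ => by simpa [h0 w hw] using hr)
    fun _ _ _ _ => ⟨0, Submodule.zero_mem _, by simp [IsWeakLim]⟩

/-- A C*-algebra has a predual if the corners of a finite orthogonal family of projections with sum
one do. -/
theorem exists_isPredualOn_of_corners {ι : Type*} [Fintype ι] [DecidableEq ι] (e : ι → A)
    (he : ∀ i, IsStarProjection (e i)) (horth : ∀ i j, i ≠ j → e i * e j = 0)
    (hsum : ∑ i, e i = 1) (h : ∀ i j, ∃ V, IsPredualOn (corner (e i) (e j)) V) :
    ∃ V, IsPredualOn (⊤ : Submodule ℂ A) V := by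
  -- Self-duality over the partial sum is carried along for every `e j`, as each inductive step
  -- consumes it for the projection being adjoined. The preduals of the corners `e j A e a` serve to
  -- renew it.
  have key : ∀ s : Finset ι, IsStarProjection (∑ i ∈ s, e i) ∧
      (∀ j, j ∉ s → (∑ i ∈ s, e i) * e j = 0) ∧
      (∀ j, IsSelfDualCorner (e j) (∑ i ∈ s, e i)) ∧
      ∃ V, IsPredualOn (corner (∑ i ∈ s, e i) (∑ i ∈ s, e i)) V := by
    intro s
    induction s using Finset.induction_on with
    | empty =>
      simp only [Finset.sum_empty]
      exact ⟨.zero A, by simp, fun j => isSelfDualCorner_zero _, ∅, isPredualOn_corner_zero⟩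
    | insert a s ha ih =>
      obtain ⟨hP, hz, hsd, V, hV⟩ := ih
      have hPa := hz a ha
      obtain ⟨Va, hVa⟩ := h a a
      rw [Finset.sum_insert ha, add_comm]
      refine ⟨isStarProjection_add_of_orthogonal (he a) hP hPa, fun j hj => ?_, fun j => ?_,
        exists_isPredualOn_corner_add (he a) hP hPa hV hVa (hsd a)⟩
      · rw [Finset.mem_insert, not_or] at hj
        rw [add_mul, hz j hj.2, horth a j (Ne.symm hj.1), add_zero]
      · obtain ⟨Vj, hVj⟩ := h j a
        exact (hsd j).add (hVj.isSelfDualCorner (he j) (he a)) hP (he a) hPa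
  obtain ⟨V, hV⟩ := (key Finset.univ).2.2.2
  have htop : corner (1 : A) 1 = ⊤ := by
    ext x
    simp [mem_corner]
  rw [hsum, htop] at hV
  exact ⟨V, hV⟩

/-- The corners of a C*-algebra with a predual have preduals. -/
lemma IsPredualOn.corner_of_top {V : Set (A →ₗ[ℂ] ℂ)} (hV : IsPredualOn (⊤ : Submodule ℂ A) V)
    (q p : A) : IsPredualOn (corner q p) V := by
  refine IsPredualOn.of_families (fun φ hφ w _ => hV.norm_apply_le φ hφ w trivial)
    (fun w _ => hV.norming w trivial) fun 𝒰 f hf hf1 => ?_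
  obtain ⟨w, -, hlim⟩ := hV.exists_lim 𝒰 (fun _ => Submodule.mem_top) hf1
  have hclosed : IsClosed ((⊤ : Submodule ℂ A) : Set A) := isClosed_univ
  refine ⟨w, ⟨?_, ?_⟩, hlim⟩
  -- Weak continuity of multiplication makes the equations `q x = x` and `x p = x` pass to weak
  -- limits.
  · have h1 := hV.isWeakLim_mul hclosed (a := q) (fun _ _ => ⟨trivial, trivial⟩)
      (fun _ => Submodule.mem_top) hf1 Submodule.mem_top hlim
    simp only [fun i => (hf i).1] at h1
    exact hV.unique trivial trivial h1 hlim
  · have h1 := hV.isWeakLim_mul_right hclosed (a := p) (fun _ _ => ⟨trivial, trivial⟩)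
      (fun _ => Submodule.mem_top) hf1 Submodule.mem_top hlim
    simp only [fun i => (hf i).2] at h1
    exact hV.unique trivial trivial h1 hlim

end Induction

/-! ### Norming sets and Banach preduals -/

section Preduals

/-- A space isometric to a dual carries a norming set of functionals for which its unit ball is
compact. -/
theorem exists_isPredualOn_of_predual {A E P : Type*} [NormedAddCommGroup A] [NormedSpace ℂ A]
    [NormedAddCommGroup E] [NormedSpace ℂ E] [NormedAddCommGroup P] [NormedSpace ℂ P]
    {W : Submodule ℂ A} (k : A →ₗ[ℂ] E) (hk : ∀ w ∈ W, ‖k w‖ = ‖w‖)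
    (hsurj : ∀ x, ∃ w ∈ W, k w = x) (Φ : E ≃ₗᵢ[ℂ] StrongDual ℂ P) : ∃ V, IsPredualOn W V := by
  let ev : P → A →ₗ[ℂ] ℂ := fun p =>
    { toFun := fun a => Φ (k a) p
      map_add' := fun a b => by simp
      map_smul' := fun c a => by simp }
  have hev : ∀ p a, ev p a = Φ (k a) p := fun _ _ => rfl
  refine ⟨{φ | ∃ p, ‖p‖ ≤ 1 ∧ φ = ev p}, ?_, ?_, ?_⟩
  · rintro _ ⟨p, hp, rfl⟩ w hw
    rw [hev]
    refine ((Φ (k w)).le_opNorm p).trans ?_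
    rw [Φ.norm_map, hk w hw]
    exact mul_le_of_le_one_right (norm_nonneg _) hp
  · intro w hw r hr h
    rw [← hk w hw, ← Φ.norm_map]
    refine ContinuousLinearMap.opNorm_le_of_unit_norm (𝕜 := ℂ) hr fun p hp => ?_
    exact h (ev p) ⟨p, hp.le, rfl⟩
  · intro F hF
    let g : A → WeakDual ℂ P := fun a => StrongDual.toWeakDual (Φ (k a))
    have hcomp := WeakDual.isCompact_closedBall (𝕜 := ℂ) (E := P) 0 1
    rw [isCompact_iff_ultrafilter_le_nhds] at hcomp
    obtain ⟨ξ, -, hξ⟩ := hcomp (F.map g) (by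
      rw [le_principal_iff, Ultrafilter.coe_map, mem_map]
      filter_upwards [hF] with w hw
      simp only [Set.mem_preimage, g, Metric.mem_closedBall, dist_zero_right]
      change ‖Φ (k w)‖ ≤ 1
      rw [Φ.norm_map, hk w hw.1]
      exact hw.2)
    obtain ⟨w, hw, hkw⟩ := hsurj (Φ.symm (WeakDual.toStrongDual ξ))
    refine ⟨w, hw, ?_⟩
    rintro _ ⟨p, -, rfl⟩
    have h1 : Tendsto g F (𝓝 ξ) := by
      rwa [Ultrafilter.coe_map] at hξ
    have h2 := ((WeakDual.eval_continuous p).tendsto ξ).comp h1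
    have h3 : ev p w = ξ p := by
      rw [hev, hkw, Φ.apply_symm_apply]
      rfl
    rw [h3]
    exact h2

variable {E : Type w} [NormedAddCommGroup E] [NormedSpace ℂ E]

/-- The predual is the closed span of `V` in the dual of `E`. Evaluation is isometric because `V` is
norming. It is onto by Hahn–Banach: a functional of norm at most `r` cannot be separated from the
compact convex image of the ball of radius `r`. -/
lemma IsPredualOn.exists_predual_of_dual {V : Set (E →ₗ[ℂ] ℂ)}
    (hV : IsPredualOn (⊤ : Submodule ℂ E) V) {D : Type w} [NormedAddCommGroup D]
    [NormedSpace ℂ D] [CompleteSpace D] (ε : D ≃ₗᵢ[ℂ] StrongDual ℂ E) :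
    ∃ (P : Type w) (_ : NormedAddCommGroup P) (_ : NormedSpace ℂ P) (_ : CompleteSpace P),
      Nonempty (E ≃ₗᵢ[ℂ] StrongDual ℂ P) := by
  let S : Submodule ℂ D :=
    Submodule.span ℂ {φ | (ε φ : E →ₗ[ℂ] ℂ) ∈ V}
  let P := S.topologicalClosure
  have hV' : ∀ φ ∈ V, ∃ ψ : D, ψ ∈ S ∧ ‖ψ‖ ≤ 1 ∧ ∀ x, ε ψ x = φ x := fun φ hφ => by
    let ψ : StrongDual ℂ E := φ.mkContinuous 1 fun x => by
      simpa using hV.norm_apply_le φ hφ x trivial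
    have hψ : ε (ε.symm ψ) = ψ := ε.apply_symm_apply ψ
    refine ⟨ε.symm ψ, Submodule.subset_span ?_, ?_, fun x => by rw [hψ]; rfl⟩
    · rw [Set.mem_ofPred_eq, hψ]
      exact hφ
    · rw [ε.symm.norm_map]
      exact φ.mkContinuous_norm_le zero_le_one _
  let ι : E →ₗ[ℂ] StrongDual ℂ P :=
    { toFun := fun x => ((NormedSpace.inclusionInDoubleDual ℂ E x).comp
        (ε.toContinuousLinearEquiv : D →L[ℂ] StrongDual ℂ E)).comp P.subtypeL
      map_add' := fun x y => by ext; simp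
      map_smul' := fun c x => by ext; simp }
  have hι : ∀ x (φ : P), ι x φ = ε φ x := fun _ _ => rfl
  have hnorm : ∀ x, ‖ι x‖ = ‖x‖ := fun x => by
    refine le_antisymm (ContinuousLinearMap.opNorm_le_bound _ (norm_nonneg _) fun φ => ?_)
      (hV.norming x trivial ‖ι x‖ (ContinuousLinearMap.opNorm_nonneg _) fun φ hφ => ?_)
    · rw [hι, mul_comm]
      exact ((ε φ).le_opNorm x).trans_eq (by rw [ε.norm_map]; rfl)
    · obtain ⟨ψ, hψS, hψ1, hψ⟩ := hV' φ hφ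
      rw [← hψ]
      refine ((ι x).le_opNorm ⟨ψ, S.le_topologicalClosure hψS⟩).trans ?_
      exact mul_le_of_le_one_right (norm_nonneg _) hψ1
  have hsurj : Function.Surjective ι := fun ξ => by
    obtain ⟨r, hr0, hr⟩ : ∃ r : ℝ, 0 ≤ r ∧ ∀ φ : P, ‖ξ φ‖ ≤ r * ‖φ‖ :=
      ⟨‖ξ‖, ContinuousLinearMap.opNorm_nonneg _, ξ.le_opNorm⟩
    -- In the algebraic dual of `S` with pointwise convergence, the continuous functionals are
    -- evaluations at elements of `S`, so a separating functional is itself an element of the span.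
    let B : (S →ₗ[ℂ] ℂ) →ₗ[ℂ] S →ₗ[ℂ] ℂ := LinearMap.id
    let k : E →ₗ[ℂ] WeakBilin B :=
      { toFun := fun x => (({ toFun := fun φ => ε φ x
                              map_add' := fun _ _ => by simp
                              map_smul' := fun _ _ => by simp } : S →ₗ[ℂ] ℂ))
        map_add' := fun x y => LinearMap.ext fun φ => map_add (ε φ) x y
        map_smul' := fun c x => LinearMap.ext fun φ => map_smul (ε φ) c x }
    have hk : ∀ x (φ : S), B (k x) φ = ε φ x := fun _ _ => rfl
    let ξS : WeakBilin B := (ξ : P →ₗ[ℂ] ℂ) ∘ₗ Submodule.inclusion S.le_topologicalClosure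
    have hξS : ∀ φ : S, B ξS φ = ξ ⟨φ, S.le_topologicalClosure φ.2⟩ := fun _ => rfl
    have hinj : Function.Injective B := Function.injective_id
    let K : Set (WeakBilin B) := k '' Metric.closedBall 0 r
    have hKconv : Convex ℝ K := by
      have := (convex_closedBall (0 : E) r).linear_image (k.restrictScalars ℝ)
      exact this
    have hKcomp : IsCompact K := by
      rw [isCompact_iff_ultrafilter_le_nhds]
      intro F hF
      rw [le_principal_iff] at hF
      classical
      let g : WeakBilin B → E := fun y => if h : y ∈ K then h.choose else 0
      have hg : ∀ y, ‖g y‖ ≤ r := fun y => by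
        simp only [g]
        split_ifs with h
        · simpa using h.choose_spec.1
        · simpa using hr0
      have hgk : ∀ y ∈ K, k (g y) = y := fun y hy => by
        simp only [g, dif_pos hy]
        exact hy.choose_spec.2
      obtain ⟨x, -, hx⟩ := hV.exists_lim F (fun _ => Submodule.mem_top) hg
      have hxn : ‖x‖ ≤ r := hV.norm_le trivial (fun _ => Submodule.mem_top)
        (Eventually.of_forall hg) hx
      refine ⟨k x, ⟨x, by simpa using hxn, rfl⟩, ?_⟩
      -- Convergence is known on the generating set and passes to linear combinations; this is why
      -- the span is used before its closure.
      have hS : ∀ φ ∈ S, Tendsto (fun y => ε φ (g y)) F (𝓝 (ε φ x)) := fun φ hφ => by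
        induction hφ using Submodule.span_induction with
        | mem φ h => exact hx _ h
        | zero => simp
        | add φ ψ _ _ h1 h2 => simpa using h1.add h2
        | smul c φ _ h1 => simpa using h1.const_mul c
      have : Tendsto (id : WeakBilin B → WeakBilin B) F (𝓝 (k x)) := by
        rw [WeakBilin.tendsto_iff_forall_eval_tendsto B hinj]
        intro φ
        rw [hk]
        refine (hS φ φ.2).congr' ?_
        filter_upwards [hF] with y hy
        rw [← hk, hgk y hy, id]
      exact this
    have : T2Space (WeakBilin B) := (WeakBilin.isEmbedding hinj).t2Space
    by_cases hmem : ξS ∈ K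
    · obtain ⟨x, -, hx⟩ := hmem
      refine ⟨x, ?_⟩
      have hden : Dense (Set.range (Submodule.inclusion S.le_topologicalClosure)) := by
        rw [Subtype.dense_iff]
        intro φ hφ
        have h1 : Subtype.val '' (Set.range (Submodule.inclusion S.le_topologicalClosure)) =
            (S : Set D) := by
          ext ψ
          constructor
          · rintro ⟨_, ⟨χ, rfl⟩, rfl⟩
            exact χ.2
          · intro h
            exact ⟨_, ⟨⟨ψ, h⟩, rfl⟩, rfl⟩
        exact h1 ▸ hφ
      refine ContinuousLinearMap.coeFn_injective ?_
      refine Continuous.ext_on hden (ι x).continuous ξ.continuous ?_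
      rintro _ ⟨φ, rfl⟩
      have := congrArg (fun y => B y φ) hx
      exact this
    · obtain ⟨f, u, h1, h2⟩ := RCLike.geometric_hahn_banach_closed_point (𝕜 := ℂ) hKconv
        hKcomp.isClosed hmem
      obtain ⟨φ, rfl⟩ := LinearMap.dualEmbedding_surjective B f
      have e1 : ∀ y, WeakBilin.eval B φ y = B y φ := fun _ => rfl
      rw [e1, hξS] at h2
      have h3 : ∀ x : E, ‖x‖ ≤ r → ‖ε φ x‖ < u := fun x hx => by
        obtain ⟨c, hc, hcx⟩ : ∃ c : ℂ, ‖c‖ = 1 ∧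
            c * ε φ x = (‖ε φ x‖ : ℂ) :=
          RCLike.exists_norm_eq_mul_self (K := ℂ) _ |>.imp fun c h => ⟨h.1, h.2.symm⟩
        have h4 := h1 (k (c • x)) ⟨c • x, by simpa [norm_smul, hc] using hx, rfl⟩
        rw [e1, hk, map_smul, smul_eq_mul, hcx] at h4
        simpa using h4
      -- Separation would give `‖φ‖ r ≤ u < Re ξ(φ) ≤ r ‖φ‖`.
      have h5 : ‖(φ : D)‖ * r ≤ u := by
        rcases hr0.eq_or_lt with h0 | h0
        · rw [← h0, mul_zero]
          exact (norm_nonneg _).trans (h3 0 (by simpa using hr0)).le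
        · rw [← le_div_iff₀ h0]
          have hu : 0 ≤ u := (norm_nonneg _).trans (h3 0 (by simpa using hr0)).le
          rw [← ε.norm_map]
          refine ContinuousLinearMap.opNorm_le_of_unit_norm (𝕜 := ℂ) (by positivity) fun x hx => ?_
          rw [le_div_iff₀ h0]
          have h6 := h3 ((r : ℂ) • x) (by simp [norm_smul, hx, abs_of_nonneg hr0])
          rw [map_smul, norm_smul, Complex.norm_real, Real.norm_of_nonneg hr0, mul_comm] at h6
          exact h6.le
      have h7 := (Complex.re_le_norm _).trans
        (hr ⟨φ, S.le_topologicalClosure φ.2⟩)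
      have h8 : ‖(⟨φ, S.le_topologicalClosure φ.2⟩ : P)‖ = ‖(φ : D)‖ := rfl
      rw [h8, mul_comm] at h7
      exact absurd (h2.trans_le (h7.trans h5)) (lt_irrefl _)
  exact ⟨P, inferInstance, inferInstance, inferInstance,
    ⟨LinearIsometryEquiv.ofSurjective ⟨ι, hnorm⟩ hsurj⟩⟩

/-- The Dixmier–Ng theorem. -/
theorem IsPredualOn.exists_predual {V : Set (E →ₗ[ℂ] ℂ)}
    (hV : IsPredualOn (⊤ : Submodule ℂ E) V) :
    ∃ (P : Type w) (_ : NormedAddCommGroup P) (_ : NormedSpace ℂ P) (_ : CompleteSpace P),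
      Nonempty (E ≃ₗᵢ[ℂ] StrongDual ℂ P) :=
  hV.exists_predual_of_dual (LinearIsometryEquiv.refl ℂ (StrongDual ℂ E))

/-- Transfer along an isometry onto a subspace. -/
theorem IsPredualOn.exists_predual_of_isometry {A : Type*} [NormedAddCommGroup A]
    [NormedSpace ℂ A] {W : Submodule ℂ A} {V : Set (A →ₗ[ℂ] ℂ)} (hV : IsPredualOn W V)
    (j : E →ₗᵢ[ℂ] A) (hj : ∀ a, a ∈ W ↔ ∃ x, j x = a) :
    ∃ (P : Type w) (_ : NormedAddCommGroup P) (_ : NormedSpace ℂ P) (_ : CompleteSpace P),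
      Nonempty (E ≃ₗᵢ[ℂ] StrongDual ℂ P) := by
  have hjW : ∀ x, j x ∈ W := fun x => (hj _).mpr ⟨x, rfl⟩
  refine IsPredualOn.exists_predual (V := (fun φ : A →ₗ[ℂ] ℂ => φ ∘ₗ j.toLinearMap) '' V)
    (IsPredualOn.of_families ?_ ?_ ?_)
  · rintro _ ⟨φ, hφ, rfl⟩ x -
    exact (hV.norm_apply_le φ hφ _ (hjW x)).trans_eq (j.norm_map x)
  · intro x _ r hr h
    rw [← j.norm_map]
    exact hV.norming _ (hjW x) r hr fun φ hφ => h _ ⟨φ, hφ, rfl⟩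
  · intro 𝒰 f _ hf
    obtain ⟨w, hw, hlim⟩ := hV.exists_lim 𝒰 (fun i => hjW (f i))
      (fun i => (j.norm_map (f i)).trans_le (hf i))
    obtain ⟨x, rfl⟩ := (hj w).mp hw
    refine ⟨x, trivial, ?_⟩
    rintro _ ⟨φ, hφ, rfl⟩
    exact hlim φ hφ

theorem IsPredualOn.wStarAlgebra {B : Type*} [CStarAlgebra B] {V : Set (B →ₗ[ℂ] ℂ)}
    (hV : IsPredualOn (⊤ : Submodule ℂ B) V) : WStarAlgebra B := by
  obtain ⟨P, i1, i2, i3, ⟨Φ⟩⟩ := hV.exists_predual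
  -- The identification of a W*-algebra with a dual is conjugate-linear in `WStarAlgebra`; the
  -- involution adjusts for this.
  exact ⟨P, i1, i2, i3, ⟨Φ.symm.trans (starₗᵢ ℂ : B ≃ₗᵢ⋆[ℂ] B)⟩⟩

end Preduals

/-! ### Endomorphism algebras as C*-algebras -/

open StarCategory

namespace CStarCategory

variable {C : Type u} [Category.{v} C] [CStarCategory C]

lemma norm_le_norm_adj {X Y : C} (f : X ⟶ Y) : ‖f‖ ≤ ‖adj f‖ := by
  rcases (norm_nonneg f).eq_or_lt with h | h
  · rw [← h]
    exact norm_nonneg _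
  · have h1 := norm_comp_le f (adj f)
    rw [norm_comp_adj, pow_two] at h1
    exact le_of_mul_le_mul_right h1 h

lemma norm_adj {X Y : C} (f : X ⟶ Y) : ‖adj f‖ = ‖f‖ :=
  le_antisymm ((norm_le_norm_adj (adj f)).trans_eq (by rw [adj_adj])) (norm_le_norm_adj f)

lemma norm_adj_comp {X Y : C} (f : X ⟶ Y) : ‖adj f ≫ f‖ = ‖f‖ ^ 2 := by
  have h := norm_comp_adj (adj f)
  rwa [adj_adj, norm_adj] at h

lemma norm_id_le (X : C) : ‖𝟙 X‖ ≤ 1 := by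
  have h := norm_comp_adj (𝟙 X)
  rw [adj_id, Category.comp_id] at h
  nlinarith [norm_nonneg (𝟙 X)]

/-- The endomorphism algebra of `Z`, with the multiplication `a * b = a ≫ b`. -/
def EndOp (Z : C) : Type v := Z ⟶ Z

namespace EndOp

variable (Z : C)

noncomputable instance : NormedAddCommGroup (EndOp Z) :=
  inferInstanceAs (NormedAddCommGroup (Z ⟶ Z))

noncomputable instance : NormedSpace ℂ (EndOp Z) := inferInstanceAs (NormedSpace ℂ (Z ⟶ Z))

instance : CompleteSpace (EndOp Z) := inferInstanceAs (CompleteSpace (Z ⟶ Z))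

noncomputable instance : NormedRing (EndOp Z) :=
  { (inferInstance : NormedAddCommGroup (EndOp Z)) with
    mul := fun a b => CategoryStruct.comp (X := Z) (Y := Z) (Z := Z) a b
    one := 𝟙 Z
    mul_assoc := fun a b c => Category.assoc (W := Z) (X := Z) (Y := Z) (Z := Z) a b c
    one_mul := fun a => Category.id_comp (X := Z) (Y := Z) a
    mul_one := fun a => Category.comp_id (X := Z) (Y := Z) a
    left_distrib := fun a b c => Preadditive.comp_add Z Z Z a b c
    right_distrib := fun a b c => Preadditive.add_comp Z Z Z a b c
    zero_mul := fun a => Limits.zero_comp (X := Z) (Y := Z) (f := a)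
    mul_zero := fun a => Limits.comp_zero (X := Z) (Y := Z) (f := a)
    norm_mul_le := fun a b => (norm_comp_le (X := Z) (Y := Z) (Z := Z) a b).trans_eq
      (mul_comm _ _) }

instance : StarRing (EndOp Z) where
  star := fun a => adj (X := Z) (Y := Z) a
  star_involutive := fun a => adj_adj (X := Z) (Y := Z) a
  star_mul := fun a b => adj_comp (X := Z) (Y := Z) (Z := Z) a b
  star_add := fun a b => adj_add (X := Z) (Y := Z) a b

noncomputable instance : CStarAlgebra (EndOp Z) :=
  { (inferInstance : NormedRing (EndOp Z)), (inferInstance : StarRing (EndOp Z)),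
    (inferInstance : CompleteSpace (EndOp Z)), (inferInstance : NormedSpace ℂ (EndOp Z)),
    Algebra.ofModule (R := ℂ) (A := EndOp Z)
      (fun c a b => Linear.smul_comp Z Z Z c a b)
      (fun c a b => Linear.comp_smul Z Z Z a c b) with
    norm_mul_self_le := fun a => by
      exact ((norm_adj_comp (X := Z) (Y := Z) a).trans (pow_two _)).ge
    star_smul := fun c a => adj_smul (X := Z) (Y := Z) c a
    norm_smul_le := fun c a => norm_smul_le c a }

noncomputable instance : PartialOrder (EndOp Z) := CStarAlgebra.spectralOrder _

instance : StarOrderedRing (EndOp Z) := CStarAlgebra.spectralOrderedRing _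

variable {Z}

/-- Reading a morphism as an element of the algebra. -/
def of (f : Z ⟶ Z) : EndOp Z := f

/-- The positivity axiom enters here; it makes the inner products of columns positive. -/
lemma nonneg_of_comp_adj {X : C} (f : Z ⟶ X) : 0 ≤ of (f ≫ adj f) := by
  obtain ⟨g, hg⟩ := comp_adj_nonneg f
  rw [hg]
  exact mul_star_self_nonneg (of g)

end EndOp

end CStarCategory

/-! ### The matrix category and its norm -/

open StarCategory

/-- Finite families of objects of `C`. -/
structure FinFamily (C : Type u) : Type u where
  card : ℕ
  obj : Fin card → C

namespace FinFamily

section Algebraic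

variable {C : Type u} [Category.{v} C] [StarCategory C]

/-- The matrix category: morphisms `X ⟶ Y` are matrices of morphisms `X j ⟶ Y i`. -/
instance : Category.{v} (FinFamily C) where
  Hom X Y := ∀ (i : Fin Y.card) (j : Fin X.card), X.obj j ⟶ Y.obj i
  id X := (1 : MatAlg X.obj)
  comp f g := fun i k => ∑ j, f j k ≫ g i j
  id_comp {X Y} f := by
    funext i k
    rw [Finset.sum_eq_single k]
    · rw [MatAlg.one_apply_self, Category.id_comp]
    · intro j _ h
      rw [MatAlg.one_apply_ne h.symm, Limits.zero_comp]
    · simp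
  comp_id {X Y} f := by
    funext i k
    rw [Finset.sum_eq_single i]
    · rw [MatAlg.one_apply_self, Category.comp_id]
    · intro j _ h
      rw [MatAlg.one_apply_ne h, Limits.comp_zero]
    · simp
  assoc {W X Y Z} f g h := by
    funext i l
    simp only [Preadditive.comp_sum, Preadditive.sum_comp, Category.assoc]
    exact Finset.sum_comm

lemma comp_apply {X Y Z : FinFamily C} (f : X ⟶ Y) (g : Y ⟶ Z) (i k) :
    (f ≫ g) i k = ∑ j, f j k ≫ g i j := rfl

lemma hom_ext {X Y : FinFamily C} {f g : X ⟶ Y} (h : ∀ i j, f i j = g i j) : f = g :=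
  funext fun i => funext fun j => h i j

instance (X Y : FinFamily C) : AddCommGroup (X ⟶ Y) :=
  inferInstanceAs (AddCommGroup (∀ (i : Fin Y.card) (j : Fin X.card), X.obj j ⟶ Y.obj i))

instance (X Y : FinFamily C) : Module ℂ (X ⟶ Y) :=
  inferInstanceAs (Module ℂ (∀ (i : Fin Y.card) (j : Fin X.card), X.obj j ⟶ Y.obj i))

lemma add_apply {X Y : FinFamily C} (f g : X ⟶ Y) (i j) : (f + g) i j = f i j + g i j := rfl

lemma smul_apply {X Y : FinFamily C} (c : ℂ) (f : X ⟶ Y) (i j) : (c • f) i j = c • f i j := rfl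

lemma zero_apply {X Y : FinFamily C} (i j) : (0 : X ⟶ Y) i j = 0 := rfl

instance : StarCategory (FinFamily C) where
  homGroup := inferInstance
  add_comp X Y Z f g h := hom_ext fun i k => by
    simp [comp_apply, add_apply, Finset.sum_add_distrib]
  comp_add X Y Z f g h := hom_ext fun i k => by
    simp [comp_apply, add_apply, Finset.sum_add_distrib]
  homModule := inferInstance
  smul_comp X Y Z c f g := hom_ext fun i k => by
    simp [comp_apply, smul_apply, Finset.smul_sum]
  comp_smul X Y Z f c g := hom_ext fun i k => by
    simp [comp_apply, smul_apply, Finset.smul_sum]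
  adj f := fun i j => adj (f j i)
  adj_add f g := hom_ext fun i j => adj_add _ _
  adj_smul c f := hom_ext fun i j => adj_smul _ _
  adj_adj f := hom_ext fun i j => adj_adj _
  adj_comp f g := hom_ext fun i j => by simp [comp_apply, adj_sum, adj_comp]

lemma adj_apply {X Y : FinFamily C} (f : X ⟶ Y) (i j) : adj f i j = adj (f j i) := rfl

end Algebraic

variable {C : Type u} [Category.{v} C] [CStarCategory C]

open CStarCategory

/-- Columns of morphisms from `Z` to the members of the family `X`. -/
def Column (Z : C) (X : FinFamily C) : Type v := ∀ i : Fin X.card, Z ⟶ X.obj i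

namespace Column

variable {Z : C} {X Y : FinFamily C}

noncomputable instance : AddCommGroup (Column Z X) :=
  inferInstanceAs (AddCommGroup (∀ i : Fin X.card, Z ⟶ X.obj i))

noncomputable instance : Module ℂ (Column Z X) :=
  inferInstanceAs (Module ℂ (∀ i : Fin X.card, Z ⟶ X.obj i))

instance : SMul (EndOp Z) (Column Z X) :=
  ⟨fun a h i => CategoryStruct.comp (X := Z) (Y := Z) a (h i)⟩

noncomputable instance : Inner (EndOp Z) (Column Z X) :=
  ⟨fun h k => EndOp.of (∑ i, k i ≫ adj (h i))⟩

noncomputable instance : Norm (Column Z X) := CStarModule.norm (EndOp Z)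

lemma inner_self_eq (h : Column Z X) :
    inner (EndOp Z) h h = ∑ i, EndOp.of (h i ≫ adj (h i)) := rfl

lemma entry_le_inner_self (h : Column Z X) (i : Fin X.card) :
    EndOp.of (h i ≫ adj (h i)) ≤ inner (EndOp Z) h h := by
  rw [inner_self_eq]
  exact Finset.single_le_sum (f := fun i => EndOp.of (h i ≫ adj (h i)))
    (fun i _ => EndOp.nonneg_of_comp_adj (h i)) (Finset.mem_univ i)

lemma norm_of_comp_adj {W : C} (f : Z ⟶ W) : ‖EndOp.of (f ≫ adj f)‖ = ‖f‖ ^ 2 :=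
  norm_comp_adj f

/-- Definiteness holds because each `h i ≫ adj (h i)` is positive and dominated by their sum. The
diagrammatic multiplication of `EndOp` turns precomposition into a left action. -/
noncomputable instance : CStarModule (EndOp Z) (Column Z X) where
  inner_add_right {x y z} := by
    change (∑ i, (y i + z i) ≫ adj (x i) : Z ⟶ Z) =
      (∑ i, y i ≫ adj (x i)) + ∑ i, z i ≫ adj (x i)
    simp [Finset.sum_add_distrib]
  inner_self_nonneg {x} := by
    rw [inner_self_eq]
    exact Finset.sum_nonneg fun i _ => EndOp.nonneg_of_comp_adj (x i)
  inner_self {x} := by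
    constructor
    · intro h
      funext i
      have h1 := CStarAlgebra.norm_le_norm_of_nonneg_of_le
        (EndOp.nonneg_of_comp_adj (x i)) (entry_le_inner_self x i)
      rw [h, norm_zero, norm_of_comp_adj] at h1
      exact norm_eq_zero.mp (pow_eq_zero_iff two_ne_zero |>.mp (le_antisymm h1 (sq_nonneg _)))
    · rintro rfl
      change (∑ i, (0 : Z ⟶ X.obj i) ≫ adj (0 : Z ⟶ X.obj i) : Z ⟶ Z) = 0
      simp
  inner_op_smul_right {a x y} := by
    have key : ∀ b : Z ⟶ Z, ∑ i, (b ≫ y i) ≫ adj (x i) = b ≫ ∑ i, y i ≫ adj (x i) := fun b => by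
      simp [Preadditive.comp_sum]
    exact key a
  inner_smul_right_complex {z x y} := by
    change (∑ i, (z • y i) ≫ adj (x i) : Z ⟶ Z) = z • ∑ i, y i ≫ adj (x i)
    simp [Finset.smul_sum]
  star_inner x y := by
    change adj (∑ i, y i ≫ adj (x i) : Z ⟶ Z) = ∑ i, x i ≫ adj (y i)
    simp [adj_sum, adj_comp, adj_adj]
  norm_eq_sqrt_norm_inner_self x := rfl

noncomputable instance : NormedAddCommGroup (Column Z X) :=
  CStarModule.normedAddCommGroup (EndOp Z)

noncomputable instance : NormedSpace ℂ (Column Z X) :=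
  NormedSpace.ofCore (CStarModule.normedSpaceCore (EndOp Z))

lemma norm_sq (h : Column Z X) : ‖h‖ ^ 2 = ‖inner (EndOp Z) h h‖ :=
  CStarModule.norm_sq_eq (EndOp Z)

lemma norm_entry_le (h : Column Z X) (i : Fin X.card) : ‖h i‖ ≤ ‖h‖ := by
  refine le_of_sq_le_sq ?_ (norm_nonneg _)
  rw [norm_sq, ← norm_of_comp_adj]
  exact CStarAlgebra.norm_le_norm_of_nonneg_of_le
    (EndOp.nonneg_of_comp_adj (h i)) (entry_le_inner_self h i)

lemma norm_le_sum (h : Column Z X) : ‖h‖ ≤ ∑ i, ‖h i‖ := by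
  refine le_of_sq_le_sq ?_ (Finset.sum_nonneg fun _ _ => norm_nonneg _)
  rw [norm_sq, inner_self_eq]
  calc ‖∑ i, EndOp.of (h i ≫ adj (h i))‖ ≤ ∑ i, ‖h i‖ ^ 2 :=
        norm_sum_le_of_le _ fun i _ => (norm_of_comp_adj (h i)).le
    _ ≤ (∑ i, ‖h i‖) ^ 2 := Finset.sum_sq_le_sq_sum_of_nonneg fun _ _ => norm_nonneg _

/-- A matrix acting on columns. -/
def act (f : X ⟶ Y) (h : Column Z X) : Column Z Y := fun i => ∑ j, h j ≫ f i j

lemma act_comp {W : FinFamily C} (f : X ⟶ Y) (g : Y ⟶ W) (h : Column Z X) :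
    act (f ≫ g) h = act g (act f h) := by
  funext i
  simp only [act, comp_apply, Preadditive.comp_sum, Preadditive.sum_comp, Category.assoc]
  exact Finset.sum_comm

lemma act_add (f g : X ⟶ Y) (h : Column Z X) : act (f + g) h = act f h + act g h := by
  funext i
  change ∑ j, h j ≫ (f i j + g i j) = (∑ j, h j ≫ f i j) + ∑ j, h j ≫ g i j
  simp [Finset.sum_add_distrib]

lemma act_smul (c : ℂ) (f : X ⟶ Y) (h : Column Z X) : act (c • f) h = c • act f h := by
  funext i
  change ∑ j, h j ≫ (c • f i j) = c • ∑ j, h j ≫ f i j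
  simp [Finset.smul_sum]

lemma inner_act (f : X ⟶ Y) (h : Column Z X) (k : Column Z Y) :
    inner (EndOp Z) (act f h) k = inner (EndOp Z) h (act (adj f) k) := by
  change (∑ i, k i ≫ adj (∑ j, h j ≫ f i j) : Z ⟶ Z) =
    ∑ j, (∑ i, k i ≫ adj (f i j)) ≫ adj (h j)
  simp only [adj_sum, adj_comp, Preadditive.comp_sum, Preadditive.sum_comp, Category.assoc]
  exact Finset.sum_comm

/-- The column of the identity matrix at `j`. -/
def single (X : FinFamily C) (j : Fin X.card) : Column (X.obj j) X :=
  fun i => (1 : MatAlg X.obj) i j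

lemma act_single (f : X ⟶ Y) (j : Fin X.card) : act f (single X j) = fun i => f i j := by
  funext i
  exact congrFun (congrFun (Category.id_comp f) i) j

lemma norm_single_le (j : Fin X.card) : ‖single X j‖ ≤ 1 := by
  refine (norm_le_sum _).trans ?_
  rw [Finset.sum_eq_single j]
  · rw [single, MatAlg.one_apply_self]
    exact norm_id_le _
  · intro i _ hi
    rw [single, MatAlg.one_apply_ne hi.symm, norm_zero]
  · simp

lemma norm_act_le_sum (f : X ⟶ Y) (h : Column Z X) :
    ‖act f h‖ ≤ (∑ i, ∑ j, ‖f i j‖) * ‖h‖ := by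
  refine (norm_le_sum _).trans ?_
  rw [Finset.sum_mul]
  refine Finset.sum_le_sum fun i _ => ?_
  rw [Finset.sum_mul]
  refine norm_sum_le_of_le _ fun j _ => (norm_comp_le _ _).trans ?_
  exact mul_le_mul_of_nonneg_left (norm_entry_le h j) (norm_nonneg _)

end Column

open Column

variable {X Y W : FinFamily C}

/-- The operator norm of the action on columns. -/
noncomputable instance homNorm (X Y : FinFamily C) : Norm (X ⟶ Y) :=
  ⟨fun f => sInf {r | 0 ≤ r ∧ ∀ (Z : C) (h : Column Z X), ‖act f h‖ ≤ r * ‖h‖}⟩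

lemma norm_le_of_act {f : X ⟶ Y} {r : ℝ} (hr : 0 ≤ r)
    (h : ∀ (Z : C) (h : Column Z X), ‖act f h‖ ≤ r * ‖h‖) : ‖f‖ ≤ r :=
  csInf_le ⟨0, fun _ h => h.1⟩ ⟨hr, h⟩

lemma bounds_nonempty (f : X ⟶ Y) :
    {r | 0 ≤ r ∧ ∀ (Z : C) (h : Column Z X), ‖act f h‖ ≤ r * ‖h‖}.Nonempty :=
  ⟨∑ i, ∑ j, ‖f i j‖, Finset.sum_nonneg fun _ _ => Finset.sum_nonneg fun _ _ => norm_nonneg _,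
    fun _ h => norm_act_le_sum f h⟩

lemma hom_norm_nonneg (f : X ⟶ Y) : 0 ≤ ‖f‖ :=
  le_csInf (bounds_nonempty f) fun _ h => h.1

lemma norm_act_le (f : X ⟶ Y) {Z : C} (h : Column Z X) : ‖act f h‖ ≤ ‖f‖ * ‖h‖ := by
  rcases (norm_nonneg h).eq_or_lt with h0 | h0
  · obtain ⟨r, -, hr⟩ := bounds_nonempty f
    have := hr Z h
    rwa [← h0, mul_zero] at this ⊢
  · rw [← div_le_iff₀ h0]
    refine le_csInf (bounds_nonempty f) fun r hr => ?_
    rw [div_le_iff₀ h0]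
    exact hr.2 Z h

lemma norm_le_sum_entries (f : X ⟶ Y) : ‖f‖ ≤ ∑ i, ∑ j, ‖f i j‖ :=
  norm_le_of_act (Finset.sum_nonneg fun _ _ => Finset.sum_nonneg fun _ _ => norm_nonneg _)
    fun _ h => norm_act_le_sum f h

/-- An entry is read off by acting on a column of the identity matrix, which has norm at most one.
-/
lemma norm_entry_le (f : X ⟶ Y) (i : Fin Y.card) (j : Fin X.card) : ‖f i j‖ ≤ ‖f‖ := by
  have h1 := Column.norm_entry_le (act f (single X j)) i
  rw [congrFun (act_single f j) i] at h1
  exact (h1.trans (norm_act_le f _)).trans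
    (mul_le_of_le_one_right (hom_norm_nonneg f) (norm_single_le j))

lemma hom_norm_comp_le (f : X ⟶ Y) (g : Y ⟶ W) : ‖f ≫ g‖ ≤ ‖g‖ * ‖f‖ :=
  norm_le_of_act (mul_nonneg (hom_norm_nonneg _) (hom_norm_nonneg _)) fun Z h => by
    rw [act_comp, mul_assoc]
    exact (norm_act_le g _).trans
      (mul_le_mul_of_nonneg_left (norm_act_le f h) (hom_norm_nonneg g))

lemma hom_norm_core (X Y : FinFamily C) : NormedSpace.Core ℂ (X ⟶ Y) where
  norm_nonneg := hom_norm_nonneg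
  norm_smul c f := by
    have key : ∀ (c : ℂ) (f : X ⟶ Y), ‖c • f‖ ≤ ‖c‖ * ‖f‖ := fun c f =>
      norm_le_of_act (mul_nonneg (norm_nonneg _) (hom_norm_nonneg _)) fun Z h => by
        rw [act_smul, norm_smul, mul_assoc]
        exact mul_le_mul_of_nonneg_left (norm_act_le f h) (norm_nonneg c)
    refine le_antisymm (key c f) ?_
    rcases eq_or_ne c 0 with rfl | hc
    · rw [norm_zero, zero_mul]
      exact hom_norm_nonneg _
    · have h := key c⁻¹ (c • f)
      rwa [inv_smul_smul₀ hc, norm_inv, ← div_eq_inv_mul, le_div_iff₀' (norm_pos_iff.mpr hc)] at h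
  norm_triangle f g := norm_le_of_act (add_nonneg (hom_norm_nonneg _) (hom_norm_nonneg _))
    fun Z h => by
      rw [act_add, add_mul]
      exact (norm_add_le _ _).trans (add_le_add (norm_act_le f h) (norm_act_le g h))
  norm_eq_zero_iff f := by
    constructor
    · intro h
      refine hom_ext fun i j => norm_le_zero_iff.mp ?_
      exact (norm_entry_le f i j).trans_eq h
    · rintro rfl
      refine le_antisymm ((norm_le_sum_entries _).trans_eq ?_) (hom_norm_nonneg _)
      simp [zero_apply]

/-- The norm lies between each entry norm and the sum of all entry norms, so convergence is
entrywise. -/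
lemma hom_complete (X Y : FinFamily C) :
    @CompleteSpace (X ⟶ Y) (NormedAddCommGroup.ofCore (hom_norm_core X Y)).toUniformSpace := by
  let := NormedAddCommGroup.ofCore (hom_norm_core X Y)
  refine Metric.complete_of_cauchySeq_tendsto fun s hs => ?_
  have h1 : ∀ i j, ∃ a, Tendsto (fun n => s n i j) atTop (𝓝 a) := fun i j => by
    refine cauchySeq_tendsto_of_complete ?_
    rw [Metric.cauchySeq_iff'] at hs ⊢
    intro ε hε
    obtain ⟨N, hN⟩ := hs ε hε
    refine ⟨N, fun n hn => ?_⟩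
    rw [dist_eq_norm]
    refine (norm_entry_le (s n - s N) i j).trans_lt ?_
    have := hN n hn
    rwa [dist_eq_norm] at this
  choose a ha using h1
  refine ⟨a, tendsto_iff_norm_sub_tendsto_zero.mpr ?_⟩
  refine squeeze_zero (fun _ => norm_nonneg _) (fun n => norm_le_sum_entries (s n - a)) ?_
  have h2 : Tendsto (fun n => ∑ i, ∑ j, ‖s n i j - a i j‖) atTop
      (𝓝 (∑ _i : Fin Y.card, ∑ _j : Fin X.card, (0 : ℝ))) :=
    tendsto_finsetSum _ fun i _ => tendsto_finsetSum _ fun j _ =>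
      tendsto_iff_norm_sub_tendsto_zero.mp (ha i j)
  rw [Finset.sum_const_zero, Finset.sum_const_zero] at h2
  exact h2

/-- Cauchy–Schwarz in the column module, applied to `⟨f h, f h⟩ = ⟨h, f* f h⟩`. -/
lemma norm_act_sq (f : X ⟶ Y) {Z : C} (h : Column Z X) :
    ‖act f h‖ ^ 2 ≤ ‖f ≫ adj f‖ * ‖h‖ ^ 2 := by
  rw [norm_sq, inner_act, ← act_comp]
  refine (CStarModule.norm_inner_le (Column Z X)).trans ?_
  calc ‖h‖ * ‖act (f ≫ adj f) h‖ ≤ ‖h‖ * (‖f ≫ adj f‖ * ‖h‖) :=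
        mul_le_mul_of_nonneg_left (norm_act_le _ _) (norm_nonneg _)
    _ = _ := by ring

lemma hom_norm_sq_le (f : X ⟶ Y) : ‖f‖ ^ 2 ≤ ‖f ≫ adj f‖ := by
  have h : ‖f‖ ≤ √‖f ≫ adj f‖ := norm_le_of_act (Real.sqrt_nonneg _) fun Z h => by
    refine le_of_sq_le_sq ?_ (mul_nonneg (Real.sqrt_nonneg _) (norm_nonneg _))
    rw [mul_pow, Real.sq_sqrt (hom_norm_nonneg _)]
    exact norm_act_sq f h
  calc ‖f‖ ^ 2 ≤ √‖f ≫ adj f‖ ^ 2 := pow_le_pow_left₀ (hom_norm_nonneg _) h 2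
    _ = _ := Real.sq_sqrt (hom_norm_nonneg _)

lemma hom_norm_comp_adj (f : X ⟶ Y) : ‖f ≫ adj f‖ = ‖f‖ ^ 2 := by
  have key : ∀ {X Y : FinFamily C} (f : X ⟶ Y), ‖f‖ ≤ ‖adj f‖ := fun f => by
    rcases (hom_norm_nonneg f).eq_or_lt with h | h
    · rw [← h]
      exact hom_norm_nonneg _
    · have h1 := (hom_norm_sq_le f).trans (hom_norm_comp_le f (adj f))
      rw [pow_two] at h1
      exact le_of_mul_le_mul_right h1 h
  refine le_antisymm ?_ (hom_norm_sq_le f)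
  refine (hom_norm_comp_le f (adj f)).trans ?_
  rw [pow_two]
  refine mul_le_mul_of_nonneg_right ?_ (hom_norm_nonneg _)
  exact (key (adj f)).trans_eq (by rw [adj_adj])

end FinFamily

/-! ### Matrix algebras and positivity -/

open StarCategory

namespace FinFamily

variable {C : Type u} [Category.{v} C] [CStarCategory C]

/-- Reading a matrix as an endomorphism in the matrix category. -/
def toHom {X : FinFamily C} (a : MatAlg X.obj) : X ⟶ X := a

lemma toHom_mul {X : FinFamily C} (a b : MatAlg X.obj) : toHom (a * b) = toHom b ≫ toHom a := rfl

lemma toHom_star {X : FinFamily C} (a : MatAlg X.obj) : toHom (star a) = adj (toHom a) := rfl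

/-- The C*-norm of a matrix algebra. -/
noncomputable abbrev matNorm (X : FinFamily C) : Norm (MatAlg X.obj) := homNorm X X

lemma matNorm_core (X : FinFamily C) :
    letI := matNorm X
    NormedSpace.Core ℂ (MatAlg X.obj) := hom_norm_core X X

lemma mat_complete (X : FinFamily C) :
    letI := matNorm X
    @CompleteSpace (MatAlg X.obj) (NormedAddCommGroup.ofCore (matNorm_core X)).toUniformSpace :=
  hom_complete X X

/-- Matrix algebras are C*-algebras. -/
noncomputable abbrev matCStarAlgebra (X : FinFamily C) : CStarAlgebra (MatAlg X.obj) :=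
  letI := matNorm X
  { (inferInstance : Ring (MatAlg X.obj)), (inferInstance : StarRing (MatAlg X.obj)),
    (inferInstance : Algebra ℂ (MatAlg X.obj)),
    NormedAddCommGroup.ofCore (matNorm_core X) with
    dist_eq := (NormedAddCommGroup.ofCore (matNorm_core X)).dist_eq
    norm_mul_le := fun a b => hom_norm_comp_le (toHom b) (toHom a)
    complete := (mat_complete X).complete
    norm_mul_self_le := fun a =>
      ((hom_norm_comp_adj (toHom a)).trans (pow_two _)).ge
    star_smul := fun c a => star_smul c a
    norm_smul_le := fun c a => ((matNorm_core X).norm_smul c a).le }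

lemma act_neg {X Y : FinFamily C} (f : X ⟶ Y) {Z : C} (h : Column Z X) :
    Column.act (-f) h = -Column.act f h := by
  rw [← neg_one_smul ℂ f, Column.act_smul, neg_one_smul]

/-- On every column `c` the positive element `⟨b c, b c⟩` equals `-⟨k c, k c⟩`, so it vanishes; and
a matrix is determined by its action on columns. -/
lemma eq_zero_of_comp_adj_eq_neg {X Y W : FinFamily C} {k : X ⟶ Y} {b : X ⟶ W}
    (h : k ≫ adj k = -(b ≫ adj b)) : b = 0 := by
  have hb : ∀ (Z : C) (c : Column Z X), Column.act b c = 0 := fun Z c => by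
    rw [← CStarModule.inner_self (A := CStarCategory.EndOp Z)]
    refine le_antisymm ?_ CStarModule.inner_self_nonneg
    have h1 : inner (CStarCategory.EndOp Z) (Column.act b c) (Column.act b c) =
        - inner (CStarCategory.EndOp Z) (Column.act k c) (Column.act k c) := by
      rw [Column.inner_act, Column.inner_act, ← Column.act_comp, ← Column.act_comp, h, act_neg]
      have h2 := CStarModule.inner_neg_right (A := CStarCategory.EndOp Z) (E := Column Z X)
        (x := c) (y := Column.act (b ≫ adj b) c)
      exact (neg_eq_iff_eq_neg.mpr h2).symm
    rw [h1]
    exact neg_nonpos.mpr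
      (CStarModule.inner_self_nonneg (A := CStarCategory.EndOp Z) (E := Column Z Y))
  refine ((hom_norm_core X W).norm_eq_zero_iff b).mp (le_antisymm ?_ (hom_norm_nonneg b))
  exact norm_le_of_act le_rfl fun Z c => by rw [hb, norm_zero, zero_mul]

/-- The negative part of `s = f* f` satisfies `(f s⁻)* (f s⁻) = s⁻ s s⁻ = -(s⁻)³`. Writing `s⁻ = t*
t` makes the right side `-(t s⁻)* (t s⁻)`, so `t s⁻ = 0` by the previous lemma. Then `s⁻ = 0`, and
`s` is positive in the matrix C*-algebra. -/
lemma exists_comp_adj_eq {X Y : FinFamily C} (f : X ⟶ Y) :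
    ∃ g : X ⟶ X, f ≫ adj f = g ≫ adj g := by
  let := matCStarAlgebra X
  let : PartialOrder (MatAlg X.obj) := CStarAlgebra.spectralOrder _
  have : StarOrderedRing (MatAlg X.obj) := CStarAlgebra.spectralOrderedRing _
  obtain ⟨s, hsf⟩ : ∃ s : MatAlg X.obj, toHom s = f ≫ adj f := ⟨f ≫ adj f, rfl⟩
  have hs : IsSelfAdjoint s := by
    change toHom (star s) = toHom s
    rw [toHom_star, hsf, adj_comp, adj_adj]
  obtain ⟨t, ht⟩ := CStarAlgebra.nonneg_iff_eq_star_mul_self.mp (CFC.negPart_nonneg s)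
  have hm : s * s⁻ = - (s⁻ * s⁻) := by
    nth_rewrite 1 [← CFC.posPart_sub_negPart s hs]
    rw [sub_mul, CFC.posPart_mul_negPart, zero_sub]
  have hsa : star s⁻ = s⁻ := (CFC.negPart_nonneg s).isSelfAdjoint
  have hk : (toHom s⁻ ≫ f) ≫ adj (toHom s⁻ ≫ f) =
      -(toHom (t * s⁻) ≫ adj (toHom (t * s⁻))) := by
    have h1 : star (t * s⁻) * (t * s⁻) = -(s⁻ * (s * s⁻)) := by
      rw [hm, star_mul, hsa, mul_assoc, ← mul_assoc (star t), ← ht, mul_neg, neg_neg]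
    have h2 : (toHom s⁻ ≫ f) ≫ adj (toHom s⁻ ≫ f) = toHom (s⁻ * (s * s⁻)) := by
      rw [toHom_mul, toHom_mul, hsf, adj_comp, ← toHom_star, hsa]
      simp only [Category.assoc]
    rw [h2, ← toHom_star, ← toHom_mul, h1]
    exact (neg_neg _).symm
  have h0 : t * s⁻ = 0 := eq_zero_of_comp_adj_eq_neg hk
  have h1 : s⁻ = 0 := by
    rw [← CStarRing.star_mul_self_eq_zero_iff, hsa]
    nth_rewrite 1 [ht]
    rw [mul_assoc, h0, mul_zero]
  have h2 : 0 ≤ s := by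
    rw [← CFC.posPart_sub_negPart s hs, h1, sub_zero]
    exact CFC.posPart_nonneg s
  obtain ⟨g, hg⟩ := CStarAlgebra.nonneg_iff_eq_star_mul_self.mp h2
  refine ⟨toHom g, ?_⟩
  rw [← hsf, hg, toHom_mul, toHom_star]

noncomputable instance : CStarCategory (FinFamily C) where
  homNorm := homNorm
  core := hom_norm_core
  complete := hom_complete
  norm_comp_le := hom_norm_comp_le
  norm_comp_adj := hom_norm_comp_adj
  comp_adj_nonneg := exists_comp_adj_eq

end FinFamily

/-! ### Hom-spaces as corners of endomorphism algebras -/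

open StarCategory

namespace CStarCategory

variable {D : Type u} [Category.{v} D] [CStarCategory D]

lemma norm_le_one_of_isometry {X S : D} {s : X ⟶ S} (hs : s ≫ adj s = 𝟙 X) : ‖s‖ ≤ 1 := by
  have h := norm_comp_adj s
  rw [hs] at h
  have := norm_id_le X
  nlinarith [norm_nonneg s]

lemma norm_comp_comp_le {X Y S T : D} {s : X ⟶ S} {t : T ⟶ Y} (hs : ‖s‖ ≤ 1) (ht : ‖t‖ ≤ 1)
    (f : S ⟶ T) : ‖s ≫ f ≫ t‖ ≤ ‖f‖ := by
  refine (norm_comp_le _ _).trans ?_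
  refine (mul_le_of_le_one_right (norm_nonneg _) hs).trans ?_
  exact (norm_comp_le _ _).trans (mul_le_of_le_one_left (norm_nonneg _) ht)

lemma norm_sandwich_le {X Y S T : D} {s : X ⟶ S} {t : Y ⟶ T} (hs : s ≫ adj s = 𝟙 X)
    (ht : t ≫ adj t = 𝟙 Y) (f : S ⟶ T) : ‖s ≫ f ≫ adj t‖ ≤ ‖f‖ :=
  norm_comp_comp_le (norm_le_one_of_isometry hs)
    ((norm_adj t).trans_le (norm_le_one_of_isometry ht)) f

lemma norm_conj_le {X Y S T : D} {s : X ⟶ S} {t : Y ⟶ T} (hs : s ≫ adj s = 𝟙 X)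
    (ht : t ≫ adj t = 𝟙 Y) (f : X ⟶ Y) : ‖adj s ≫ f ≫ t‖ ≤ ‖f‖ :=
  norm_comp_comp_le ((norm_adj s).trans_le (norm_le_one_of_isometry hs))
    (norm_le_one_of_isometry ht) f

lemma sandwich_conj {X Y S T : D} {s : X ⟶ S} {t : Y ⟶ T} (hs : s ≫ adj s = 𝟙 X)
    (ht : t ≫ adj t = 𝟙 Y) (f : X ⟶ Y) : s ≫ (adj s ≫ f ≫ t) ≫ adj t = f := by
  simp only [Category.assoc, ht, Category.comp_id]
  rw [← Category.assoc, hs, Category.id_comp]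

lemma norm_conj {X Y S T : D} {s : X ⟶ S} {t : Y ⟶ T} (hs : s ≫ adj s = 𝟙 X)
    (ht : t ≫ adj t = 𝟙 Y) (f : X ⟶ Y) : ‖adj s ≫ f ≫ t‖ = ‖f‖ := by
  refine le_antisymm (norm_conj_le hs ht f) ?_
  have h := norm_sandwich_le hs ht (adj s ≫ f ≫ t)
  rwa [sandwich_conj hs ht] at h

namespace EndOp

/-- The range projection of a morphism into `S`. -/
def range {X S : D} (s : X ⟶ S) : EndOp S := of (adj s ≫ s)

/-- Reading an element of the algebra as a morphism. -/
def toHom {S : D} (x : EndOp S) : S ⟶ S := x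

lemma isStarProjection_range {X S : D} {s : X ⟶ S} (hs : s ≫ adj s = 𝟙 X) :
    IsStarProjection (range s) where
  isIdempotentElem := by
    change (adj s ≫ s) ≫ adj s ≫ s = adj s ≫ s
    rw [Category.assoc, ← Category.assoc s, hs, Category.id_comp]
  isSelfAdjoint := by
    change adj (adj s ≫ s) = adj s ≫ s
    rw [adj_comp, adj_adj]

/-- Since products in `EndOp` are diagrammatic, this corner is the copy of `X ⟶ Y` obtained by
projecting onto `X` and including from `Y`. -/
lemma mem_corner_range {X Y S : D} {s : X ⟶ S} {t : Y ⟶ S} (hs : s ≫ adj s = 𝟙 X)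
    (ht : t ≫ adj t = 𝟙 Y) (x : EndOp S) :
    x ∈ corner (range s) (range t) ↔
      adj s ≫ (s ≫ toHom x ≫ adj t) ≫ t = toHom x := by
  rw [mem_corner]
  change (adj s ≫ s) ≫ toHom x = toHom x ∧ toHom x ≫ (adj t ≫ t) = toHom x ↔ _
  constructor
  · rintro ⟨h1, h2⟩
    simp only [Category.assoc] at h1 ⊢
    rw [h2, h1]
  · intro h
    rw [← h]
    constructor
    · simp only [Category.assoc]
      rw [← Category.assoc s (adj s), hs, Category.id_comp]
    · simp only [Category.assoc]
      rw [← Category.assoc t (adj t), ht, Category.id_comp]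

end EndOp

/-- A morphism space with a predual. -/
def HasPredual (X Y : D) : Prop :=
  ∃ (P : Type v) (_ : NormedAddCommGroup P) (_ : NormedSpace ℂ P) (_ : CompleteSpace P),
    Nonempty ((X ⟶ Y) ≃ₗᵢ[ℂ] StrongDual ℂ P)

/-- The endomorphism algebra of a direct sum of objects with dual hom-spaces. -/
theorem exists_isPredualOn_endOp {n : ℕ} {X : Fin n → D} {S : D} {s : ∀ i, X i ⟶ S}
    (hs : IsDirectSum X S s) (h : ∀ i j, HasPredual (X i) (X j)) :
    ∃ V, IsPredualOn (⊤ : Submodule ℂ (EndOp S)) V := by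
  refine exists_isPredualOn_of_corners (fun i => EndOp.range (s i))
    (fun i => EndOp.isStarProjection_range (hs.isometry i)) ?_ hs.total fun i j => ?_
  · intro i j hij
    change (adj (s i) ≫ s i) ≫ adj (s j) ≫ s j = 0
    rw [Category.assoc, ← Category.assoc (s i), hs.orthogonal i j hij, Limits.zero_comp,
      Limits.comp_zero]
  · obtain ⟨P, _, _, _, ⟨Φ⟩⟩ := h i j
    refine exists_isPredualOn_of_predual (k := 
      { toFun := fun x => s i ≫ EndOp.toHom x ≫ adj (s j)
        map_add' := fun x y => ?_
        map_smul' := fun c x => ?_ }) ?_ ?_ Φ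
    · change s i ≫ (EndOp.toHom x + EndOp.toHom y) ≫ adj (s j) = _
      rw [Preadditive.add_comp, Preadditive.comp_add]
    · change s i ≫ (c • EndOp.toHom x) ≫ adj (s j) = c • _
      rw [Linear.smul_comp, Linear.comp_smul]
    · intro x hx
      rw [EndOp.mem_corner_range (hs.isometry i) (hs.isometry j)] at hx
      change ‖s i ≫ EndOp.toHom x ≫ adj (s j)‖ = ‖EndOp.toHom x‖
      rw [← norm_conj (hs.isometry i) (hs.isometry j), hx]
    · intro f
      refine ⟨EndOp.of (adj (s i) ≫ f ≫ s j), ?_, sandwich_conj (hs.isometry i) (hs.isometry j) f⟩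
      rw [EndOp.mem_corner_range (hs.isometry i) (hs.isometry j)]
      change adj (s i) ≫ (s i ≫ (adj (s i) ≫ f ≫ s j) ≫ adj (s j)) ≫ s j = _
      rw [sandwich_conj (hs.isometry i) (hs.isometry j)]
      rfl

/-- Hom-spaces between summands are dual. -/
theorem hasPredual_of_endOp {X Y S : D} {V : Set (EndOp S →ₗ[ℂ] ℂ)}
    (hV : IsPredualOn (⊤ : Submodule ℂ (EndOp S)) V) {s : X ⟶ S} {t : Y ⟶ S}
    (hs : s ≫ adj s = 𝟙 X) (ht : t ≫ adj t = 𝟙 Y) : HasPredual X Y := by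
  refine (hV.corner_of_top (EndOp.range s) (EndOp.range t)).exists_predual_of_isometry
    (E := (X ⟶ Y))
    { toFun := fun f => EndOp.of (adj s ≫ f ≫ t)
      map_add' := fun f g => ?_
      map_smul' := fun c f => ?_
      norm_map' := fun f => norm_conj hs ht f } ?_
  · rw [Preadditive.add_comp, Preadditive.comp_add]
    rfl
  · rw [Linear.smul_comp, Linear.comp_smul]
    rfl
  · intro x
    rw [EndOp.mem_corner_range hs ht]
    constructor
    · intro h
      exact ⟨_, h⟩
    · rintro ⟨f, rfl⟩
      change adj s ≫ (s ≫ (adj s ≫ f ≫ t) ≫ adj t) ≫ t = adj s ≫ f ≫ t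
      rw [sandwich_conj hs ht]

end CStarCategory

/-! ### The embedding and direct sums by concatenation -/

open StarCategory

namespace FinFamily

section Algebraic

variable {C : Type u} [Category.{v} C] [StarCategory C]

lemma sum_apply {ι : Type*} (s : Finset ι) {X Y : FinFamily C} (f : ι → (X ⟶ Y)) (a b) :
    (∑ i ∈ s, f i) a b = ∑ i ∈ s, f i a b := by
  induction s using Finset.cons_induction with
  | empty => rfl
  | cons i s his ih =>
    rw [Finset.sum_cons, Finset.sum_cons, ← ih]
    rfl

section One

variable {ι : Type*} [Fintype ι] [DecidableEq ι] (X : ι → C)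

/-- The identity `1* 1 = 1` read entrywise; columns of the identity matrix are the inclusions, so
this and its companion yield the direct-sum relations. -/
lemma sum_one_comp_adj_one (i j : ι) :
    ∑ k, (1 : MatAlg X) k j ≫ adj ((1 : MatAlg X) k i) = (1 : MatAlg X) i j := by
  have h : (star (1 : MatAlg X) * 1) i j = (1 : MatAlg X) i j := by rw [star_one, mul_one]
  exact h

lemma sum_adj_one_comp_one (i j : ι) :
    ∑ k, adj ((1 : MatAlg X) j k) ≫ (1 : MatAlg X) i k = (1 : MatAlg X) i j := by
  have h : ((1 : MatAlg X) * star 1) i j = (1 : MatAlg X) i j := by rw [star_one, mul_one]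
  exact h

end One

lemma id_apply_self (X : FinFamily C) (i) : 𝟙 X i i = 𝟙 (X.obj i) := MatAlg.one_apply_self i

lemma id_apply_ne (X : FinFamily C) {i j} (h : j ≠ i) : 𝟙 X i j = 0 := MatAlg.one_apply_ne h

variable (C) in
/-- Objects as families with one member. -/
def embedding : C ⥤ FinFamily C where
  obj Z := ⟨1, fun _ => Z⟩
  map f := fun _ _ => f
  map_id Z := hom_ext fun i j => by
    obtain rfl : i = j := Subsingleton.elim (α := Fin 1) i j
    exact (id_apply_self _ i).symm
  map_comp {X Y Z} f g := hom_ext fun i j =>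
    (Fin.sum_univ_one fun _ : Fin 1 => f ≫ g).symm

instance (Z : C) : Unique (Fin ((embedding C).obj Z).card) := inferInstanceAs (Unique (Fin 1))

/-- The single entry of a morphism between images of the embedding. -/
def entry {X Y : C} (f : (embedding C).obj X ⟶ (embedding C).obj Y) : X ⟶ Y := f default default

lemma embedding_map_entry {X Y : C} (f : (embedding C).obj X ⟶ (embedding C).obj Y) :
    (embedding C).map (entry f) = f := hom_ext fun i j => by
  obtain rfl := Subsingleton.elim i default
  obtain rfl := Subsingleton.elim j default
  rfl

lemma isStarFunctor_embedding : IsStarFunctor (embedding C) where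
  map_add _ _ := rfl
  map_smul _ _ := rfl
  map_adj _ := rfl

instance : (embedding C).Faithful where
  map_injective h := congrArg entry h

instance : (embedding C).Full where
  map_surjective f := ⟨entry f, embedding_map_entry f⟩

/-- The inclusion of a member of a family. -/
def incl (X : FinFamily C) (i : Fin X.card) : (embedding C).obj (X.obj i) ⟶ X :=
  fun k _ => (1 : MatAlg X.obj) k i

lemma isDirectSum_incl (X : FinFamily C) :
    IsDirectSum (fun i => (embedding C).obj (X.obj i)) X (incl X) where
  isometry i := hom_ext fun a b => by
    obtain rfl := Subsingleton.elim a b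
    rw [id_apply_self]
    exact (sum_one_comp_adj_one X.obj i i).trans (MatAlg.one_apply_self i)
  orthogonal i j hij := hom_ext fun a b =>
    (sum_one_comp_adj_one X.obj j i).trans (MatAlg.one_apply_ne hij)
  total := hom_ext fun a b => by
    rw [sum_apply]
    refine (Finset.sum_congr rfl fun i _ => ?_).trans (sum_adj_one_comp_one X.obj a b)
    exact Fin.sum_univ_one _

section Sum

variable {n : ℕ} (X : Fin n → FinFamily C)

/-- The members of all members of `X`. -/
def members (p : Σ i, Fin (X i).card) : C := (X p.1).obj p.2

/-- The concatenation of a family of families. -/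
def sum : FinFamily C :=
  ⟨∑ i, (X i).card, fun k => members X (finSigmaFinEquiv.symm k)⟩

/-- Positions in the concatenation. -/
def position : Fin (sum X).card ≃ Σ i, Fin (X i).card := finSigmaFinEquiv.symm

/-- The inclusion of a family in the concatenation. -/
def sumIncl (i : Fin n) : X i ⟶ sum X :=
  fun k j => (1 : MatAlg (members X)) (position X k) ⟨i, j⟩

lemma sumIncl_comp_adj (i i' : Fin n) (j' : Fin (X i').card) (j : Fin (X i).card) :
    (sumIncl X i ≫ adj (sumIncl X i')) j' j = (1 : MatAlg (members X)) ⟨i', j'⟩ ⟨i, j⟩ := by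
  rw [← sum_one_comp_adj_one]
  exact Equiv.sum_comp (position X) fun p =>
    (1 : MatAlg (members X)) p ⟨i, j⟩ ≫ adj ((1 : MatAlg (members X)) p ⟨i', j'⟩)

lemma isDirectSum_sumIncl : IsDirectSum X (sum X) (sumIncl X) where
  isometry i := hom_ext fun j' j => by
    rw [sumIncl_comp_adj]
    rcases eq_or_ne j j' with rfl | h
    · rw [id_apply_self]
      exact MatAlg.one_apply_self _
    · rw [id_apply_ne _ h]
      exact MatAlg.one_apply_ne (by simpa using h)
  orthogonal i i' hii := hom_ext fun j' j => by
    rw [sumIncl_comp_adj]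
    exact MatAlg.one_apply_ne fun h => hii (congrArg Sigma.fst h)
  total := hom_ext fun k' k => by
    rw [sum_apply]
    have h : ∑ i, (adj (sumIncl X i) ≫ sumIncl X i) k' k =
        (1 : MatAlg (members X)) (position X k') (position X k) := by
      rw [← sum_adj_one_comp_one, Fintype.sum_sigma]
      rfl
    rw [h]
    rcases eq_or_ne k k' with rfl | h
    · rw [id_apply_self]
      exact MatAlg.one_apply_self _
    · rw [id_apply_ne _ h]
      exact MatAlg.one_apply_ne ((position X).injective.ne h)

end Sum

lemma hasFiniteDirectSums : HasFiniteDirectSums (FinFamily C) :=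
  fun _ X => ⟨sum X, sumIncl X, isDirectSum_sumIncl X⟩

lemma isDirectSumExtension_embedding : IsDirectSumExtension (embedding C) where
  isStarFunctor := isStarFunctor_embedding
  full := inferInstance
  faithful := inferInstance
  hasFiniteDirectSums := hasFiniteDirectSums
  generated X := ⟨X.card, X.obj, incl X, isDirectSum_incl X⟩

end Algebraic

variable {C : Type u} [Category.{v} C] [CStarCategory C]

lemma norm_embedding_map {X Y : C} (f : X ⟶ Y) : ‖(embedding C).map f‖ = ‖f‖ := by
  refine le_antisymm ((norm_le_sum_entries _).trans_eq ?_)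
    (norm_entry_le ((embedding C).map f) default default)
  exact (Fin.sum_univ_one _).trans (Fin.sum_univ_one _)

/-- The isometry of hom-spaces given by the embedding. -/
noncomputable def embeddingIsometry (X Y : C) :
    ((embedding C).obj X ⟶ (embedding C).obj Y) ≃ₗᵢ[ℂ] (X ⟶ Y) :=
  LinearIsometryEquiv.symm
    { toFun := (embedding C).map
      invFun := entry
      map_add' := fun _ _ => rfl
      map_smul' := fun _ _ => rfl
      left_inv := fun _ => rfl
      right_inv := embedding_map_entry
      norm_map' := norm_embedding_map }

open CStarCategory

lemma hasPredual_embedding_iff (X Y : C) :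
    HasPredual ((embedding C).obj X) ((embedding C).obj Y) ↔ HasPredual X Y := by
  constructor
  · rintro ⟨P, i1, i2, i3, ⟨Φ⟩⟩
    exact ⟨P, i1, i2, i3, ⟨(embeddingIsometry X Y).symm.trans Φ⟩⟩
  · rintro ⟨P, i1, i2, i3, ⟨Φ⟩⟩
    exact ⟨P, i1, i2, i3, ⟨(embeddingIsometry X Y).trans Φ⟩⟩

lemma exists_isPredualOn_endOp [IsWStarCategory C] (X : FinFamily C) :
    ∃ V, IsPredualOn (⊤ : Submodule ℂ (EndOp X)) V :=
  CStarCategory.exists_isPredualOn_endOp (isDirectSum_incl X) fun _ _ =>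
    (hasPredual_embedding_iff _ _).mpr (IsWStarCategory.exists_predual _ _)

/-- A hom-space is a corner of the endomorphism algebra of the concatenation, which is itself a
direct sum of objects of `C`. -/
instance [IsWStarCategory C] : IsWStarCategory (FinFamily C) where
  exists_predual X Y := by
    obtain ⟨V, hV⟩ := exists_isPredualOn_endOp (sum ![X, Y])
    exact hasPredual_of_endOp hV ((isDirectSum_sumIncl ![X, Y]).isometry 0)
      ((isDirectSum_sumIncl ![X, Y]).isometry 1)

end FinFamily

/-! ### Matrix W*-algebras -/

open StarCategory

namespace FinFamily

variable {C : Type u} [Category.{v} C] [CStarCategory C]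

open CStarCategory

lemma norm_of_support {X Y : FinFamily C} (a : X ⟶ Y) (i : Fin Y.card) (j : Fin X.card)
    (h : ∀ k l, (k, l) ≠ (i, j) → a k l = 0) : ‖a‖ = ‖a i j‖ := by
  refine le_antisymm ((norm_le_sum_entries a).trans_eq ?_) (norm_entry_le a i j)
  rw [Finset.sum_eq_single i, Finset.sum_eq_single j]
  · intro l _ hl
    rw [h i l (fun e => hl (Prod.mk.inj e).2), norm_zero]
  · simp
  · intro k _ hk
    exact Finset.sum_eq_zero fun l _ => by
      rw [h k l (fun e => hk (Prod.mk.inj e).1), norm_zero]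
  · simp

theorem wStarAlgebra_matAlg [IsWStarCategory C] (X : FinFamily C) :
    @WStarAlgebra (MatAlg X.obj) (matCStarAlgebra X) := by
  let := matCStarAlgebra X
  obtain ⟨V, hV⟩ := exists_isPredualOn_endOp X
  -- `EndOp X` carries the opposite multiplication, but a predual concerns only the normed space.
  have hV' : IsPredualOn (⊤ : Submodule ℂ (MatAlg X.obj)) V := hV
  exact hV'.wStarAlgebra

theorem exists_wStarAlgebra_matAlg [IsWStarCategory C] {n : ℕ} (X : Fin n → C) :
    ∃ (B : Type v) (_ : CStarAlgebra B) (_ : WStarAlgebra B) (φ : MatAlg X ≃⋆ₐ[ℂ] B),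
      ∀ (i j : Fin n) (a : MatAlg X),
        (∀ k l, (k, l) ≠ (i, j) → a k l = 0) → ‖φ a‖ = ‖a i j‖ :=
  ⟨MatAlg X, matCStarAlgebra ⟨n, X⟩, wStarAlgebra_matAlg ⟨n, X⟩, StarAlgEquiv.refl _ _,
    fun i j a h => norm_of_support (X := ⟨n, X⟩) (Y := ⟨n, X⟩) a i j h⟩

theorem isWStarAlgebra_matAlg [IsWStarCategory C] {n : ℕ} (X : Fin n → C) :
    IsWStarAlgebra (MatAlg X) := by
  obtain ⟨B, i1, i2, φ, -⟩ := exists_wStarAlgebra_matAlg X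
  exact ⟨B, i1, i2, ⟨φ⟩⟩

/-- A *-isomorphism of C*-algebras is isometric, so the predual of the W*-algebra passes to the
matrices and then to the corner belonging to the entry. -/
theorem hasPredual_of_isWStarAlgebra {n : ℕ} {X : Fin n → C} (h : IsWStarAlgebra (MatAlg X))
    (i j : Fin n) : HasPredual (X i) (X j) := by
  obtain ⟨B, _, _, ⟨ψ⟩⟩ := h
  let := matCStarAlgebra ⟨n, X⟩
  have hψ : ∀ a, ‖ψ a‖ = ‖a‖ := StarAlgEquiv.norm_map ψ
  obtain ⟨P, _, _, _, ⟨Φ⟩⟩ := WStarAlgebra.exists_predual (M := B)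
  let S : FinFamily C := ⟨n, X⟩
  let k : EndOp S →ₗ[ℂ] B :=
    { toFun := fun a => ψ a
      map_add' := fun a b => map_add ψ a b
      map_smul' := fun c a => map_smul ψ c a }
  obtain ⟨V, hV⟩ := exists_isPredualOn_of_predual (W := ⊤) k (fun a _ => hψ a)
    (fun x => ⟨ψ.symm x, trivial, ψ.apply_symm_apply x⟩)
    (Φ.trans (starₗᵢ ℂ : B ≃ₗᵢ⋆[ℂ] B)).symm
  exact (hasPredual_embedding_iff _ _).mp (hasPredual_of_endOp hV
    ((isDirectSum_incl S).isometry i) ((isDirectSum_incl S).isometry j))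

theorem isWStarCategory_iff :
    IsWStarCategory C ↔ ∀ X Y : C, IsWStarAlgebra (MatAlg ![X, Y]) :=
  ⟨fun _ _ _ => isWStarAlgebra_matAlg _,
    fun h => ⟨fun X Y => hasPredual_of_isWStarAlgebra (h X Y) 0 1⟩⟩

end FinFamily

/-! ### Morphisms between direct sums -/

namespace StarCategory

section DirectSumMorphisms

variable {C : Type u} [Category.{v} C] [StarCategory C]

lemma IsUnitary.adj {X Y : C} {f : X ⟶ Y} (hf : IsUnitary f) : IsUnitary (adj f) :=
  ⟨by rw [adj_adj]; exact hf.2, by rw [adj_adj]; exact hf.1⟩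

lemma IsUnitary.comp {X Y Z : C} {f : X ⟶ Y} {g : Y ⟶ Z} (hf : IsUnitary f) (hg : IsUnitary g) :
    IsUnitary (f ≫ g) := by
  constructor
  · rw [adj_comp, Category.assoc, ← Category.assoc g, hg.1, Category.id_comp, hf.1]
  · rw [adj_comp, Category.assoc, ← Category.assoc _ f, hf.2, Category.id_comp, hg.2]

lemma isUnitary_id (X : C) : IsUnitary (𝟙 X) := by
  constructor <;> rw [adj_id, Category.comp_id]

/-- The isomorphism given by a unitary. -/
def IsUnitary.iso {X Y : C} {f : X ⟶ Y} (hf : IsUnitary f) : X ≅ Y where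
  hom := f
  inv := StarCategory.adj f
  hom_inv_id := hf.1
  inv_hom_id := hf.2

lemma IsUnitary.adj_eq_inv {X Y : C} {f : X ≅ Y} (hf : IsUnitary f.hom) :
    StarCategory.adj f.hom = f.inv := by
  rw [← cancel_mono f.hom, hf.2, f.inv_hom_id]

variable {n m l : ℕ} {X : Fin n → C} {S : C} {s : ∀ i, X i ⟶ S}
  {Y : Fin m → C} {T : C} {t : ∀ i, Y i ⟶ T} {Z : Fin l → C} {R : C} {r : ∀ i, Z i ⟶ R}

namespace IsDirectSum

lemma comp_adj_self (hs : IsDirectSum X S s) {W : C} (i : Fin n) (f : X i ⟶ W) :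
    s i ≫ adj (s i) ≫ f = f := by
  rw [← Category.assoc, hs.isometry, Category.id_comp]

lemma comp_sum (hs : IsDirectSum X S s) {W : C} (f : ∀ i, X i ⟶ W) (i : Fin n) :
    s i ≫ ∑ j, adj (s j) ≫ f j = f i := by
  rw [Preadditive.comp_sum, Finset.sum_eq_single i]
  · exact hs.comp_adj_self i (f i)
  · intro j _ hj
    rw [← Category.assoc, hs.orthogonal i j hj.symm, Limits.zero_comp]
  · simp

lemma sum_comp_adj (hs : IsDirectSum X S s) {W : C} (f : ∀ i, W ⟶ X i) (i : Fin n) :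
    (∑ j, f j ≫ s j) ≫ adj (s i) = f i := by
  rw [Preadditive.sum_comp, Finset.sum_eq_single i]
  · rw [Category.assoc, hs.isometry, Category.comp_id]
  · intro j _ hj
    rw [Category.assoc, hs.orthogonal j i hj, Limits.comp_zero]
  · simp

lemma eq_sum_adj_comp (hs : IsDirectSum X S s) {W : C} (f : S ⟶ W) :
    f = ∑ i, adj (s i) ≫ s i ≫ f := by
  simp only [← Category.assoc]
  rw [← Preadditive.sum_comp, hs.total, Category.id_comp]

lemma eq_sum_comp (hs : IsDirectSum X S s) {W : C} (f : W ⟶ S) :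
    f = ∑ i, (f ≫ adj (s i)) ≫ s i := by
  simp only [Category.assoc]
  rw [← Preadditive.comp_sum, hs.total, Category.comp_id]

lemma hom_ext (hs : IsDirectSum X S s) {W : C} {f g : S ⟶ W}
    (h : ∀ i, s i ≫ f = s i ≫ g) : f = g := by
  rw [hs.eq_sum_adj_comp f, hs.eq_sum_adj_comp g]
  simp only [h]

lemma hom_ext_right (hs : IsDirectSum X S s) {W : C} {f g : W ⟶ S}
    (h : ∀ i, f ≫ adj (s i) = g ≫ adj (s i)) : f = g := by
  rw [hs.eq_sum_comp f, hs.eq_sum_comp g]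
  simp only [h]

lemma hom_ext₂ (hs : IsDirectSum X S s) (ht : IsDirectSum Y T t) {f g : S ⟶ T}
    (h : ∀ i j, s i ≫ f ≫ adj (t j) = s i ≫ g ≫ adj (t j)) : f = g :=
  hs.hom_ext fun i => ht.hom_ext_right fun j => by simpa using h i j

/-- The diagonal morphism of direct sums with the given entries. -/
def diag {X' : Fin n → C} {S' : C} (s : ∀ i, X i ⟶ S) (s' : ∀ i, X' i ⟶ S')
    (θ : ∀ i, X i ⟶ X' i) : S ⟶ S' :=
  ∑ i, adj (s i) ≫ θ i ≫ s' i

variable {X' : Fin n → C} {S' : C} {s' : ∀ i, X' i ⟶ S'}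

lemma comp_diag (hs : IsDirectSum X S s) (θ : ∀ i, X i ⟶ X' i) (i : Fin n) :
    s i ≫ diag s s' θ = θ i ≫ s' i :=
  hs.comp_sum (fun i => θ i ≫ s' i) i

lemma adj_diag (θ : ∀ i, X i ⟶ X' i) : adj (diag s s' θ) = diag s' s fun i => adj (θ i) := by
  simp only [diag, adj_sum, adj_comp, adj_adj, Category.assoc]

lemma isUnitary_diag (hs : IsDirectSum X S s) (hs' : IsDirectSum X' S' s')
    {θ : ∀ i, X i ⟶ X' i} (hθ : ∀ i, IsUnitary (θ i)) : IsUnitary (diag s s' θ) := by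
  rw [IsUnitary, adj_diag]
  constructor
  · refine hs.hom_ext fun i => ?_
    rw [← Category.assoc, hs.comp_diag, Category.assoc, hs'.comp_diag, ← Category.assoc,
      (hθ i).1, Category.id_comp, Category.comp_id]
  · refine hs'.hom_ext fun i => ?_
    rw [← Category.assoc, hs'.comp_diag, Category.assoc, hs.comp_diag, ← Category.assoc,
      (hθ i).2, Category.id_comp, Category.comp_id]

/-- The morphism of direct sums with a given matrix. -/
def assemble (s : ∀ i, X i ⟶ S) (t : ∀ i, Y i ⟶ T) (a : ∀ i j, X i ⟶ Y j) : S ⟶ T :=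
  ∑ i, adj (s i) ≫ ∑ j, a i j ≫ t j

lemma comp_assemble (hs : IsDirectSum X S s) (a : ∀ i j, X i ⟶ Y j) (i : Fin n) :
    s i ≫ assemble s t a = ∑ j, a i j ≫ t j :=
  hs.comp_sum (fun i => ∑ j, a i j ≫ t j) i

lemma comp_assemble_comp_adj (hs : IsDirectSum X S s) (ht : IsDirectSum Y T t)
    (a : ∀ i j, X i ⟶ Y j) (i : Fin n) (j : Fin m) :
    s i ≫ assemble s t a ≫ adj (t j) = a i j := by
  rw [← Category.assoc, hs.comp_assemble, ht.sum_comp_adj]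

/-- Inserting the resolution of the identity of the middle object: matrix multiplication. -/
lemma comp_eq_sum (ht : IsDirectSum Y T t) {V W : C} (f : V ⟶ T) (g : T ⟶ W) :
    f ≫ g = ∑ j, (f ≫ adj (t j)) ≫ t j ≫ g := by
  nth_rewrite 1 [ht.eq_sum_comp f]
  rw [Preadditive.sum_comp]
  simp only [Category.assoc]

end IsDirectSum

end DirectSumMorphisms

section Functors

variable {C : Type u} [Category.{v} C] [StarCategory C]
variable {D : Type u₁} [Category.{v₁} D] [StarCategory D]
variable {E : Type u₂} [Category.{v₂} E] [StarCategory E]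

namespace IsStarFunctor

variable {F : C ⥤ D}

lemma additive (hF : IsStarFunctor F) : F.Additive := ⟨hF.map_add _ _⟩

lemma map_zero (hF : IsStarFunctor F) (X Y : C) : F.map (0 : X ⟶ Y) = 0 :=
  haveI := hF.additive
  F.map_zero X Y

lemma map_sum (hF : IsStarFunctor F) {ι : Type*} (s : Finset ι) {X Y : C} (f : ι → (X ⟶ Y)) :
    F.map (∑ i ∈ s, f i) = ∑ i ∈ s, F.map (f i) :=
  haveI := hF.additive
  F.map_sum f s

lemma isDirectSum (hF : IsStarFunctor F) {n : ℕ} {X : Fin n → C} {S : C} {s : ∀ i, X i ⟶ S} (hs : IsDirectSum X S s) :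
    IsDirectSum (fun i => F.obj (X i)) (F.obj S) (fun i => F.map (s i)) where
  isometry i := by rw [← hF.map_adj, ← F.map_comp, hs.isometry, F.map_id]
  orthogonal i j hij := by
    rw [← hF.map_adj, ← F.map_comp, hs.orthogonal i j hij, hF.map_zero]
  total := by
    simp only [← hF.map_adj, ← F.map_comp]
    rw [← hF.map_sum, hs.total, F.map_id]

lemma isDirectSum_preimage (hF : IsStarFunctor F) [F.Full] [F.Faithful] {n : ℕ} {X : Fin n → C} {S : C}
    {s : ∀ i, F.obj (X i) ⟶ F.obj S} (hs : IsDirectSum (fun i => F.obj (X i)) (F.obj S) s) :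
    IsDirectSum X S (fun i => F.preimage (s i)) where
  isometry i := F.map_injective <| by
    rw [F.map_comp, hF.map_adj, F.map_preimage, hs.isometry, F.map_id]
  orthogonal i j hij := F.map_injective <| by
    rw [F.map_comp, hF.map_adj, F.map_preimage, F.map_preimage, hs.orthogonal i j hij,
      hF.map_zero]
  total := F.map_injective <| by
    simp only [hF.map_sum, F.map_comp, hF.map_adj, F.map_preimage]
    rw [hs.total, F.map_id]

end IsStarFunctor

end Functors

end StarCategory

/-! ### The universal property -/

namespace StarCategory

variable {C : Type u} [Category.{v} C] [StarCategory C]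
variable {D : Type u₁} [Category.{v₁} D] [StarCategory D]
variable {E : Type u₂} [Category.{v₂} E] [StarCategory E]

/-- A decomposition of `Y` into images of objects under `J`, with a direct sum of the images of
the same objects under `F`. -/
structure Decomposition (J : C ⥤ D) (F : C ⥤ E) (Y : D) where
  card : ℕ
  obj : Fin card → C
  incl : ∀ i, J.obj (obj i) ⟶ Y
  isDirectSum : IsDirectSum (fun i => J.obj (obj i)) Y incl
  sum : E
  sumIncl : ∀ i, F.obj (obj i) ⟶ sum
  isDirectSum_sum : IsDirectSum (fun i => F.obj (obj i)) sum sumIncl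

lemma IsDirectSumExtension.nonempty_decomposition {J : C ⥤ D} (hJ : IsDirectSumExtension J)
    (F : C ⥤ E) (hE : HasFiniteDirectSums E) (Y : D) : Nonempty (Decomposition J F Y) := by
  obtain ⟨n, X, s, hs⟩ := hJ.generated Y
  obtain ⟨T, t, ht⟩ := hE n fun i => F.obj (X i)
  exact ⟨⟨n, X, s, hs, T, t, ht⟩⟩

namespace Decomposition

set_option linter.unusedSectionVars false

variable {J : C ⥤ D} [J.Full] [J.Faithful] {F : C ⥤ E}

/-- The image under `F` of the matrix entries of a morphism. -/
noncomputable def entry {Y Y' : D} (d : Decomposition J F Y) (d' : Decomposition J F Y')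
    (f : Y ⟶ Y') (i : Fin d.card) (j : Fin d'.card) : F.obj (d.obj i) ⟶ F.obj (d'.obj j) :=
  F.map (J.preimage (d.incl i ≫ f ≫ adj (d'.incl j)))

variable {Y Y' Y'' : D} (d : Decomposition J F Y) (d' : Decomposition J F Y')
  (d'' : Decomposition J F Y'')

/-- Fullness of `J` makes each block a morphism of `C`, so the matrix product is taken in `C`;
faithfulness lets it be verified after `J`. -/
lemma entry_comp (hJ : IsStarFunctor J) (hF : IsStarFunctor F) (f : Y ⟶ Y') (g : Y' ⟶ Y'')
    (i : Fin d.card) (k : Fin d''.card) :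
    d.entry d'' (f ≫ g) i k = ∑ j, d.entry d' f i j ≫ d'.entry d'' g j k := by
  simp only [entry, ← F.map_comp]
  rw [← hF.map_sum]
  congr 1
  apply J.map_injective
  rw [hJ.map_sum]
  simp only [J.map_comp, J.map_preimage]
  rw [Category.assoc, ← Category.assoc, d'.isDirectSum.comp_eq_sum]
  simp only [Category.assoc]

lemma entry_adj (hJ : IsStarFunctor J) (hF : IsStarFunctor F) (f : Y ⟶ Y')
    (i : Fin d.card) (j : Fin d'.card) : d'.entry d (adj f) j i = adj (d.entry d' f i j) := by
  simp only [entry, ← hF.map_adj]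
  congr 1
  apply J.map_injective
  simp only [hJ.map_adj, J.map_preimage, adj_comp, adj_adj, Category.assoc]

lemma entry_add (hJ : IsStarFunctor J) (hF : IsStarFunctor F) (f g : Y ⟶ Y')
    (i : Fin d.card) (j : Fin d'.card) :
    d.entry d' (f + g) i j = d.entry d' f i j + d.entry d' g i j := by
  simp only [entry, ← hF.map_add]
  congr 1
  apply J.map_injective
  simp only [hJ.map_add, J.map_preimage, Preadditive.add_comp, Preadditive.comp_add]

lemma entry_smul (hJ : IsStarFunctor J) (hF : IsStarFunctor F) (c : ℂ) (f : Y ⟶ Y')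
    (i : Fin d.card) (j : Fin d'.card) : d.entry d' (c • f) i j = c • d.entry d' f i j := by
  simp only [entry, ← hF.map_smul]
  congr 1
  apply J.map_injective
  simp only [hJ.map_smul, J.map_preimage, Linear.smul_comp, Linear.comp_smul]

/-- Both decompositions use the same objects of `C`, hence have the same Kronecker delta; stating it
through the inclusions avoids a cast along `i = j`. -/
lemma entry_id (hJ : IsStarFunctor J) (hF : IsStarFunctor F) (i j : Fin d.card) :
    d.entry d (𝟙 Y) i j = d.sumIncl i ≫ adj (d.sumIncl j) := by
  rw [entry, Category.id_comp]
  rcases eq_or_ne i j with rfl | h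
  · rw [d.isDirectSum.isometry, d.isDirectSum_sum.isometry, ← F.map_id]
    congr 1
    apply J.map_injective
    rw [J.map_preimage, J.map_id]
  · rw [d.isDirectSum.orthogonal i j h, d.isDirectSum_sum.orthogonal i j h, ← hF.map_zero]
    congr 1
    apply J.map_injective
    rw [J.map_preimage, hJ.map_zero]

/-- The morphism of direct sums with the image under `F` of the matrix of `f`. -/
noncomputable def extend (f : Y ⟶ Y') : d.sum ⟶ d'.sum :=
  IsDirectSum.assemble d.sumIncl d'.sumIncl (d.entry d' f)

lemma sumIncl_extend_adj (f : Y ⟶ Y') (i : Fin d.card) (j : Fin d'.card) :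
    d.sumIncl i ≫ d.extend d' f ≫ adj (d'.sumIncl j) = d.entry d' f i j :=
  d.isDirectSum_sum.comp_assemble_comp_adj d'.isDirectSum_sum _ i j

lemma sumIncl_extend (f : Y ⟶ Y') (i : Fin d.card) :
    d.sumIncl i ≫ d.extend d' f = ∑ j, d.entry d' f i j ≫ d'.sumIncl j :=
  d.isDirectSum_sum.comp_assemble _ i

lemma extend_add (hJ : IsStarFunctor J) (hF : IsStarFunctor F) (f g : Y ⟶ Y') :
    d.extend d' (f + g) = d.extend d' f + d.extend d' g :=
  d.isDirectSum_sum.hom_ext₂ d'.isDirectSum_sum fun i k => by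
    rw [Preadditive.add_comp, Preadditive.comp_add]
    simp only [sumIncl_extend_adj]
    exact entry_add _ _ hJ hF _ _ _ _

lemma extend_smul (hJ : IsStarFunctor J) (hF : IsStarFunctor F) (c : ℂ) (f : Y ⟶ Y') :
    d.extend d' (c • f) = c • d.extend d' f :=
  d.isDirectSum_sum.hom_ext₂ d'.isDirectSum_sum fun i k => by
    rw [Linear.smul_comp, Linear.comp_smul]
    simp only [sumIncl_extend_adj]
    exact entry_smul _ _ hJ hF _ _ _ _

lemma extend_adj (hJ : IsStarFunctor J) (hF : IsStarFunctor F) (f : Y ⟶ Y') :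
    d'.extend d (adj f) = adj (d.extend d' f) :=
  d'.isDirectSum_sum.hom_ext₂ d.isDirectSum_sum fun i k => by
    have h : d'.sumIncl i ≫ adj (d.extend d' f) ≫ adj (d.sumIncl k) =
        adj (d.sumIncl k ≫ d.extend d' f ≫ adj (d'.sumIncl i)) := by
      simp only [adj_comp, adj_adj, Category.assoc]
    rw [h, sumIncl_extend_adj, sumIncl_extend_adj, entry_adj _ _ hJ hF]

/-- The extension of `F` along `J` given by a choice of decompositions. -/
noncomputable def functor (hJ : IsStarFunctor J) (hF : IsStarFunctor F)
    (d : ∀ Y : D, Decomposition J F Y) : D ⥤ E where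
  obj Y := (d Y).sum
  map f := (d _).extend (d _) f
  map_id Y := (d Y).isDirectSum_sum.hom_ext₂ (d Y).isDirectSum_sum fun i j => by
    rw [sumIncl_extend_adj, entry_id _ hJ hF, Category.id_comp]
  map_comp {X Y Z} f g := (d X).isDirectSum_sum.hom_ext₂ (d Z).isDirectSum_sum fun i k => by
    rw [sumIncl_extend_adj, entry_comp _ (d Y) _ hJ hF, Category.assoc, ← Category.assoc,
      (d Y).isDirectSum_sum.comp_eq_sum]
    simp only [Category.assoc, sumIncl_extend_adj]

lemma isStarFunctor_functor (hJ : IsStarFunctor J) (hF : IsStarFunctor F)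
    (d : ∀ Y : D, Decomposition J F Y) : IsStarFunctor (functor hJ hF d) where
  map_add f g := extend_add _ _ hJ hF f g
  map_smul c f := extend_smul _ _ hJ hF c f
  map_adj f := extend_adj _ _ hJ hF f

/-- The images under `F` of the inclusions in a decomposition of `J.obj X`. -/
noncomputable def imageIncl {X : C} (d : Decomposition J F (J.obj X)) (i : Fin d.card) :
    F.obj (d.obj i) ⟶ F.obj X :=
  F.map (J.preimage (d.incl i))

lemma isDirectSum_imageIncl (hJ : IsStarFunctor J) (hF : IsStarFunctor F) {X : C}
    (d : Decomposition J F (J.obj X)) :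
    IsDirectSum (fun i => F.obj (d.obj i)) (F.obj X) d.imageIncl :=
  hF.isDirectSum (hJ.isDirectSum_preimage d.isDirectSum)

/-- The comparison of the chosen direct sum with the value of `F`. -/
noncomputable def comparison {X : C} (d : Decomposition J F (J.obj X)) : d.sum ⟶ F.obj X :=
  IsDirectSum.diag d.sumIncl d.imageIncl fun _ => 𝟙 _

lemma sumIncl_comparison {X : C} (d : Decomposition J F (J.obj X)) (i : Fin d.card) :
    d.sumIncl i ≫ d.comparison = d.imageIncl i :=
  (d.isDirectSum_sum.comp_diag _ i).trans (Category.id_comp _)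

lemma isUnitary_comparison (hJ : IsStarFunctor J) (hF : IsStarFunctor F) {X : C}
    (d : Decomposition J F (J.obj X)) : IsUnitary d.comparison :=
  d.isDirectSum_sum.isUnitary_diag (d.isDirectSum_imageIncl hJ hF) fun _ => isUnitary_id _

/-- The chosen decomposition of `J X` comes from one of `X` by full faithfulness, and `F` maps that
to a decomposition of `F X`; in these coordinates `F.map f` has the entries used in `extend`. -/
lemma extend_comparison (hJ : IsStarFunctor J) (hF : IsStarFunctor F) {X X' : C} (f : X ⟶ X')
    (d : Decomposition J F (J.obj X)) (d' : Decomposition J F (J.obj X')) :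
    d.extend d' (J.map f) ≫ d'.comparison = d.comparison ≫ F.map f :=
  d.isDirectSum_sum.hom_ext fun i => by
    have h : ∀ j, d.entry d' (J.map f) i j = (d.imageIncl i ≫ F.map f) ≫ adj (d'.imageIncl j) :=
      fun j => by
        simp only [entry, imageIncl, ← hF.map_adj, ← F.map_comp]
        congr 1
        apply J.map_injective
        simp only [J.map_comp, hJ.map_adj, J.map_preimage, Category.assoc]
    rw [← Category.assoc, sumIncl_extend, ← Category.assoc, sumIncl_comparison,
      (d'.isDirectSum_imageIncl hJ hF).eq_sum_comp (d.imageIncl i ≫ F.map f),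
      Preadditive.sum_comp]
    refine Finset.sum_congr rfl fun j _ => ?_
    rw [h, Category.assoc _ (d'.sumIncl j), sumIncl_comparison]

/-- The chosen extension restricts to `F`. -/
noncomputable def functorIso (hJ : IsStarFunctor J) (hF : IsStarFunctor F)
    (d : ∀ Y : D, Decomposition J F Y) : J ⋙ functor hJ hF d ≅ F :=
  NatIso.ofComponents (fun X => ((d (J.obj X)).isUnitary_comparison hJ hF).iso)
    fun f => extend_comparison hJ hF f _ _

end Decomposition

theorem IsDirectSumExtension.exists_extension {J : C ⥤ D} (hJ : IsDirectSumExtension J)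
    {F : C ⥤ E} (hF : IsStarFunctor F) (hE : HasFiniteDirectSums E) :
    ∃ (G : D ⥤ E) (α : J ⋙ G ≅ F), IsStarFunctor G ∧ IsUnitaryIso α := by
  have := hJ.full
  have := hJ.faithful
  let d := fun Y => (hJ.nonempty_decomposition F hE Y).some
  exact ⟨Decomposition.functor hJ.isStarFunctor hF d,
    Decomposition.functorIso hJ.isStarFunctor hF d,
    Decomposition.isStarFunctor_functor hJ.isStarFunctor hF d,
    fun X => (d (J.obj X)).isUnitary_comparison hJ.isStarFunctor hF⟩

section Comparison

variable {J : C ⥤ D} {G G' : D ⥤ E} (θ : J ⋙ G ≅ J ⋙ G')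

/-- Naturality along the inclusions of a decomposition forces the components to be diagonal, which
gives uniqueness. The diagonal maps are compatible with every morphism out of an object of the image
of `J`, not only with the chosen inclusions, and this yields naturality. -/
theorem IsDirectSumExtension.exists_iso (hJ : IsDirectSumExtension J) (hG : IsStarFunctor G)
    (hG' : IsStarFunctor G') (hθ : IsUnitaryIso θ) :
    ∃ β : G ≅ G', IsUnitaryIso β ∧ Functor.whiskerLeft J β.hom = θ.hom ∧
      ∀ γ : G ⟶ G', Functor.whiskerLeft J γ = θ.hom → γ = β.hom := by
  have := hJ.full
  choose n X s hs using hJ.generated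
  let β : ∀ Y, G.obj Y ⟶ G'.obj Y := fun Y =>
    IsDirectSum.diag (fun i => G.map (s Y i)) (fun i => G'.map (s Y i))
      fun i => θ.hom.app (X Y i)
  have hβi : ∀ Y i, G.map (s Y i) ≫ β Y = θ.hom.app (X Y i) ≫ G'.map (s Y i) := fun Y i =>
    (hG.isDirectSum (hs Y)).comp_diag _ i
  -- The blocks of `w` come from `C` by fullness of `J`, where `θ` is natural.
  have hβ : ∀ {Z : C} {Y : D} (w : J.obj Z ⟶ Y),
      G.map w ≫ β Y = θ.hom.app Z ≫ G'.map w := fun {Z Y} w => by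
    have key : ∀ i, G.map (w ≫ adj (s Y i)) ≫ θ.hom.app (X Y i) =
        θ.hom.app Z ≫ G'.map (w ≫ adj (s Y i)) := fun i => by
      obtain ⟨m, hm⟩ := J.map_surjective (w ≫ adj (s Y i))
      rw [← hm]
      exact θ.hom.naturality m
    rw [(hs Y).eq_sum_comp w, hG.map_sum, hG'.map_sum, Preadditive.sum_comp,
      Preadditive.comp_sum]
    refine Finset.sum_congr rfl fun i _ => ?_
    rw [G.map_comp, G'.map_comp, Category.assoc, hβi, ← Category.assoc, key, Category.assoc]
  have hβu : ∀ Y, IsUnitary (β Y) := fun Y =>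
    (hG.isDirectSum (hs Y)).isUnitary_diag (hG'.isDirectSum (hs Y)) fun i => hθ (X Y i)
  refine ⟨NatIso.ofComponents (fun Y => (hβu Y).iso) fun {Y Y'} f => ?_, hβu, ?_, ?_⟩
  · refine (hG.isDirectSum (hs Y)).hom_ext fun i => ?_
    change G.map (s Y i) ≫ G.map f ≫ β Y' = G.map (s Y i) ≫ β Y ≫ G'.map f
    rw [← Category.assoc, ← Category.assoc, ← G.map_comp, hβ, hβ, G'.map_comp, Category.assoc]
  · ext Z
    change β (J.obj Z) = θ.hom.app Z
    have h := hβ (𝟙 (J.obj Z))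
    rw [G.map_id, G'.map_id, Category.id_comp] at h
    exact h.trans (Category.comp_id _)
  · intro γ hγ
    ext Y
    refine (hG.isDirectSum (hs Y)).hom_ext fun i => ?_
    change G.map (s Y i) ≫ γ.app Y = G.map (s Y i) ≫ β Y
    rw [γ.naturality, hβi, ← hγ]
    rfl

end Comparison

theorem IsDirectSumExtension.exists_unique_iso {J : C ⥤ D} (hJ : IsDirectSumExtension J)
    {F : C ⥤ E} {G G' : D ⥤ E} (α : J ⋙ G ≅ F) (α' : J ⋙ G' ≅ F) (hG : IsStarFunctor G)
    (hG' : IsStarFunctor G') (hα : IsUnitaryIso α) (hα' : IsUnitaryIso α') :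
    ∃ β : G ≅ G', IsUnitaryIso β ∧ Functor.whiskerLeft J β.hom ≫ α'.hom = α.hom ∧
      ∀ γ : G ⟶ G', Functor.whiskerLeft J γ ≫ α'.hom = α.hom → γ = β.hom := by
  obtain ⟨β, h1, h2, h3⟩ := hJ.exists_iso (α ≪≫ α'.symm) hG hG' fun X => by
    have h : adj (α'.hom.app X) = α'.inv.app X :=
      (show IsUnitary (α'.app X).hom from hα' X).adj_eq_inv
    have := (hα X).comp (hα' X).adj
    rwa [h] at this
  refine ⟨β, h1, ?_, fun γ hγ => h3 γ ?_⟩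
  · rw [h2, Iso.trans_hom, Category.assoc, Iso.symm_hom, α'.inv_hom_id, Category.comp_id]
  · rw [Iso.trans_hom, ← hγ, Category.assoc, Iso.symm_hom, α'.hom_inv_id, Category.comp_id]

/-- Since `J ⋙ G` is isomorphic to `F`, it is fully faithful; matrix entries carry this over to `G`.
Each object of `E` is a direct sum of objects `F X`, hence unitarily isomorphic to the image of the
corresponding direct sum in `D`. -/
theorem IsDirectSumExtension.isUnitaryEquivalence {J : C ⥤ D} (hJ : IsDirectSumExtension J)
    {F : C ⥤ E} (hF : IsDirectSumExtension F) {G : D ⥤ E} (α : J ⋙ G ≅ F)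
    (hG : IsStarFunctor G) (hα : IsUnitaryIso α) : IsUnitaryEquivalence G := by
  have := hJ.full
  have := hF.full
  have := hF.faithful
  have : (J ⋙ G).Full := Functor.Full.of_iso α.symm
  have : (J ⋙ G).Faithful := Functor.Faithful.of_iso α.symm
  refine ⟨hG, ⟨fun {Y Y'} g => ?_⟩, ⟨fun {Y Y'} f f' h => ?_⟩, fun Y => ?_⟩
  · obtain ⟨n, X, s, hs⟩ := hJ.generated Y
    obtain ⟨n', X', s', hs'⟩ := hJ.generated Y'
    choose m hm using fun i j =>
      (J ⋙ G).map_surjective (G.map (s i) ≫ g ≫ adj (G.map (s' j)))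
    refine ⟨IsDirectSum.assemble s s' fun i j => J.map (m i j), ?_⟩
    refine (hG.isDirectSum hs).hom_ext₂ (hG.isDirectSum hs') fun i j => ?_
    rw [← hm, ← hG.map_adj, ← G.map_comp, ← G.map_comp, hs.comp_assemble_comp_adj hs']
    rfl
  · obtain ⟨n, X, s, hs⟩ := hJ.generated Y
    obtain ⟨n', X', s', hs'⟩ := hJ.generated Y'
    refine hs.hom_ext₂ hs' fun i j => ?_
    obtain ⟨m, hm⟩ := J.map_surjective (s i ≫ f ≫ adj (s' j))
    obtain ⟨m', hm'⟩ := J.map_surjective (s i ≫ f' ≫ adj (s' j))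
    rw [← hm, ← hm', (J ⋙ G).map_injective (a₁ := m) (a₂ := m')]
    rw [Functor.comp_map, Functor.comp_map, hm, hm']
    simp only [G.map_comp, h]
  · obtain ⟨n, X, s, hs⟩ := hF.generated Y
    obtain ⟨S, t, ht⟩ := hJ.hasFiniteDirectSums n fun i => J.obj (X i)
    exact ⟨S, _, (hG.isDirectSum ht).isUnitary_diag hs fun i => hα (X i)⟩

end StarCategory

open StarCategory in
theorem proposition1p3 (C : Type u) [Category.{v} C] [CStarCategory C] :
    -- a C*-category is a W*-category iff all its 2 by 2 linking algebras are W*-algebras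
    (IsWStarCategory C ↔ ∀ X Y : C, IsWStarAlgebra (MatAlg ![X, Y])) ∧
    (IsWStarCategory C →
      -- the matrix algebra of a finite family is a W*-algebra, with isometric entries
      (∀ (n : ℕ) (X : Fin n → C),
        ∃ (B : Type v) (_ : CStarAlgebra B) (_ : WStarAlgebra B) (φ : MatAlg X ≃⋆ₐ[ℂ] B),
          ∀ (i j : Fin n) (a : MatAlg X),
            (∀ k l, (k, l) ≠ (i, j) → a k l = 0) → ‖φ a‖ = ‖a i j‖) ∧
      -- existence of a W*-category extending `C` that admits finite direct sums
      (∃ (D : Type u) (_ : Category.{v} D) (_ : CStarCategory D) (_ : IsWStarCategory D)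
        (J : C ⥤ D), IsDirectSumExtension J ∧
          ∀ {X Y : C} (f : X ⟶ Y), ‖J.map f‖ = ‖f‖) ∧
      -- uniqueness of the extension, through its universal property
      (∀ (D : Type u₁) [Category.{v₁} D] [CStarCategory D] [IsWStarCategory D]
        (J : C ⥤ D), IsDirectSumExtension J →
        ∀ (E : Type u₂) [Category.{v₂} E] [CStarCategory E] [IsWStarCategory E]
          (F : C ⥤ E), IsStarFunctor F → HasFiniteDirectSums E →
          (∃ (G : D ⥤ E) (α : J ⋙ G ≅ F), IsStarFunctor G ∧ IsUnitaryIso α) ∧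
          (∀ (G G' : D ⥤ E) (α : J ⋙ G ≅ F) (α' : J ⋙ G' ≅ F),
            IsStarFunctor G → IsStarFunctor G' → IsUnitaryIso α → IsUnitaryIso α' →
            ∃ β : G ≅ G', IsUnitaryIso β ∧ Functor.whiskerLeft J β.hom ≫ α'.hom = α.hom ∧
              ∀ γ : G ⟶ G', Functor.whiskerLeft J γ ≫ α'.hom = α.hom → γ = β.hom) ∧
          (IsDirectSumExtension F → ∀ (G : D ⥤ E) (α : J ⋙ G ≅ F),
            IsStarFunctor G → IsUnitaryIso α → IsUnitaryEquivalence G))) :=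
  ⟨FinFamily.isWStarCategory_iff, fun _ =>
    ⟨fun _ X => FinFamily.exists_wStarAlgebra_matAlg X,
      ⟨FinFamily C, inferInstance, inferInstance, inferInstance, FinFamily.embedding C,
        FinFamily.isDirectSumExtension_embedding, FinFamily.norm_embedding_map⟩,
      fun _ _ _ _ _ hJ _ _ _ _ _ hF hE =>
        ⟨hJ.exists_extension hF hE,
          fun _ _ α α' hG hG' hα hα' => hJ.exists_unique_iso α α' hG hG' hα hα',
          fun hF' _ α hG hα => hJ.isUnitaryEquivalence hF' α hG hα⟩⟩⟩
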